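/- Let $\mathbb{K}\in\{\mathbb{R},\mathbb{T}\}$ with $\mathbb{T}=\mathbb{R}/2\pi\mathbb{Z}$, and let $\mathcal{S}(\mathbb{R})$ denote the Schwartz functions on the line and $\mathcal{S}(\mathbb{T})=C^\infty(\mathbb{T})$ the smooth functions on the circle (all complex-valued). With $\hat f(\xi)=(2\pi)^{-1/2}\int_{\mathbb{K}} f(x)e^{-ix\xi}\,dx$ for $\xi\in\mathbb{R}$ (if $\mathbb{K}=\mathbb{R}$), respectively $\xi\in\mathbb{Z}$ (if $\mathbb{K}=\mathbb{T}$), let $$\|f\|_{B^s_{r,2}(\mathbb{K})}=\Big(\|\hat f\|_{L^2(|\xi|\le 1)}^r+\sum_{j\ge 1}2^{jsr}\,\|\hat f\|_{L^2(2^{j-1}<|\xi|\le 2^j)}^r\Big)^{1/r},$$ with the supremum in place of the $\ell^r$-sum if $r=\infty$; the $L^2$-norms in $\xi$ are taken with respect to Lebesgue measure on $\mathbb{R}$, respectively counting measure on $\mathbb{Z}$. **Theorem 1.** For every $0<s<\frac12$ and $r\in[1,\infty]$ there are constants $c=c(s,r)\in(0,1)$ and $C=C(s,r)<\infty$ such that,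 for $\mathbb{K}=\mathbb{R}$ and for $\mathbb{K}=\mathbb{T}$, every solution $q\in C^\infty(\mathbb{R};\mathcal{S}(\mathbb{K}))$ of the derivative nonlinear Schrödinger equation $$i\partial_t q+\partial_{xx}q+i\partial_x(|q|^2q)=0,\qquad (t,x)\in\mathbb{R}\times\mathbb{K},$$ with $\|q(0)\|_{L^2(\mathbb{K})}\le c$ satisfies $$\sup_{t\in\mathbb{R}}\|q(t)\|_{B^s_{r,2}(\mathbb{K})}\le C\,\|q(0)\|_{B^s_{r,2}(\mathbb{K})}.$$ -/

import Mathlib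

open MeasureTheory
open scoped ENNReal NNReal SchwartzMap FourierTransform ContDiff

noncomputable section

/-- The derivative nonlinear Schrödinger equation `i q_t + q_xx + i (|q|² q)_x = 0`, at every
`(t, x)`.  Functions on the circle `ℝ / 2πℤ` are `2π`-periodic functions of `x`. -/
def SolvesDNLS (q : ℝ → ℝ → ℂ) : Prop :=
  ∀ t x : ℝ,
    Complex.I * deriv (fun τ => q τ x) t
      + iteratedDeriv 2 (q t) x
      + Complex.I * deriv (fun y => ((‖q t y‖ : ℂ) ^ 2) * q t y) x = 0

/-- `q ∈ C^∞(ℝ; 𝓢(ℝ))`: a curve in the Fréchet space of Schwartz functions which has derivatives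
of all orders `Q 1, Q 2, …`, in the topology of the Schwartz space. -/
def IsSmoothSchwartzCurve (q : ℝ → 𝓢(ℝ, ℂ)) : Prop :=
  ∃ Q : ℕ → ℝ → 𝓢(ℝ, ℂ), Q 0 = q ∧ ∀ (n : ℕ) (t : ℝ), HasDerivAt (Q n) (Q (n + 1) t) t

/-- `q ∈ C^∞(ℝ; C^∞(𝕋)) = C^∞(ℝ × 𝕋)` with `𝕋 = ℝ / 2πℤ`. -/
def IsSmoothPeriodic (q : ℝ → ℝ → ℂ) : Prop :=
  ContDiff ℝ ∞ (Function.uncurry q) ∧ ∀ t : ℝ, Function.Periodic (q t) (2 * Real.pi)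

/-- The dyadic frequency regions: `|ξ| ≤ 1` for `j = 0` and `2^(j-1) < |ξ| ≤ 2^j` for `j ≥ 1`. -/
def dyadicShell : ℕ → Set ℝ
  | 0 => {ξ | |ξ| ≤ 1}
  | j + 1 => {ξ | (2 : ℝ) ^ j < |ξ| ∧ |ξ| ≤ (2 : ℝ) ^ (j + 1)}

/-- The `ℓ^r` norm (a supremum for `r = ∞`) of `2^(j s) a_j`, `j ≥ 0`. -/
def dyadicNorm (s : ℝ) (r : ℝ≥0∞) (a : ℕ → ℝ≥0∞) : ℝ≥0∞ :=
  eLpNorm (fun j : ℕ => ENNReal.ofReal ((2 : ℝ) ^ ((j : ℝ) * s)) * a j) r Measure.count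

/-- The unitary Fourier transform on the line in the angular frequency `ξ`,
`(2π)^(-1/2) ∫ f(x) e^{-i x ξ} dx`, expressed through Mathlib's normalization
`𝓕 f η = ∫ f(x) e^{-2π i x η} dx`. -/
def lineHat (f : ℝ → ℂ) (ξ : ℝ) : ℂ :=
  ((Real.sqrt (2 * Real.pi))⁻¹ : ℝ) * 𝓕 f (ξ / (2 * Real.pi))

/-- The Fourier coefficients `(2π)^(-1/2) ∫_0^{2π} f(x) e^{-i k x} dx` of a `2π`-periodic
function, for which Plancherel's identity is `∑ |f̂(k)|² = ∫_0^{2π} |f|²`. -/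
def circleHat (f : ℝ → ℂ) (k : ℤ) : ℂ :=
  ((Real.sqrt (2 * Real.pi))⁻¹ : ℝ) *
    ∫ x in (0 : ℝ)..(2 * Real.pi), f x * Complex.exp (-(Complex.I * k * x))

/-- The norm of `B^s_{r,2}(ℝ)`. -/
def lineBesovNorm (s : ℝ) (r : ℝ≥0∞) (f : ℝ → ℂ) : ℝ≥0∞ :=
  dyadicNorm s r fun j => eLpNorm (lineHat f) 2 (volume.restrict (dyadicShell j))

/-- The norm of `B^s_{r,2}(𝕋)`, for a `2π`-periodic function. -/
def circleBesovNorm (s : ℝ) (r : ℝ≥0∞) (f : ℝ → ℂ) : ℝ≥0∞ :=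
  dyadicNorm s r fun j =>
    eLpNorm (circleHat f) 2 (Measure.count.restrict {k : ℤ | (k : ℝ) ∈ dyadicShell j})

end

/-! The equation is completely integrable (Kaup-Newell). At the spectral parameter `z = iκ`, `κ ≥
1`, the spectral problem reduces to the Riccati equation `u' = -2κ u - iκ q̄ - q u²`. Small mass
makes it solvable by contraction with a bounded `u`, and `∫ q u` is conserved in time
(`IsEvolution.momentum_conserved`), because `q u` obeys a local conservation law.

Let `G = (∂ + 2κ)⁻¹`, which is `decayConv κ`. Inserting `u = -iκ conj(G q) - G(q u²)` into `∫ q u`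
and adding twice the imaginary part to the mass gives, up to a quartic error `N = ∫ q G(q u²)`, the
quadratic form `∫ ξ²/(4κ² + ξ²) |q̂|²` (`highEnergy_eq`). It is essentially the mass at frequencies
above `κ`, so this high-frequency mass can change in time only by the error.

With `κ = 2^j`, the error is at most `c²` times the square of `X_j = ∑_k 2^{-(j-k)₊/2} a_k`, where
`a_k` is the `L²` norm of `q̂` on the `k`-th shell: two factors `u` are measured by `κ ‖G q‖_∞`,
which Cauchy-Schwarz on the shells bounds by a multiple of `2^{j/2} X_j`, and the other two factors
by the mass (`IsRiccati.norm_integral_quartic_le`). Hence `a_j(t) ≤ 6 X_j(0) + 33 c X_j(t)`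
(`IsEvolution.shellNorm_le`).

For `0 < s < 1/2` the map `a ↦ X` is bounded on the weighted `ℓ^r`
(`exists_dyadicNorm_dyadicAverage_le`), so for small `c` the last term is absorbed
(`dyadicNorm_le_of_le_dyadicAverage`). The absorption needs the Besov norm at time `t` to be finite,
which smoothness guarantees.

Line and circle are treated together: `μ` is the measure in space, `ν` the measure in frequency, and
`p`, `W` record periodicity and decay. -/

/-! ### The resolvent of `∂ + 2κ` on bounded continuous functions. -/

section DecayConv

variable {E : Type*} [NormedAddCommGroup E]

/-- Bounded continuous functions on the line, as a predicate. -/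
structure IsBddCont (f : ℝ → E) : Prop where
  cont : Continuous f
  bdd : ∃ M : ℝ, ∀ x, ‖f x‖ ≤ M

theorem IsBddCont.add {f g : ℝ → E} (hf : IsBddCont f) (hg : IsBddCont g) :
    IsBddCont (fun x => f x + g x) := by
  obtain ⟨M, hM⟩ := hf.bdd
  obtain ⟨N, hN⟩ := hg.bdd
  exact ⟨hf.cont.add hg.cont, M + N, fun x => (norm_add_le _ _).trans (add_le_add (hM x) (hN x))⟩

theorem IsBddCont.neg {f : ℝ → E} (hf : IsBddCont f) : IsBddCont (fun x => -f x) := by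
  obtain ⟨M, hM⟩ := hf.bdd
  exact ⟨hf.cont.neg, M, fun x => by simpa using hM x⟩

theorem IsBddCont.sub {f g : ℝ → E} (hf : IsBddCont f) (hg : IsBddCont g) :
    IsBddCont (fun x => f x - g x) := by
  simpa only [sub_eq_add_neg] using hf.add hg.neg

theorem IsBddCont.mul {f g : ℝ → ℂ} (hf : IsBddCont f) (hg : IsBddCont g) :
    IsBddCont (fun x => f x * g x) := by
  obtain ⟨M, hM⟩ := hf.bdd
  obtain ⟨N, hN⟩ := hg.bdd
  refine ⟨hf.cont.mul hg.cont, M * N, fun x => ?_⟩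
  rw [norm_mul]
  exact mul_le_mul (hM x) (hN x) (norm_nonneg _) ((norm_nonneg _).trans (hM x))

theorem IsBddCont.pow {f : ℝ → ℂ} (hf : IsBddCont f) (n : ℕ) : IsBddCont (fun x => f x ^ n) := by
  induction n with
  | zero => exact ⟨by simpa using continuous_const, 1, fun x => by simp⟩
  | succ n ih => simpa only [pow_succ] using ih.mul hf

theorem isBddCont_const (c : E) : IsBddCont (fun _ : ℝ => c) :=
  ⟨continuous_const, ‖c‖, fun _ => le_rfl⟩

theorem IsBddCont.norm {f : ℝ → E} (hf : IsBddCont f) : IsBddCont (fun x => ‖f x‖) := by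
  obtain ⟨M, hM⟩ := hf.bdd
  exact ⟨hf.cont.norm, M, fun x => by simpa using hM x⟩

theorem IsBddCont.conj {f : ℝ → ℂ} (hf : IsBddCont f) :
    IsBddCont (fun x => (starRingEnd ℂ) (f x)) := by
  obtain ⟨M, hM⟩ := hf.bdd
  exact ⟨Complex.continuous_conj.comp hf.cont, M, fun x => by simpa using hM x⟩

variable [NormedSpace ℝ E]

/-- The solution `∫_0^∞ e^{-2κy} f(x-y) dy` of `v' = f - 2κ v`. -/
noncomputable def decayConv (κ : ℝ) (f : ℝ → E) (x : ℝ) : E :=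
  ∫ y in Set.Ioi (0 : ℝ), Real.exp (-(2 * κ) * y) • f (x - y)

variable {κ : ℝ}

theorem integrableOn_exp_decay (hκ : 0 < κ) :
    IntegrableOn (fun y : ℝ => Real.exp (-(2 * κ) * y)) (Set.Ioi 0) :=
  exp_neg_integrableOn_Ioi 0 (by linarith)

theorem integral_exp_decay (hκ : 0 < κ) :
    ∫ y in Set.Ioi (0 : ℝ), Real.exp (-(2 * κ) * y) = 1 / (2 * κ) := by
  rw [integral_exp_mul_Ioi (by linarith)]
  simp

theorem integrableOn_decay_smul (hκ : 0 < κ) {f : ℝ → E} (hf : IsBddCont f) (x : ℝ) :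
    IntegrableOn (fun y : ℝ => Real.exp (-(2 * κ) * y) • f (x - y)) (Set.Ioi 0) := by
  obtain ⟨M, hM⟩ := hf.bdd
  refine ((integrableOn_exp_decay hκ).mul_const M).mono' ?_ ?_
  · have := hf.cont
    exact Continuous.aestronglyMeasurable (by fun_prop)
  · refine Filter.Eventually.of_forall fun y => ?_
    rw [norm_smul, Real.norm_eq_abs, abs_of_pos (Real.exp_pos _)]
    exact mul_le_mul_of_nonneg_left (hM _) (Real.exp_pos _).le

theorem norm_decayConv_le_of_le (hκ : 0 < κ) {f : ℝ → E} {g : ℝ → ℝ} (hg : IsBddCont g)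
    (h : ∀ x, ‖f x‖ ≤ g x) (x : ℝ) : ‖decayConv κ f x‖ ≤ decayConv κ g x := by
  refine norm_integral_le_of_norm_le (integrableOn_decay_smul hκ hg x) ?_
  refine Filter.Eventually.of_forall fun y => ?_
  rw [norm_smul, Real.norm_eq_abs, abs_of_pos (Real.exp_pos _)]
  exact mul_le_mul_of_nonneg_left (h _) (Real.exp_pos _).le

theorem decayConv_const (hκ : 0 < κ) (M x : ℝ) : decayConv κ (fun _ => M) x = M / (2 * κ) := by
  unfold decayConv
  simp only [smul_eq_mul]
  rw [integral_mul_const, integral_exp_decay hκ]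
  ring

theorem norm_decayConv_le (hκ : 0 < κ) {f : ℝ → E} {M : ℝ} (h : ∀ x, ‖f x‖ ≤ M) (x : ℝ) :
    ‖decayConv κ f x‖ ≤ M / (2 * κ) := by
  rw [← decayConv_const hκ M x]
  exact norm_decayConv_le_of_le hκ (isBddCont_const M) h x

theorem decayConv_add (hκ : 0 < κ) {f g : ℝ → E} (hf : IsBddCont f) (hg : IsBddCont g) (x : ℝ) :
    decayConv κ (fun y => f y + g y) x = decayConv κ f x + decayConv κ g x := by
  unfold decayConv
  rw [← integral_add (integrableOn_decay_smul hκ hf x) (integrableOn_decay_smul hκ hg x)]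
  simp only [smul_add]

theorem decayConv_sub (hκ : 0 < κ) {f g : ℝ → E} (hf : IsBddCont f) (hg : IsBddCont g) (x : ℝ) :
    decayConv κ (fun y => f y - g y) x = decayConv κ f x - decayConv κ g x := by
  unfold decayConv
  rw [← integral_sub (integrableOn_decay_smul hκ hf x) (integrableOn_decay_smul hκ hg x)]
  simp only [smul_sub]

theorem decayConv_const_mul (c : ℂ) (f : ℝ → ℂ) (x : ℝ) :
    decayConv κ (fun y => c * f y) x = c * decayConv κ f x := by
  unfold decayConv
  rw [← integral_const_mul]
  congr 1
  ext y
  simp only [Complex.real_smul]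
  ring

theorem decayConv_real_const_mul (c : ℝ) (f : ℝ → ℝ) (x : ℝ) :
    decayConv κ (fun y => c * f y) x = c * decayConv κ f x := by
  unfold decayConv
  rw [← integral_const_mul]
  congr 1
  ext y
  simp only [smul_eq_mul]
  ring

theorem decayConv_conj (f : ℝ → ℂ) (x : ℝ) :
    decayConv κ (fun y => (starRingEnd ℂ) (f y)) x = (starRingEnd ℂ) (decayConv κ f x) := by
  unfold decayConv
  rw [← integral_conj]
  congr 1
  ext y
  simp only [Complex.real_smul, map_mul, Complex.conj_ofReal]

/-- The substitution `s = x - y` moves `x` out of the argument of `f` and into the upper limit, so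
that differentiability needs only continuity of `f`. -/
theorem decayConv_eq_Iic (f : ℝ → E) (x : ℝ) :
    decayConv κ f x
      = Real.exp (-(2 * κ) * x) • ∫ s in Set.Iic x, Real.exp ((2 * κ) * s) • f s := by
  have h := (Measure.measurePreserving_sub_left (volume : Measure ℝ) x).setIntegral_preimage_emb
    (Homeomorph.subLeft x).measurableEmbedding
    (fun s => Real.exp (-(2 * κ) * x) • Real.exp ((2 * κ) * s) • f s) (Set.Iic x)
  rw [← integral_smul, ← h]
  have : (fun y : ℝ => x - y) ⁻¹' Set.Iic x = Set.Ici 0 := by ext y; simp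
  rw [this, integral_Ici_eq_integral_Ioi]
  unfold decayConv
  congr 1
  ext y
  rw [smul_smul, ← Real.exp_add]
  congr 2
  ring

theorem hasDerivAt_decayConv [CompleteSpace E] (hκ : 0 < κ) {f : ℝ → E} (hf : IsBddCont f)
    (x : ℝ) : HasDerivAt (decayConv κ f) (f x - (2 * κ) • decayConv κ f x) x := by
  obtain ⟨M, hM⟩ := hf.bdd
  have hc : Continuous fun s => Real.exp ((2 * κ) * s) • f s := by
    have := hf.cont
    fun_prop
  have hint : ∀ a, IntegrableOn (fun s => Real.exp ((2 * κ) * s) • f s) (Set.Iic a) := fun a => by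
    refine ((integrableOn_exp_mul_Iic (a := 2 * κ) (by linarith) a).mul_const M).mono'
      hc.aestronglyMeasurable (Filter.Eventually.of_forall fun y => ?_)
    rw [norm_smul, Real.norm_eq_abs, abs_of_pos (Real.exp_pos _)]
    exact mul_le_mul_of_nonneg_left (hM _) (Real.exp_pos _).le
  have heq : decayConv κ f = fun x => Real.exp (-(2 * κ) * x) •
      ((∫ s in Set.Iic 0, Real.exp ((2 * κ) * s) • f s)
        + ∫ s in (0 : ℝ)..x, Real.exp ((2 * κ) * s) • f s) := by
    ext x
    rw [decayConv_eq_Iic, ← intervalIntegral.integral_Iic_sub_Iic (hint 0) (hint x)]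
    congr 1
    abel
  have hI : HasDerivAt (fun x => (∫ s in Set.Iic 0, Real.exp ((2 * κ) * s) • f s)
        + ∫ s in (0 : ℝ)..x, Real.exp ((2 * κ) * s) • f s) (Real.exp ((2 * κ) * x) • f x) x :=
    (intervalIntegral.integral_hasDerivAt_right (hc.intervalIntegrable _ _)
      (hc.stronglyMeasurableAtFilter _ _) hc.continuousAt).const_add _
  have hE : HasDerivAt (fun x : ℝ => Real.exp (-(2 * κ) * x))
      (Real.exp (-(2 * κ) * x) * (-(2 * κ))) x := by
    simpa using ((hasDerivAt_id x).const_mul (-(2 * κ))).exp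
  have := hE.smul hI
  have h2 : decayConv κ f x = _ := congrFun heq x
  rw [h2, heq]
  refine this.congr_deriv ?_
  rw [smul_smul, ← Real.exp_add, smul_smul, sub_eq_add_neg, ← neg_smul]
  congr 2
  · simp
  · ring

theorem isBddCont_decayConv [CompleteSpace E] (hκ : 0 < κ) {f : ℝ → E} (hf : IsBddCont f) :
    IsBddCont (decayConv κ f) := by
  obtain ⟨M, hM⟩ := hf.bdd
  exact ⟨continuous_iff_continuousAt.2 fun x => (hasDerivAt_decayConv hκ hf x).continuousAt,
    _, norm_decayConv_le hκ hM⟩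

/-- A bounded solution of `v' = h - 2κ v` is `decayConv κ h`. -/
theorem eq_decayConv_of_hasDerivAt [CompleteSpace E] (hκ : 0 < κ) {v h : ℝ → E}
    (hh : IsBddCont h) (hv : ∃ M : ℝ, ∀ x, ‖v x‖ ≤ M)
    (hd : ∀ x, HasDerivAt v (h x - (2 * κ) • v x) x) (x : ℝ) : v x = decayConv κ h x := by
  obtain ⟨M, hM⟩ := hv
  -- Along the backward ray from `x`, the integrand of `decayConv` has the antiderivative `-e^{-2κy}
  -- v(x - y)`; boundedness of `v` kills the boundary term at infinity.
  have hder : ∀ y ∈ Set.Ici (0 : ℝ), HasDerivAt (fun y => -(Real.exp (-(2 * κ) * y) • v (x - y)))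
      (Real.exp (-(2 * κ) * y) • h (x - y)) y := by
    intro y _
    have h1 : HasDerivAt (fun y => v (x - y)) (-(h (x - y) - (2 * κ) • v (x - y))) y := by
      have := (hd (x - y)).scomp y ((hasDerivAt_id y).const_sub x)
      simpa using! this
    have hE : HasDerivAt (fun x : ℝ => Real.exp (-(2 * κ) * x))
        (Real.exp (-(2 * κ) * y) * (-(2 * κ))) y := by
      simpa using ((hasDerivAt_id y).const_mul (-(2 * κ))).exp
    refine (hE.smul h1).neg.congr_deriv ?_
    simp only [smul_neg, smul_sub, mul_smul, neg_smul]
    abel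
  have hlim : Filter.Tendsto (fun y => -(Real.exp (-(2 * κ) * y) • v (x - y))) Filter.atTop
      (nhds 0) := by
    have h0 : Filter.Tendsto (fun y : ℝ => Real.exp (-(2 * κ) * y) * M) Filter.atTop (nhds 0) := by
      have : Filter.Tendsto (fun y : ℝ => Real.exp (-(2 * κ) * y)) Filter.atTop (nhds 0) :=
        Real.tendsto_exp_atBot.comp
          (Filter.tendsto_id.const_mul_atTop_of_neg (by linarith))
      simpa using this.mul_const M
    refine squeeze_zero_norm (fun y => ?_) h0
    rw [norm_neg, norm_smul, Real.norm_eq_abs, abs_of_pos (Real.exp_pos _)]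
    exact mul_le_mul_of_nonneg_left (hM _) (Real.exp_pos _).le
  have := integral_Ioi_of_hasDerivAt_of_tendsto' hder (integrableOn_decay_smul hκ hh x) hlim
  unfold decayConv
  rw [this]
  simp

/-- `v = G (b v + g)` has `‖v‖_∞ ≤ ‖g‖_∞ / κ` as soon as `G |b| ≤ 1/2`. -/
theorem norm_le_of_linear_equation (hκ : 0 < κ) {v b g : ℝ → ℂ} (hv : ∃ M : ℝ, ∀ x, ‖v x‖ ≤ M)
    (hb : IsBddCont b) (hg : IsBddCont g) {γ : ℝ} (hγ : ∀ x, ‖g x‖ ≤ γ)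
    (hbs : ∀ x, decayConv κ (fun y => ‖b y‖) x ≤ 1 / 2)
    (hd : ∀ x, HasDerivAt v (b x * v x + g x - (2 * κ) * v x) x) (x : ℝ) : ‖v x‖ ≤ γ / κ := by
  have hvc : IsBddCont v :=
    ⟨continuous_iff_continuousAt.2 fun x => (hd x).continuousAt, hv⟩
  have heq : ∀ x, v x = decayConv κ (fun x => b x * v x + g x) x := by
    refine eq_decayConv_of_hasDerivAt hκ ((hb.mul hvc).add hg) hv fun x => ?_
    refine (hd x).congr_deriv ?_
    simp [Complex.real_smul]
  set S := ⨆ x, ‖v x‖ with hS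
  have hbd : BddAbove (Set.range fun x => ‖v x‖) := by
    obtain ⟨M, hM⟩ := hv
    exact ⟨M, by rintro _ ⟨x, rfl⟩; exact hM x⟩
  have hle : ∀ x, ‖v x‖ ≤ S := fun x => le_ciSup hbd x
  have hS0 : 0 ≤ S := (norm_nonneg _).trans (hle 0)
  -- The supremum `S` is finite because `v` is bounded by hypothesis, so the half of it on the right
  -- can be absorbed.
  have hmain : S ≤ S / 2 + γ / (2 * κ) := by
    refine ciSup_le fun x => ?_
    rw [heq x, decayConv_add hκ (hb.mul hvc) hg]
    refine (norm_add_le _ _).trans (add_le_add ?_ (norm_decayConv_le hκ hγ x))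
    have h1 : IsBddCont fun y => S * ‖b y‖ := by
      obtain ⟨M, hM⟩ := hb.bdd
      refine ⟨continuous_const.mul hb.cont.norm, S * M, fun x => ?_⟩
      rw [norm_mul, Real.norm_of_nonneg hS0, norm_norm]
      exact mul_le_mul_of_nonneg_left (hM x) hS0
    refine (norm_decayConv_le_of_le hκ h1 (fun y => ?_) x).trans ?_
    · rw [norm_mul, mul_comm]
      exact mul_le_mul_of_nonneg_right (hle y) (norm_nonneg _)
    · rw [decayConv_real_const_mul]
      have := mul_le_mul_of_nonneg_left (hbs x) hS0
      linarith
  have h3 : γ / (2 * κ) = γ / κ / 2 := by field_simp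
  linarith [hle x]

end DecayConv

/-! ### Smallness of `G|q|` from the mass. -/

section Smallness

theorem decayConv_eq_sub_one {κ : ℝ} (hκ : 0 < κ) {f : ℝ → ℝ} (hf : IsBddCont f) (x : ℝ) :
    decayConv κ f x = Real.exp (-(2 * κ)) * decayConv κ f (x - 1)
      + ∫ s in (x - 1)..x, Real.exp (-(2 * κ) * (x - s)) * f s := by
  obtain ⟨M, hM⟩ := hf.bdd
  have hc : Continuous fun s => Real.exp ((2 * κ) * s) • f s := by
    have := hf.cont
    fun_prop
  have hint : ∀ a, IntegrableOn (fun s => Real.exp ((2 * κ) * s) • f s) (Set.Iic a) := fun a => by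
    refine ((integrableOn_exp_mul_Iic (a := 2 * κ) (by linarith) a).mul_const M).mono'
      hc.aestronglyMeasurable (Filter.Eventually.of_forall fun y => ?_)
    rw [norm_smul, Real.norm_eq_abs, abs_of_pos (Real.exp_pos _)]
    exact mul_le_mul_of_nonneg_left (hM _) (Real.exp_pos _).le
  have h1 := intervalIntegral.integral_Iic_sub_Iic (hint (x - 1)) (hint x)
  have h2 : ∫ s in (x - 1)..x, Real.exp (-(2 * κ) * (x - s)) * f s
      = Real.exp (-(2 * κ) * x) * ∫ s in (x - 1)..x, Real.exp ((2 * κ) * s) • f s := by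
    rw [← intervalIntegral.integral_const_mul]
    congr 1
    ext s
    rw [smul_eq_mul, ← mul_assoc, ← Real.exp_add]
    congr 2
    ring
  rw [h2, ← h1, decayConv_eq_Iic, decayConv_eq_Iic, smul_eq_mul, smul_eq_mul, ← mul_assoc,
    ← Real.exp_add]
  have : -(2 * κ) + -(2 * κ) * (x - 1) = -(2 * κ) * x := by ring
  rw [this]
  ring

/-- Only `L²` bounds on unit intervals enter, so periodic functions are covered too. The window `[x
- 1, x]` contributes at most `c / (2√κ)`; everything further left contributes `e^{-2κ} ≤ 1/2` times
the supremum of the same quantity, which is absorbed. -/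
theorem decayConv_norm_le_of_local_sq {κ c : ℝ} (hκ : 1 ≤ κ) (hc : 0 < c) {f : ℝ → ℂ}
    (hf : IsBddCont f) (hloc : ∀ x, ∫ y in (x - 1)..x, ‖f y‖ ^ 2 ≤ c ^ 2) (x : ℝ) :
    decayConv κ (fun y => ‖f y‖) x ≤ c / √κ := by
  have hκ0 : 0 < κ := by linarith
  have hs : 0 < √κ := Real.sqrt_pos.2 hκ0
  have hss : √κ * √κ = κ := Real.mul_self_sqrt hκ0.le
  have hcont := hf.cont
  have hstep : ∀ x, ∫ s in (x - 1)..x, Real.exp (-(2 * κ) * (x - s)) * ‖f s‖ ≤ c / (2 * √κ) := by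
    intro x
    have hexp : ∫ s in (x - 1)..x, Real.exp (-(4 * κ) * (x - s)) ≤ 1 / (4 * κ) := by
      have hd : ∀ s ∈ Set.uIcc (x - 1) x, HasDerivAt
          (fun s => Real.exp (-(4 * κ) * (x - s)) / (4 * κ)) (Real.exp (-(4 * κ) * (x - s))) s := by
        intro s _
        have := ((((hasDerivAt_id s).const_sub x).const_mul (-(4 * κ))).exp).div_const (4 * κ)
        refine this.congr_deriv ?_
        simp only [id_eq]
        field_simp
      rw [intervalIntegral.integral_eq_sub_of_hasDerivAt hd
        (Continuous.intervalIntegrable (by fun_prop) _ _)]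
      have : 0 < Real.exp (-(4 * κ) * (x - (x - 1))) / (4 * κ) := by positivity
      simp only [sub_self, mul_zero, Real.exp_zero]
      linarith
    -- Cauchy-Schwarz in the form `ab ≤ √κ c a² + b² / (4√κ c)`; the weights make each of the two
    -- terms integrate to at most `c / (4√κ)`.
    have hle : ∫ s in (x - 1)..x, Real.exp (-(2 * κ) * (x - s)) * ‖f s‖
        ≤ ∫ s in (x - 1)..x,
          ((√κ * c) * Real.exp (-(4 * κ) * (x - s)) + 1 / (4 * √κ * c) * ‖f s‖ ^ 2) := by
      refine intervalIntegral.integral_mono_on (by linarith)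
        (Continuous.intervalIntegrable (by fun_prop) _ _)
        (Continuous.intervalIntegrable (by fun_prop) _ _) fun s _ => ?_
      have he : Real.exp (-(4 * κ) * (x - s)) = Real.exp (-(2 * κ) * (x - s)) ^ 2 := by
        rw [← Real.exp_nat_mul]
        congr 1
        push_cast
        ring
      rw [he]
      set a := Real.exp (-(2 * κ) * (x - s))
      have : √κ * c * a ^ 2 + 1 / (4 * √κ * c) * ‖f s‖ ^ 2 - a * ‖f s‖
          = (2 * √κ * c * a - ‖f s‖) ^ 2 / (4 * √κ * c) := by
        field_simp
        ring
      have h2 : 0 ≤ (2 * √κ * c * a - ‖f s‖) ^ 2 / (4 * √κ * c) := by positivity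
      linarith
    refine hle.trans ?_
    rw [intervalIntegral.integral_add (Continuous.intervalIntegrable (by fun_prop) _ _)
      (Continuous.intervalIntegrable (by fun_prop) _ _), intervalIntegral.integral_const_mul,
      intervalIntegral.integral_const_mul]
    have h1 := mul_le_mul_of_nonneg_left hexp (by positivity : 0 ≤ √κ * c)
    have h2 := mul_le_mul_of_nonneg_left (hloc x) (by positivity : 0 ≤ 1 / (4 * √κ * c))
    have h3 : √κ * c * (1 / (4 * κ)) + 1 / (4 * √κ * c) * c ^ 2 = c / (2 * √κ) := by
      nth_rw 2 [← hss]
      field_simp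
      norm_num
    linarith
  have hbc : IsBddCont fun y => ‖f y‖ := hf.norm
  obtain ⟨M, hM⟩ := (isBddCont_decayConv hκ0 hbc).bdd
  have hbd : BddAbove (Set.range fun x => decayConv κ (fun y => ‖f y‖) x) :=
    ⟨M, by rintro _ ⟨x, rfl⟩; exact (le_abs_self _).trans (hM x)⟩
  set S := ⨆ x, decayConv κ (fun y => ‖f y‖) x with hS
  have hle : ∀ x, decayConv κ (fun y => ‖f y‖) x ≤ S := fun x => le_ciSup hbd x
  have hS0 : 0 ≤ S := by
    refine le_trans ?_ (hle 0)
    exact setIntegral_nonneg measurableSet_Ioi fun y _ => by positivity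
  have he : Real.exp (-(2 * κ)) ≤ 1 / 2 := by
    rw [Real.exp_neg, ← one_div]
    refine one_div_le_one_div_of_le (by norm_num) ?_
    have := Real.add_one_le_exp (2 * κ)
    linarith
  have hmain : S ≤ 1 / 2 * S + c / (2 * √κ) := by
    refine ciSup_le fun x => ?_
    rw [decayConv_eq_sub_one hκ0 hbc]
    refine add_le_add ?_ (hstep x)
    exact (mul_le_mul_of_nonneg_left (hle _) (Real.exp_pos _).le).trans
      (mul_le_mul_of_nonneg_right he hS0)
  have h3 : c / (2 * √κ) = c / √κ / 2 := by field_simp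
  linarith [hle x]

end Smallness

/-! ### The Riccati equation of the spectral problem at `z = iκ`, `r = -q̄`. -/

section Riccati

/-- Bounded solutions of the Riccati equation `u' = -2κ u - iκ q̄ - q u²` of the Kaup-Newell
spectral problem. -/
structure IsRiccati (κ ρ : ℝ) (q u : ℝ → ℂ) : Prop where
  norm_le : ∀ x, ‖u x‖ ≤ ρ
  hasDerivAt : ∀ x, HasDerivAt u
    (-(Complex.I * κ * (starRingEnd ℂ) (q x)) - q x * u x ^ 2 - 2 * κ * u x) x

variable {κ ρ c : ℝ} {q u : ℝ → ℂ}

theorem IsRiccati.isBddCont (h : IsRiccati κ ρ q u) : IsBddCont u :=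
  ⟨continuous_iff_continuousAt.2 fun x => (h.hasDerivAt x).continuousAt, ρ, h.norm_le⟩

theorem isBddCont_riccati_source (hq : IsBddCont q) (hu : IsBddCont u) :
    IsBddCont fun x => -(Complex.I * κ * (starRingEnd ℂ) (q x)) - q x * u x ^ 2 :=
  ((isBddCont_const (Complex.I * (κ : ℂ))).mul hq.conj).neg.sub (hq.mul (hu.pow 2))

theorem IsRiccati.eq_decayConv (hκ : 0 < κ) (hq : IsBddCont q) (h : IsRiccati κ ρ q u) (x : ℝ) :
    u x = decayConv κ
      (fun x => -(Complex.I * κ * (starRingEnd ℂ) (q x)) - q x * u x ^ 2) x := by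
  refine eq_decayConv_of_hasDerivAt hκ (isBddCont_riccati_source hq h.isBddCont) ⟨ρ, h.norm_le⟩
    (fun x => (h.hasDerivAt x).congr_deriv ?_) x
  simp [Complex.real_smul]

/-- A weighted bound for `G (q w)`. -/
theorem norm_decayConv_mul_le (hκ : 0 < κ) (hq : IsBddCont q) {b : ℝ}
    (hsmall : ∀ x, decayConv κ (fun y => ‖q y‖) x ≤ b) {w : ℝ → ℂ} {m : ℝ}
    (hw : ∀ x, ‖w x‖ ≤ m) (x : ℝ) : ‖decayConv κ (fun y => q y * w y) x‖ ≤ m * b := by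
  have hm : 0 ≤ m := (norm_nonneg _).trans (hw 0)
  have h1 : IsBddCont fun y => m * ‖q y‖ := by
    obtain ⟨M, hM⟩ := hq.bdd
    refine ⟨continuous_const.mul hq.cont.norm, m * M, fun x => ?_⟩
    rw [norm_mul, Real.norm_of_nonneg hm, norm_norm]
    exact mul_le_mul_of_nonneg_left (hM x) hm
  refine (norm_decayConv_le_of_le hκ h1 (fun y => ?_) x).trans ?_
  · rw [norm_mul, mul_comm]
    exact mul_le_mul_of_nonneg_right (hw y) (norm_nonneg _)
  · rw [decayConv_real_const_mul]
    exact mul_le_mul_of_nonneg_left (hsmall x) hm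

-- The integral form of the equation is a contraction on the sup-norm ball of radius `ρ = 2c√κ`. The
-- linear term is at most `κ · c/√κ = ρ/2`, the quadratic one at most `ρ² · c/√κ = 4c² · ρ/2`, and
-- the Lipschitz constant is `2ρ · c/√κ = 4c² ≤ 1/2`.
open BoundedContinuousFunction in
theorem exists_isRiccati (hκ : 1 ≤ κ) (hc : 0 < c) (hc8 : c ≤ 1 / 8) (hq : IsBddCont q)
    (hsmall : ∀ x, decayConv κ (fun y => ‖q y‖) x ≤ c / √κ) :
    ∃ u, IsRiccati κ (2 * c * √κ) q u := by
  have hκ0 : 0 < κ := by linarith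
  have hs : 0 < √κ := Real.sqrt_pos.2 hκ0
  have hss : √κ * √κ = κ := Real.mul_self_sqrt hκ0.le
  set ρ := 2 * c * √κ with hρ
  have hρ0 : 0 < ρ := by positivity
  have hbcf : ∀ u : ℝ →ᵇ ℂ, IsBddCont u := fun u => ⟨u.continuous, ‖u‖, u.norm_coe_le_norm⟩
  set src : (ℝ →ᵇ ℂ) → ℝ → ℂ := fun u x =>
    -(Complex.I * κ * (starRingEnd ℂ) (q x)) - q x * u x ^ 2 with hsrc
  have hsrcb : ∀ u, IsBddCont (src u) := fun u => isBddCont_riccati_source hq (hbcf u)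
  have hex : ∀ u : ℝ →ᵇ ℂ, ∃ v : ℝ →ᵇ ℂ, ∀ x, v x = decayConv κ (src u) x := fun u => by
    have hb := isBddCont_decayConv hκ0 (hsrcb u)
    exact ⟨BoundedContinuousFunction.ofNormedAddCommGroup _ hb.cont hb.bdd.choose
      hb.bdd.choose_spec, fun x => rfl⟩
  choose T hT using hex
  have hmaps : Set.MapsTo T (Metric.closedBall 0 ρ) (Metric.closedBall 0 ρ) := by
    intro u hu
    rw [mem_closedBall_zero_iff] at hu ⊢
    refine (BoundedContinuousFunction.norm_le hρ0.le).2 fun x => ?_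
    have hux : ∀ x, ‖u x ^ 2‖ ≤ ρ ^ 2 := fun x => by
      rw [norm_pow]
      exact pow_le_pow_left₀ (norm_nonneg _) ((u.norm_coe_le_norm x).trans hu) 2
    have h1 : IsBddCont fun x => -(Complex.I * κ * (starRingEnd ℂ) (q x)) :=
      ((isBddCont_const (Complex.I * (κ : ℂ))).mul hq.conj).neg
    rw [hT, hsrc]
    simp only
    rw [decayConv_sub hκ0 h1 (hq.mul ((hbcf u).pow 2))]
    have hA : ‖decayConv κ (fun x => -(Complex.I * κ * (starRingEnd ℂ) (q x))) x‖
        ≤ κ * (c / √κ) := by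
      have : (fun x => -(Complex.I * κ * (starRingEnd ℂ) (q x)))
          = fun x => (-(Complex.I * κ)) * (starRingEnd ℂ) (q x) := by ext; ring
      rw [this, decayConv_const_mul, decayConv_conj]
      simp only [norm_mul, norm_neg, Complex.norm_I, one_mul, Complex.norm_real,
        Real.norm_of_nonneg hκ0.le, RCLike.norm_conj]
      exact mul_le_mul_of_nonneg_left ((norm_decayConv_le_of_le hκ0 hq.norm
        (fun _ => le_rfl) x).trans (hsmall x)) hκ0.le
    have hB := norm_decayConv_mul_le hκ0 hq hsmall hux x
    refine (norm_sub_le _ _).trans ((add_le_add hA hB).trans ?_)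
    have h2 : κ * (c / √κ) = c * √κ := by
      nth_rw 1 [← hss]
      field_simp
    have h3 : ρ ^ 2 * (c / √κ) = 4 * c ^ 2 * (c * √κ) := by
      rw [hρ]
      field_simp
      norm_num
    have h4 : 4 * c ^ 2 * (c * √κ) ≤ 1 * (c * √κ) :=
      mul_le_mul_of_nonneg_right (by nlinarith) (by positivity)
    rw [h2, h3, hρ]
    linarith
  have hcontr : ContractingWith (1 / 2) (hmaps.restrict T _ _) := by
    refine ⟨by rw [← NNReal.coe_lt_coe]; norm_num, LipschitzWith.of_dist_le_mul fun u v => ?_⟩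
    have hu := mem_closedBall_zero_iff.1 u.2
    have hv := mem_closedBall_zero_iff.1 v.2
    change dist (T u.1) (T v.1) ≤ _ * dist u.1 v.1
    refine (BoundedContinuousFunction.dist_le (by positivity)).2 fun x => ?_
    rw [dist_eq_norm, hT, hT, ← decayConv_sub hκ0 (hsrcb _) (hsrcb _)]
    have heq : (fun y => src u.1 y - src v.1 y)
        = fun y => q y * ((v.1 y + u.1 y) * (v.1 y - u.1 y)) := by
      ext y
      simp only [hsrc]
      ring
    have hw : ∀ y, ‖(v.1 y + u.1 y) * (v.1 y - u.1 y)‖ ≤ (2 * ρ) * dist u.1 v.1 := fun y => by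
      rw [norm_mul]
      refine mul_le_mul ?_ ?_ (norm_nonneg _) (by positivity)
      · have h1 := (v.1.norm_coe_le_norm y).trans hv
        have h2 := (u.1.norm_coe_le_norm y).trans hu
        exact (norm_add_le _ _).trans (by linarith)
      · rw [← dist_eq_norm, dist_comm]
        exact BoundedContinuousFunction.dist_coe_le_dist y
    rw [heq]
    refine (norm_decayConv_mul_le hκ0 hq hsmall hw x).trans ?_
    have h5 : 2 * ρ * dist u.1 v.1 * (c / √κ) = 4 * c ^ 2 * dist u.1 v.1 := by
      generalize dist u.1 v.1 = d
      have : ρ * (c / √κ) = 2 * c ^ 2 := by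
        rw [hρ]
        field_simp
      linear_combination 2 * d * this
    rw [h5]
    refine mul_le_mul_of_nonneg_right ?_ dist_nonneg
    push_cast
    nlinarith
  obtain ⟨u, hu, hfix, -⟩ := hcontr.exists_fixedPoint' Metric.isClosed_closedBall.isComplete hmaps
    (x := 0) (by simp [hρ0.le]) (edist_ne_top _ _)
  refine ⟨u, fun x => (u.norm_coe_le_norm x).trans (mem_closedBall_zero_iff.1 hu), fun x => ?_⟩
  have hux : (u : ℝ → ℂ) = decayConv κ (src u) := by
    ext x
    rw [← hT, hfix]
  have := hasDerivAt_decayConv hκ0 (hsrcb u) x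
  rw [← hux] at this
  refine this.congr_deriv ?_
  simp [hsrc, Complex.real_smul]

/-- Since `v² - u² = (v + u)(v - u)`, the difference of two Riccati solutions solves a linear
equation with the coefficient `-q(v + u)`. This is the smallness which `norm_le_of_linear_equation`
asks of it. -/
theorem riccati_coefficient_le (hκ : 1 ≤ κ) (hc : 0 < c) (hc8 : c ≤ 1 / 8) (hq : IsBddCont q)
    (hsmall : ∀ x, decayConv κ (fun y => ‖q y‖) x ≤ c / √κ) {v : ℝ → ℂ}
    (hu : ∀ x, ‖u x‖ ≤ 2 * c * √κ) (hv : ∀ x, ‖v x‖ ≤ 2 * c * √κ) (x : ℝ) :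
    decayConv κ (fun y => ‖-(q y * (v y + u y))‖) x ≤ 1 / 2 := by
  have hκ0 : 0 < κ := by linarith
  have hs : 0 < √κ := Real.sqrt_pos.2 hκ0
  have h1 : IsBddCont fun y => (4 * c * √κ) * ‖q y‖ := by
    obtain ⟨M, hM⟩ := hq.bdd
    refine ⟨continuous_const.mul hq.cont.norm, (4 * c * √κ) * M, fun x => ?_⟩
    rw [norm_mul, Real.norm_of_nonneg (by positivity), norm_norm]
    exact mul_le_mul_of_nonneg_left (hM x) (by positivity)
  refine (Real.le_norm_self _).trans ((norm_decayConv_le_of_le hκ0 h1 (fun y => ?_) x).trans ?_)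
  · rw [norm_norm, norm_neg, norm_mul, mul_comm]
    refine mul_le_mul_of_nonneg_right ((norm_add_le _ _).trans ?_) (norm_nonneg _)
    linarith [hu y, hv y]
  · rw [decayConv_real_const_mul]
    refine (mul_le_mul_of_nonneg_left (hsmall x) (by positivity)).trans ?_
    have : 4 * c * √κ * (c / √κ) = 4 * c ^ 2 := by field_simp
    rw [this]
    nlinarith

/-- Two Riccati solutions for `q` and `q'` differ by `O(‖q - q'‖_∞)`. -/
theorem IsRiccati.norm_sub_le_of_potential {q' u' : ℝ → ℂ} (hκ : 1 ≤ κ) (hc : 0 < c)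
    (hc8 : c ≤ 1 / 8)
    (hq : IsBddCont q) (hq' : IsBddCont q')
    (hsmall' : ∀ x, decayConv κ (fun y => ‖q' y‖) x ≤ c / √κ)
    (h : IsRiccati κ (2 * c * √κ) q u) (h' : IsRiccati κ (2 * c * √κ) q' u') {η : ℝ}
    (hη : ∀ x, ‖q' x - q x‖ ≤ η) (x : ℝ) : ‖u' x - u x‖ ≤ 2 * η := by
  have hκ0 : 0 < κ := by linarith
  have hs : 0 < √κ := Real.sqrt_pos.2 hκ0
  have hss : √κ * √κ = κ := Real.mul_self_sqrt hκ0.le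
  have hη0 : 0 ≤ η := (norm_nonneg _).trans (hη 0)
  have hd := hq'.sub hq
  -- The splitting `q'u'² - qu² = q'(u' + u)(u' - u) + (q' - q)u²` separates coefficient from
  -- source. The source is at most `κη + |u|²η ≤ 2κη`, as `ρ² ≤ κ`. With `q' = q` and `η = 0` the
  -- result is uniqueness.
  have key := norm_le_of_linear_equation hκ0 (v := fun x => u' x - u x)
    (b := fun x => -(q' x * (u' x + u x)))
    (g := fun x => -(Complex.I * κ) * (starRingEnd ℂ) (q' x - q x) - (q' x - q x) * u x ^ 2)
    (γ := κ * (2 * η)) (h'.isBddCont.sub h.isBddCont).bdd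
    (hq'.mul (h'.isBddCont.add h.isBddCont)).neg
    (((isBddCont_const (-(Complex.I * (κ : ℂ)))).mul hd.conj).sub
      (hd.mul (h.isBddCont.pow 2))) ?_ ?_ ?_ x
  · rwa [mul_div_cancel_left₀ _ hκ0.ne'] at key
  · intro x
    refine (norm_sub_le _ _).trans ?_
    simp only [norm_mul, norm_neg, Complex.norm_I, one_mul, Complex.norm_real,
        Real.norm_of_nonneg hκ0.le, RCLike.norm_conj, norm_pow]
    have h1 : ‖u x‖ ^ 2 ≤ (2 * c * √κ) ^ 2 := pow_le_pow_left₀ (norm_nonneg _) (h.norm_le x) 2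
    have h2 : (2 * c * √κ) ^ 2 ≤ κ := by
      have : (2 * c * √κ) ^ 2 = 4 * c ^ 2 * κ := by rw [← hss]; ring_nf; rw [Real.sqrt_sq hs.le]
      have h5 : c ^ 2 ≤ 1 / 64 := by nlinarith
      rw [this]
      nlinarith
    have h3 : ‖q' x - q x‖ * ‖u x‖ ^ 2 ≤ η * κ :=
      mul_le_mul (hη x) (h1.trans h2) (by positivity) hη0
    have h4 := mul_le_mul_of_nonneg_left (hη x) hκ0.le
    linarith
  · exact riccati_coefficient_le hκ hc hc8 hq' hsmall' h.norm_le h'.norm_le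
  · intro x
    refine ((h'.hasDerivAt x).sub (h.hasDerivAt x)).congr_deriv ?_
    simp only [map_sub]
    ring

end Riccati

/-! ### A common setting for integration over the line and over the circle. -/

section Tame

/-- Continuous `p`-periodic functions bounded by a multiple of the weight `W`.  The line is
`p = 0`, `W = 1 / (1 + x²)`; the circle is `p = 2π`, `W = 1`. -/
structure Tame (p : ℝ) (W : ℝ → ℝ) (f : ℝ → ℂ) : Prop where
  cont : Continuous f
  per : Function.Periodic f p
  bound : ∃ M : ℝ, ∀ x, ‖f x‖ ≤ M * W x

/-- The measure `μ` over one period, with the properties used of integration over the line and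
over the circle. -/
structure SpaceMeasure (μ : Measure ℝ) (p : ℝ) (W : ℝ → ℝ) : Prop where
  weight_nonneg : ∀ x, 0 ≤ W x
  weight_le_one : ∀ x, W x ≤ 1
  weight_int : Integrable W μ
  weight_sub_le : ∀ x y, W (x - y) ≤ 2 * (1 + y ^ 2) * W x
  local_sq_le : ∀ f, Tame p W f → ∀ x, ∫ y in (x - 1)..x, ‖f y‖ ^ 2 ≤ ∫ y, ‖f y‖ ^ 2 ∂μ
  integral_deriv : ∀ f f', Tame p W f → Tame p W f' → (∀ x, HasDerivAt f (f' x) x) →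
    ∫ x, f' x ∂μ = 0

variable {μ : Measure ℝ} {p : ℝ} {W : ℝ → ℝ} {f g : ℝ → ℂ}

theorem Tame.bound_nonneg (hμ : SpaceMeasure μ p W) (hf : Tame p W f) :
    ∃ M : ℝ, 0 ≤ M ∧ ∀ x, ‖f x‖ ≤ M * W x := by
  obtain ⟨M, hM⟩ := hf.bound
  exact ⟨|M|, abs_nonneg _, fun x =>
    (hM x).trans (mul_le_mul_of_nonneg_right (le_abs_self _) (hμ.weight_nonneg x))⟩

theorem Tame.isBddCont (hμ : SpaceMeasure μ p W) (hf : Tame p W f) : IsBddCont f := by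
  obtain ⟨M, hM0, hM⟩ := hf.bound_nonneg hμ
  exact ⟨hf.cont, M, fun x => (hM x).trans (mul_le_of_le_one_right hM0 (hμ.weight_le_one x))⟩

theorem Tame.integrable (hμ : SpaceMeasure μ p W) (hf : Tame p W f) : Integrable f μ := by
  obtain ⟨M, hM⟩ := hf.bound
  exact (hμ.weight_int.const_mul M).mono' hf.cont.aestronglyMeasurable
    (Filter.Eventually.of_forall hM)

theorem Tame.add (hf : Tame p W f) (hg : Tame p W g) : Tame p W (fun x => f x + g x) := by
  obtain ⟨M, hM⟩ := hf.bound
  obtain ⟨N, hN⟩ := hg.bound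
  refine ⟨hf.cont.add hg.cont, fun x => by simp only [hf.per x, hg.per x], M + N, fun x => ?_⟩
  rw [add_mul]
  exact (norm_add_le _ _).trans (add_le_add (hM x) (hN x))

theorem Tame.mul (hμ : SpaceMeasure μ p W) (hf : Tame p W f) (hg : IsBddCont g)
    (hgp : Function.Periodic g p) : Tame p W (fun x => f x * g x) := by
  obtain ⟨M, hM0, hM⟩ := hf.bound_nonneg hμ
  obtain ⟨N, hN⟩ := hg.bdd
  refine ⟨hf.cont.mul hg.cont, fun x => by simp only [hf.per x, hgp x], M * N, fun x => ?_⟩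
  have h0 := mul_nonneg hM0 (hμ.weight_nonneg x)
  rw [norm_mul]
  calc ‖f x‖ * ‖g x‖ ≤ (M * W x) * N :=
        mul_le_mul (hM x) (hN x) (norm_nonneg _) h0
    _ = M * N * W x := by ring

theorem Tame.mul_tame (hμ : SpaceMeasure μ p W) (hf : Tame p W f) (hg : Tame p W g) :
    Tame p W (fun x => f x * g x) :=
  hf.mul hμ (hg.isBddCont hμ) hg.per

theorem Tame.const_mul (hf : Tame p W f) (c : ℂ) : Tame p W (fun x => c * f x) := by
  obtain ⟨M, hM⟩ := hf.bound
  refine ⟨continuous_const.mul hf.cont, fun x => by simp only [hf.per x], ‖c‖ * M, fun x => ?_⟩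
  rw [norm_mul, mul_assoc]
  exact mul_le_mul_of_nonneg_left (hM x) (norm_nonneg _)

theorem Tame.neg (hf : Tame p W f) : Tame p W (fun x => -f x) := by
  simpa using hf.const_mul (-1)

theorem Tame.sub (hf : Tame p W f) (hg : Tame p W g) : Tame p W (fun x => f x - g x) := by
  simpa only [sub_eq_add_neg] using hf.add hg.neg

theorem Tame.conj (hf : Tame p W f) : Tame p W (fun x => (starRingEnd ℂ) (f x)) := by
  obtain ⟨M, hM⟩ := hf.bound
  exact ⟨Complex.continuous_conj.comp hf.cont, fun x => by simp only [hf.per x], M,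
    fun x => by simpa using hM x⟩

theorem Tame.ofReal_norm (hf : Tame p W f) : Tame p W (fun x => (‖f x‖ : ℂ)) := by
  obtain ⟨M, hM⟩ := hf.bound
  exact ⟨Complex.continuous_ofReal.comp hf.cont.norm, fun x => by simp only [hf.per x], M,
    fun x => by simpa using hM x⟩

/-- Shifting the weight by `y` costs `2(1 + y²) ≤ 4e^{κy}`, which is where `κ ≥ 1` is used; the
kernel `e^{-2κy}` pays for it and leaves the integrable `e^{-κy}`. -/
theorem Tame.decayConv {κ : ℝ} (hκ : 1 ≤ κ) (hμ : SpaceMeasure μ p W) (hf : Tame p W f) :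
    Tame p W (decayConv κ f) := by
  have hκ0 : 0 < κ := by linarith
  obtain ⟨M, hM0, hM⟩ := hf.bound_nonneg hμ
  refine ⟨(isBddCont_decayConv hκ0 (hf.isBddCont hμ)).cont, fun x => ?_,
    ∫ y in Set.Ioi (0 : ℝ), Real.exp (-κ * y) * (4 * M), fun x => ?_⟩
  · unfold _root_.decayConv
    congr 1
    ext y
    rw [show x + p - y = (x - y) + p by ring, hf.per]
  · rw [← integral_mul_const]
    refine norm_integral_le_of_norm_le (((exp_neg_integrableOn_Ioi 0 hκ0).mul_const _).mul_const _)
      ((ae_restrict_mem measurableSet_Ioi).mono fun y hy => ?_)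
    have hy0 : 0 < y := hy
    have h1 : 1 + y ^ 2 ≤ 2 * Real.exp (κ * y) := by
      have h2 : 1 + y + y ^ 2 / 2 ≤ Real.exp y := Real.quadratic_le_exp_of_nonneg hy0.le
      have h3 : Real.exp y ≤ Real.exp (κ * y) := Real.exp_le_exp.2 (by nlinarith)
      nlinarith
    have h4 : ‖f (x - y)‖ ≤ Real.exp (κ * y) * (4 * M) * W x := by
      refine (hM _).trans ((mul_le_mul_of_nonneg_left (hμ.weight_sub_le x y) hM0).trans ?_)
      have := mul_le_mul_of_nonneg_right h1 (mul_nonneg (mul_nonneg zero_le_two hM0)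
        (hμ.weight_nonneg x))
      linarith
    rw [norm_smul, Real.norm_eq_abs, abs_of_pos (Real.exp_pos _)]
    calc Real.exp (-(2 * κ) * y) * ‖f (x - y)‖
        ≤ Real.exp (-(2 * κ) * y) * (Real.exp (κ * y) * (4 * M) * W x) :=
          mul_le_mul_of_nonneg_left h4 (Real.exp_pos _).le
      _ = Real.exp (-(2 * κ) * y) * Real.exp (κ * y) * (4 * M) * W x := by ring
      _ = Real.exp (-κ * y) * (4 * M) * W x := by
          rw [← Real.exp_add]
          congr 3
          ring

/-- `∫ |f| G|f| dμ ≤ ‖f‖² / 2κ`. -/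
theorem integral_norm_mul_decayConv_le {κ : ℝ} (hκ : 1 ≤ κ) (hμ : SpaceMeasure μ p W)
    (hf : Tame p W f) :
    ∫ x, ‖f x‖ * decayConv κ (fun y => ‖f y‖) x ∂μ ≤ (∫ x, ‖f x‖ ^ 2 ∂μ) / (2 * κ) := by
  have hκ0 : 0 < κ := by linarith
  have hn := hf.ofReal_norm
  have hG := hn.decayConv hκ hμ
  set v := decayConv κ (fun y => ‖f y‖) with hv
  have hvG : decayConv κ (fun y => (‖f y‖ : ℂ)) = fun x => (v x : ℂ) := by
    ext x
    rw [hv]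
    unfold decayConv
    rw [← integral_complex_ofReal]
    congr 1
    ext y
    simp
  rw [hvG] at hG
  have hd : ∀ x, HasDerivAt (fun x => (v x : ℂ)) ((‖f x‖ : ℂ) - 2 * κ * v x) x := fun x => by
    have := hasDerivAt_decayConv hκ0 (hn.isBddCont hμ) x
    rw [hvG] at this
    refine this.congr_deriv ?_
    simp [Complex.real_smul]
  have h1 := (hn.mul_tame hμ hG).integrable hμ
  have h2 := (hG.mul_tame hμ hG).integrable hμ
  have h3 := (hn.mul_tame hμ hn).integrable hμ
  -- For `v = G|f|`, integrating `(v²)' = 2|f|v - 4κv²` gives `∫ |f|v = 2κ ∫ v²`. Combined with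
  -- `|f|v ≤ |f|²/(4κ) + κv²`, half of the left side is absorbed.
  have hz := hμ.integral_deriv (fun x => (v x : ℂ) * v x)
    (fun x => 2 * ((‖f x‖ : ℂ) * v x) - (4 * κ) * ((v x : ℂ) * v x)) (hG.mul_tame hμ hG)
    (((hn.mul_tame hμ hG).const_mul _).sub ((hG.mul_tame hμ hG).const_mul _))
    (fun x => ((hd x).mul (hd x)).congr_deriv (by ring))
  have h1r : Integrable (fun x => ‖f x‖ * v x) μ := by
    have := h1.re
    simpa using! this
  have h2r : Integrable (fun x => v x * v x) μ := by
    have := h2.re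
    simpa using! this
  have h3r : Integrable (fun x => ‖f x‖ ^ 2) μ := by
    have := h3.re
    simpa [pow_two] using! this
  rw [integral_sub (h1.const_mul _) (h2.const_mul _), integral_const_mul, integral_const_mul] at hz
  have e1 : ∫ x, (‖f x‖ : ℂ) * v x ∂μ = ((∫ x, ‖f x‖ * v x ∂μ : ℝ) : ℂ) := by
    rw [← integral_complex_ofReal]; simp
  have e2 : ∫ x, (v x : ℂ) * v x ∂μ = ((∫ x, v x * v x ∂μ : ℝ) : ℂ) := by
    rw [← integral_complex_ofReal]; simp
  rw [e1, e2] at hz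
  have hz' : 2 * (∫ x, ‖f x‖ * v x ∂μ) - 4 * κ * (∫ x, v x * v x ∂μ) = 0 := by exact_mod_cast hz
  have hle : ∫ x, ‖f x‖ * v x ∂μ ≤ ∫ x, ((1 / (4 * κ)) * ‖f x‖ ^ 2 + κ * (v x * v x)) ∂μ := by
    refine integral_mono h1r ((h3r.const_mul _).add (h2r.const_mul _)) fun x => ?_
    have : (1 / (4 * κ)) * ‖f x‖ ^ 2 + κ * (v x * v x) - ‖f x‖ * v x
        = (‖f x‖ - 2 * κ * v x) ^ 2 / (4 * κ) := by
      field_simp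
      ring
    have h5 : 0 ≤ (‖f x‖ - 2 * κ * v x) ^ 2 / (4 * κ) := by positivity
    simp only
    linarith
  rw [integral_add (h3r.const_mul _) (h2r.const_mul _), integral_const_mul,
    integral_const_mul] at hle
  have h6 : (∫ x, ‖f x‖ ^ 2 ∂μ) / (2 * κ) = 2 * (1 / (4 * κ) * ∫ x, ‖f x‖ ^ 2 ∂μ) := by
    field_simp
    norm_num
  linarith

/-- A remainder `O(h²)` dominated by an integrable weight differentiates the integral directly, with
derivative `∫ F' = 0`. This form suits `u`, whose dependence on time is known only through such a
remainder estimate. -/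
theorem integral_eq_of_quadratic_remainder (hW : Integrable W μ) {F F' : ℝ → ℝ → ℂ}
    (hF : ∀ t, Integrable (F t) μ) (hF' : ∀ t, Integrable (F' t) μ)
    (hzero : ∀ t, ∫ x, F' t x ∂μ = 0)
    (hrem : ∀ t, ∃ M : ℝ, ∀ h : ℝ, |h| ≤ 1 → ∀ x,
      ‖F (t + h) x - F t x - h * F' t x‖ ≤ M * h ^ 2 * W x) (t : ℝ) :
    ∫ x, F t x ∂μ = ∫ x, F 0 x ∂μ := by
  have hd : ∀ t, HasDerivAt (fun t => ∫ x, F t x ∂μ) 0 t := by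
    intro t
    obtain ⟨M, hM⟩ := hrem t
    rw [hasDerivAt_iff_isLittleO_nhds_zero]
    have hO : (fun h : ℝ => (∫ x, F (t + h) x ∂μ) - (∫ x, F t x ∂μ) - h • (0 : ℂ))
        =O[nhds 0] fun h : ℝ => h ^ 2 := by
      refine Asymptotics.IsBigO.of_bound (M * ∫ x, W x ∂μ) ?_
      filter_upwards [Metric.ball_mem_nhds (0 : ℝ) one_pos] with h hh
      have hh1 : |h| ≤ 1 := by
        rw [Metric.mem_ball, dist_zero_right, Real.norm_eq_abs] at hh
        exact hh.le
      have : (∫ x, F (t + h) x ∂μ) - (∫ x, F t x ∂μ) - h • (0 : ℂ)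
          = ∫ x, (F (t + h) x - F t x - h * F' t x) ∂μ := by
        have hA : Integrable (fun x => F (t + h) x - F t x) μ := (hF _).sub (hF _)
        rw [integral_sub hA ((hF' t).const_mul _), integral_sub (hF _) (hF _),
          integral_const_mul, hzero]
        simp
      rw [this]
      refine (norm_integral_le_of_norm_le (hW.const_mul (M * h ^ 2))
        (Filter.Eventually.of_forall fun x => hM h hh1 x)).trans (le_of_eq ?_)
      rw [integral_const_mul, Real.norm_of_nonneg (sq_nonneg h)]
      ring
    refine hO.trans_isLittleO ?_
    simpa using (Asymptotics.isLittleO_pow_pow (𝕜 := ℝ) (m := 1) (n := 2) (by norm_num))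
  exact is_const_of_deriv_eq_zero (fun t => (hd t).differentiableAt) (fun t => (hd t).deriv) t 0

end Tame

/-! ### Conservation of `∫ |q|²` and of `∫ q u`. -/

section Conservation

/-- Smooth solutions of the derivative nonlinear Schrödinger equation, with first and second space
derivatives `q₁`, `q₂` and time derivative `qt`; time differentiability is a quadratic remainder
bound. -/
structure IsEvolution (p : ℝ) (W : ℝ → ℝ) (q q₁ q₂ qt : ℝ → ℝ → ℂ) : Prop where
  tame : ∀ t, Tame p W (q t)
  tame₁ : ∀ t, Tame p W (q₁ t)
  tame₂ : ∀ t, Tame p W (q₂ t)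
  deriv₁ : ∀ t x, HasDerivAt (q t) (q₁ t x) x
  deriv₂ : ∀ t x, HasDerivAt (q₁ t) (q₂ t x) x
  eqn : ∀ t x, qt t x = Complex.I * q₂ t x - (2 * q t x * q₁ t x * (starRingEnd ℂ) (q t x)
    + q t x ^ 2 * (starRingEnd ℂ) (q₁ t x))
  remainder : ∀ t, ∃ M : ℝ, ∀ h : ℝ, |h| ≤ 1 → ∀ x,
    ‖q (t + h) x - q t x - h * qt t x‖ ≤ M * h ^ 2 * W x

variable {μ : Measure ℝ} {p : ℝ} {W : ℝ → ℝ} {q q₁ q₂ qt : ℝ → ℝ → ℂ}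

theorem IsEvolution.tame_time (hμ : SpaceMeasure μ p W) (hq : IsEvolution p W q q₁ q₂ qt) (t : ℝ) :
    Tame p W (qt t) := by
  have h := ((hq.tame₂ t).const_mul Complex.I).sub
    (((((hq.tame t).const_mul 2).mul_tame hμ (hq.tame₁ t)).mul_tame hμ (hq.tame t).conj).add
      (((hq.tame t).mul_tame hμ (hq.tame t)).mul_tame hμ (hq.tame₁ t).conj))
  convert! h using 1
  ext x
  rw [hq.eqn]
  ring

/-- Bounds for one time `t`, uniform in the time increment. -/
theorem IsEvolution.exists_bounds (hμ : SpaceMeasure μ p W) (hq : IsEvolution p W q q₁ q₂ qt)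
    (t : ℝ) : ∃ M : ℝ, 0 ≤ M ∧ (∀ x, ‖q t x‖ ≤ M * W x) ∧ (∀ x, ‖qt t x‖ ≤ M * W x) ∧
      ∀ h : ℝ, |h| ≤ 1 → ∀ x,
        ‖q (t + h) x - q t x - h * qt t x‖ ≤ M * h ^ 2 * W x ∧
        ‖q (t + h) x - q t x‖ ≤ 2 * M * |h| ∧ ‖q (t + h) x‖ ≤ 3 * M := by
  obtain ⟨A, hA0, hA⟩ := (hq.tame t).bound_nonneg hμ
  obtain ⟨B, hB0, hB⟩ := (hq.tame_time hμ t).bound_nonneg hμ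
  obtain ⟨R, hR⟩ := hq.remainder t
  have hW := hμ.weight_nonneg
  have hW1 := hμ.weight_le_one
  set M := A + B + |R| with hM
  have hM0 : 0 ≤ M := by positivity
  have hAM : A ≤ M := by rw [hM]; linarith [abs_nonneg R]
  have hBM : B ≤ M := by rw [hM]; linarith [abs_nonneg R]
  have hRM : R ≤ M := by rw [hM]; linarith [le_abs_self R]
  have hq0 : ∀ x, ‖q t x‖ ≤ M * W x := fun x =>
    (hA x).trans (mul_le_mul_of_nonneg_right hAM (hW x))
  have hqt : ∀ x, ‖qt t x‖ ≤ M * W x := fun x =>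
    (hB x).trans (mul_le_mul_of_nonneg_right hBM (hW x))
  refine ⟨M, hM0, hq0, hqt, fun h hh x => ?_⟩
  have h1 : ‖q (t + h) x - q t x - h * qt t x‖ ≤ M * h ^ 2 * W x := by
    refine (hR h hh x).trans (mul_le_mul_of_nonneg_right ?_ (hW x))
    exact mul_le_mul_of_nonneg_right hRM (sq_nonneg h)
  have hMW : M * W x ≤ M := mul_le_of_le_one_right hM0 (hW1 x)
  have hsq : h ^ 2 ≤ |h| := by
    rw [← sq_abs]
    nlinarith [abs_nonneg h]
  have h2 : ‖q (t + h) x - q t x‖ ≤ 2 * M * |h| := by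
    have e : q (t + h) x - q t x = (q (t + h) x - q t x - h * qt t x) + h * qt t x := by ring
    rw [e]
    refine (norm_add_le _ _).trans ?_
    rw [norm_mul, Complex.norm_real, Real.norm_eq_abs]
    have h3 : |h| * ‖qt t x‖ ≤ |h| * M :=
      mul_le_mul_of_nonneg_left ((hqt x).trans hMW) (abs_nonneg h)
    have h4 : M * h ^ 2 * W x ≤ M * |h| := by
      refine (mul_le_of_le_one_right (by positivity) (hW1 x)).trans ?_
      exact mul_le_mul_of_nonneg_left hsq hM0
    linarith
  refine ⟨h1, h2, ?_⟩
  have e : q (t + h) x = (q (t + h) x - q t x) + q t x := by ring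
  rw [e]
  refine (norm_add_le _ _).trans ?_
  have h5 : 2 * M * |h| ≤ 2 * M * 1 := mul_le_mul_of_nonneg_left hh (by positivity)
  linarith [hq0 x]

theorem HasDerivAt.complex_conj {f : ℝ → ℂ} {f' : ℂ} {x : ℝ} (h : HasDerivAt f f' x) :
    HasDerivAt (fun y => (starRingEnd ℂ) (f y)) ((starRingEnd ℂ) f') x := by
  simpa using! h.star

theorem IsEvolution.mass_conserved (hμ : SpaceMeasure μ p W) (hq : IsEvolution p W q q₁ q₂ qt)
    (t : ℝ) : ∫ x, ‖q t x‖ ^ 2 ∂μ = ∫ x, ‖q 0 x‖ ^ 2 ∂μ := by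
  have hc : ∀ t, ∫ x, q t x * (starRingEnd ℂ) (q t x) ∂μ = ((∫ x, ‖q t x‖ ^ 2 ∂μ : ℝ) : ℂ) := by
    intro t
    rw [← integral_complex_ofReal]
    congr 1
    ext x
    rw [Complex.mul_conj, Complex.normSq_eq_norm_sq]
  have hT := hq.tame
  have hTt := hq.tame_time hμ
  have key := integral_eq_of_quadratic_remainder hμ.weight_int
    (F := fun t x => q t x * (starRingEnd ℂ) (q t x))
    (F' := fun t x => qt t x * (starRingEnd ℂ) (q t x) + q t x * (starRingEnd ℂ) (qt t x))
    (fun t => ((hT t).mul_tame hμ (hT t).conj).integrable hμ)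
    (fun t => (((hTt t).mul_tame hμ (hT t).conj).add
      ((hT t).mul_tame hμ (hTt t).conj)).integrable hμ) ?_ ?_ t
  · rw [hc, hc] at key
    exact_mod_cast key
  · intro t
    have h1 := hq.tame₁ t
    have h0 := hT t
    -- The flux of the mass: `∂_t |q|² = ∂_x (i(q_x q̄ - q q̄_x) - (3/2)|q|⁴)`.
    refine hμ.integral_deriv
      (fun x => Complex.I * (q₁ t x * (starRingEnd ℂ) (q t x) - q t x * (starRingEnd ℂ) (q₁ t x))
        + (-(3 / 2)) * ((q t x * (starRingEnd ℂ) (q t x)) * (q t x * (starRingEnd ℂ) (q t x))))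
      _ ?_ (((hTt t).mul_tame hμ h0.conj).add (h0.mul_tame hμ (hTt t).conj)) ?_
    · exact (((h1.mul_tame hμ h0.conj).sub (h0.mul_tame hμ h1.conj)).const_mul _).add
        (((h0.mul_tame hμ h0.conj).mul_tame hμ (h0.mul_tame hμ h0.conj)).const_mul _)
    · intro x
      have d0 := hq.deriv₁ t x
      have d1 := hq.deriv₂ t x
      have d0c := d0.complex_conj
      have d1c := d1.complex_conj
      refine ((((d1.mul d0c).sub (d0.mul d1c)).const_mul Complex.I).add
        (((d0.mul d0c).mul (d0.mul d0c)).const_mul (-(3 / 2)))).congr_deriv ?_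
      rw [hq.eqn]
      simp only [Pi.mul_apply, map_sub, map_add, map_mul, map_pow, Complex.conj_I,
        Complex.conj_conj, map_ofNat]
      ring
  · intro t
    obtain ⟨M, hM0, hq0, hqt, hR⟩ := hq.exists_bounds hμ t
    refine ⟨M * (3 * M) + M * M + (2 * M) * M, fun h hh x => ?_⟩
    obtain ⟨hr, -, hq'⟩ := hR h hh x
    have hW := hμ.weight_nonneg x
    have hMW : M * W x ≤ M := mul_le_of_le_one_right hM0 (hμ.weight_le_one x)
    set r := q (t + h) x - q t x - h * qt t x with hrdef
    have hstar : (starRingEnd ℂ) r = (starRingEnd ℂ) (q (t + h) x) - (starRingEnd ℂ) (q t x)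
        - h * (starRingEnd ℂ) (qt t x) := by
      rw [hrdef]; simp
    have e : q (t + h) x * (starRingEnd ℂ) (q (t + h) x) - q t x * (starRingEnd ℂ) (q t x)
        - h * (qt t x * (starRingEnd ℂ) (q t x) + q t x * (starRingEnd ℂ) (qt t x))
        = r * (starRingEnd ℂ) (q (t + h) x) + (h : ℂ) ^ 2 * (qt t x * (starRingEnd ℂ) (qt t x))
          + (q t x + h * qt t x) * (starRingEnd ℂ) r := by
      rw [hstar, hrdef]; ring
    rw [e]
    have b1 : ‖r * (starRingEnd ℂ) (q (t + h) x)‖ ≤ (M * h ^ 2 * W x) * (3 * M) := by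
      rw [norm_mul, RCLike.norm_conj]
      exact mul_le_mul hr hq' (norm_nonneg _) (by positivity)
    have b2 : ‖(h : ℂ) ^ 2 * (qt t x * (starRingEnd ℂ) (qt t x))‖ ≤ h ^ 2 * ((M * W x) * M) := by
      rw [norm_mul, norm_mul, RCLike.norm_conj, norm_pow, Complex.norm_real, Real.norm_eq_abs,
        sq_abs]
      exact mul_le_mul_of_nonneg_left (mul_le_mul (hqt x) ((hqt x).trans hMW) (norm_nonneg _)
        (by positivity)) (sq_nonneg h)
    have b3 : ‖(q t x + h * qt t x) * (starRingEnd ℂ) r‖ ≤ (2 * M) * (M * h ^ 2 * W x) := by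
      rw [norm_mul, RCLike.norm_conj]
      refine mul_le_mul ?_ hr (norm_nonneg _) (by positivity)
      refine (norm_add_le _ _).trans ?_
      rw [norm_mul, Complex.norm_real, Real.norm_eq_abs]
      have := mul_le_mul hh ((hqt x).trans hMW) (norm_nonneg _) zero_le_one
      linarith [(hq0 x).trans hMW]
    refine (norm_add₃_le).trans ((add_le_add (add_le_add b1 b2) b3).trans (le_of_eq ?_))
    ring

/-- The coefficient of the flux `j = -i z q r + B u` of the density `q u`. -/
noncomputable def fluxCoeff (z q q₁ r : ℂ) : ℂ := 2 * z * q + Complex.I * q₁ + q ^ 2 * r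

/-- The time derivative of a Riccati solution. -/
noncomputable def riccatiFlow (z q q₁ r r₁ u : ℂ) : ℂ :=
  2 * z ^ 2 * r - Complex.I * z * r₁ + z * q * r ^ 2
    + 2 * (2 * Complex.I * z ^ 2 + Complex.I * z * q * r) * u - fluxCoeff z q q₁ r * u ^ 2

theorem isBddCont_riccatiFlow {z : ℂ} {q q₁ r r₁ u : ℝ → ℂ} (hq : IsBddCont q)
    (hq₁ : IsBddCont q₁) (hr : IsBddCont r) (hr₁ : IsBddCont r₁) (hu : IsBddCont u) :
    IsBddCont fun x => riccatiFlow z (q x) (q₁ x) (r x) (r₁ x) (u x) := by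
  have hB := ((((isBddCont_const (2 * z)).mul hq).add ((isBddCont_const Complex.I).mul hq₁)).add
    ((hq.pow 2).mul hr)).mul (hu.pow 2)
  have hA := (isBddCont_const (2 * Complex.I * z ^ 2)).add
    (((isBddCont_const (Complex.I * z)).mul hq).mul hr)
  exact (((((isBddCont_const (2 * z ^ 2)).mul hr).sub ((isBddCont_const (Complex.I * z)).mul
    hr₁)).add (((isBddCont_const z).mul hq).mul (hr.pow 2))).add
    (((isBddCont_const 2).mul hA).mul hu)).sub hB

/-- Compatibility of the space and time equations of the Lax pair: `P = riccatiFlow` solves the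
Riccati equation linearised at `u`, `P' = (2iz - 2qu)P + z r_t - q_t u²`, where `q_t = i q_xx + (q²
r)_x` and `r_t = -i r_xx + (q r²)_x` have been written out. For `r = -q̄` the former is the equation
of the theorem. -/
theorem hasDerivAt_riccatiFlow {z : ℂ} {q q₁ r r₁ u : ℝ → ℂ} {q₂ r₂ : ℂ} {x : ℝ}
    (hq : HasDerivAt q (q₁ x) x) (hq₁ : HasDerivAt q₁ q₂ x)
    (hr : HasDerivAt r (r₁ x) x) (hr₁ : HasDerivAt r₁ r₂ x)
    (hu : HasDerivAt u (2 * Complex.I * z * u x + z * r x - q x * u x ^ 2) x) :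
    HasDerivAt (fun x => riccatiFlow z (q x) (q₁ x) (r x) (r₁ x) (u x))
      ((2 * Complex.I * z - 2 * q x * u x) * riccatiFlow z (q x) (q₁ x) (r x) (r₁ x) (u x)
        + z * (-Complex.I * r₂ + (2 * r x * r₁ x * q x + r x ^ 2 * q₁ x))
        - (Complex.I * q₂ + (2 * q x * q₁ x * r x + q x ^ 2 * r₁ x)) * u x ^ 2) x := by
  have hI : Complex.I ^ 2 = -1 := Complex.I_sq
  unfold riccatiFlow fluxCoeff
  have hB := ((hq.const_mul (2 * z)).add (hq₁.const_mul Complex.I)).add ((hq.pow 2).mul hr)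
  have hA := ((hq.const_mul (Complex.I * z)).mul hr).const_add (2 * Complex.I * z ^ 2)
  refine ((((((hr.const_mul (2 * z ^ 2)).sub (hr₁.const_mul (Complex.I * z))).add
    ((hq.const_mul z).mul (hr.pow 2))).add ((hA.const_mul 2).mul hu)).sub
      (hB.mul (hu.pow 2))).congr_deriv ?_)
  simp only [Pi.pow_apply, Pi.mul_apply, Pi.add_apply]
  push_cast
  ring_nf
  simp only [hI]
  ring

/-- The local conservation law `∂_t(q u) = ∂_x j`, with `riccatiFlow` in the role of `∂_t u`. -/
theorem hasDerivAt_flux {z : ℂ} {q q₁ r r₁ u : ℝ → ℂ} {q₂ : ℂ} {x : ℝ}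
    (hq : HasDerivAt q (q₁ x) x) (hq₁ : HasDerivAt q₁ q₂ x) (hr : HasDerivAt r (r₁ x) x)
    (hu : HasDerivAt u (2 * Complex.I * z * u x + z * r x - q x * u x ^ 2) x) :
    HasDerivAt (fun x => -Complex.I * z * (q x * r x) + fluxCoeff z (q x) (q₁ x) (r x) * u x)
      ((Complex.I * q₂ + (2 * q x * q₁ x * r x + q x ^ 2 * r₁ x)) * u x
        + q x * riccatiFlow z (q x) (q₁ x) (r x) (r₁ x) (u x)) x := by
  have hI : Complex.I ^ 2 = -1 := Complex.I_sq
  unfold riccatiFlow fluxCoeff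
  have hB := ((hq.const_mul (2 * z)).add (hq₁.const_mul Complex.I)).add ((hq.pow 2).mul hr)
  refine ((((hq.mul hr).const_mul (-Complex.I * z)).add (hB.mul hu)).congr_deriv ?_)
  simp only [Pi.pow_apply, Pi.mul_apply, Pi.add_apply]
  push_cast
  ring_nf
  simp only [hI]
  ring

/-- Quadratic remainder estimate for the Riccati solution along the flow. -/
theorem IsEvolution.riccati_remainder (hμ : SpaceMeasure μ p W)
    (hq : IsEvolution p W q q₁ q₂ qt) {κ c : ℝ} (hκ : 1 ≤ κ) (hc : 0 < c) (hc8 : c ≤ 1 / 8)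
    (hsmall : ∀ t x, decayConv κ (fun y => ‖q t y‖) x ≤ c / √κ) {u : ℝ → ℝ → ℂ}
    (hu : ∀ t, IsRiccati κ (2 * c * √κ) (q t) (u t)) (t : ℝ) :
    ∃ K : ℝ, 0 ≤ K ∧ ∀ h : ℝ, |h| ≤ 1 → ∀ x, ‖u (t + h) x - u t x - h * riccatiFlow (Complex.I * κ)
      (q t x) (q₁ t x) (-(starRingEnd ℂ) (q t x)) (-(starRingEnd ℂ) (q₁ t x)) (u t x)‖
        ≤ K * h ^ 2 := by
  have hκ0 : 0 < κ := by linarith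
  obtain ⟨M, hM0, hq0, hqt, hR⟩ := hq.exists_bounds hμ t
  have hbc := fun t => (hq.tame t).isBddCont hμ
  have hbc₁ := (hq.tame₁ t).isBddCont hμ
  have hbct := (hq.tame_time hμ t).isBddCont hμ
  set ρ := 2 * c * √κ with hρ
  have hρ0 : 0 ≤ ρ := by positivity
  have hub := fun t => (hu t).isBddCont
  set P : ℝ → ℂ := fun x => riccatiFlow (Complex.I * κ)
      (q t x) (q₁ t x) (-(starRingEnd ℂ) (q t x)) (-(starRingEnd ℂ) (q₁ t x)) (u t x) with hP
  have hPb : IsBddCont P :=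
    isBddCont_riccatiFlow (hbc t) hbc₁ (hbc t).conj.neg hbc₁.conj.neg (hub t)
  -- At `z = iκ` one has `2iz = -2κ`, so `P` solves a damped equation of the same type as `u`.
  have hPd : ∀ x, HasDerivAt P (-(2 * κ) * P x - 2 * q t x * u t x * P x
      - Complex.I * κ * (starRingEnd ℂ) (qt t x) - qt t x * u t x ^ 2) x := by
    intro x
    have d0 := hq.deriv₁ t x
    have d1 := hq.deriv₂ t x
    have := hasDerivAt_riccatiFlow (z := Complex.I * κ) d0 d1 d0.complex_conj.neg
      d1.complex_conj.neg ((hu t).hasDerivAt x |>.congr_deriv (by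
        simp only [Pi.neg_apply]
        linear_combination (-2 * κ * u t x) * Complex.I_sq))
    refine this.congr_deriv ?_
    rw [hq.eqn]
    simp only [Pi.neg_apply, map_sub, map_add, map_mul, map_pow, Complex.conj_I,
      Complex.conj_conj, map_ofNat]
    change (_ - _) * P x + _ - _ = _
    linear_combination (2 * κ * P x) * Complex.I_sq
  obtain ⟨N, hN⟩ := hPb.bdd
  have hN0 : 0 ≤ N := (norm_nonneg _).trans (hN 0)
  refine ⟨(κ * M + M * ρ ^ 2 + N * (3 * M * (4 * M) + 2 * (2 * M) * ρ)) / κ, by positivity,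
    fun h hh x => ?_⟩
  have hW := hμ.weight_nonneg
  have hW1 := hμ.weight_le_one
  have hδ : ∀ x, ‖u (t + h) x - u t x‖ ≤ 2 * (2 * M * |h|) := fun x =>
    (hu t).norm_sub_le_of_potential hκ hc hc8 (hbc t) (hbc _) (hsmall _) (hu (t + h))
      (fun x => (hR h hh x).2.1) x
  have hrb : IsBddCont fun x => q (t + h) x - q t x - h * qt t x :=
    ((hbc _).sub (hbc t)).sub ((isBddCont_const (h : ℂ)).mul hbct)
  have hdb : IsBddCont fun x => q (t + h) x - q t x := (hbc _).sub (hbc t)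
  -- The Taylor remainder of `u` in time solves a linear equation with the coefficient of
  -- `riccati_coefficient_le`. Its source consists of the Taylor remainder of `q` and of `h P` times
  -- increments of `q` and `u` that are `O(h)`, hence is `O(h²)`.
  have key := norm_le_of_linear_equation hκ0
    (v := fun x => u (t + h) x - u t x - h * P x)
    (b := fun x => -(q (t + h) x * (u (t + h) x + u t x)))
    (g := fun x => (-(Complex.I * κ)) * (starRingEnd ℂ) (q (t + h) x - q t x - h * qt t x)
      - (q (t + h) x - q t x - h * qt t x) * u t x ^ 2
      - (h : ℂ) * (P x * (q (t + h) x * (u (t + h) x - u t x)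
        + 2 * (q (t + h) x - q t x) * u t x)))
    (γ := (κ * M + M * ρ ^ 2 + N * (3 * M * (4 * M) + 2 * (2 * M) * ρ)) * h ^ 2)
    (((hub _).sub (hub t)).sub ((isBddCont_const (h : ℂ)).mul hPb)).bdd
    ((hbc _).mul ((hub _).add (hub t))).neg
    ((((isBddCont_const (-(Complex.I * (κ : ℂ)))).mul hrb.conj).sub (hrb.mul ((hub t).pow 2))).sub
      ((isBddCont_const (h : ℂ)).mul (hPb.mul (((hbc _).mul ((hub _).sub (hub t))).add
        (((isBddCont_const (2 : ℂ)).mul hdb).mul (hub t)))))) ?_ ?_ ?_ x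
  · refine key.trans (le_of_eq ?_)
    ring
  · intro x
    obtain ⟨hr, hd, hq'⟩ := hR h hh x
    have hr' : ‖q (t + h) x - q t x - h * qt t x‖ ≤ M * h ^ 2 :=
      hr.trans (mul_le_of_le_one_right (by positivity) (hW1 x))
    have hux := (hu t).norm_le x
    have b1 : ‖(-(Complex.I * κ)) * (starRingEnd ℂ) (q (t + h) x - q t x - h * qt t x)‖
        ≤ κ * (M * h ^ 2) := by
      rw [norm_mul, norm_neg, norm_mul, Complex.norm_I, one_mul, Complex.norm_real,
        Real.norm_of_nonneg hκ0.le, RCLike.norm_conj]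
      exact mul_le_mul_of_nonneg_left hr' hκ0.le
    have b2 : ‖(q (t + h) x - q t x - h * qt t x) * u t x ^ 2‖ ≤ (M * h ^ 2) * ρ ^ 2 := by
      rw [norm_mul, norm_pow]
      exact mul_le_mul hr' (pow_le_pow_left₀ (norm_nonneg _) hux 2) (by positivity) (by positivity)
    have b3 : ‖(h : ℂ) * (P x * (q (t + h) x * (u (t + h) x - u t x)
        + 2 * (q (t + h) x - q t x) * u t x))‖
        ≤ |h| * (N * ((3 * M) * (2 * (2 * M * |h|)) + 2 * (2 * M * |h|) * ρ)) := by
      rw [norm_mul, norm_mul, Complex.norm_real, Real.norm_eq_abs]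
      refine mul_le_mul_of_nonneg_left (mul_le_mul (hN x) ((norm_add_le _ _).trans
        (add_le_add ?_ ?_)) (norm_nonneg _) hN0) (abs_nonneg h)
      · rw [norm_mul]
        exact mul_le_mul hq' (hδ x) (norm_nonneg _) (by positivity)
      · rw [norm_mul, norm_mul, Complex.norm_ofNat]
        exact mul_le_mul (mul_le_mul_of_nonneg_left hd zero_le_two) hux (norm_nonneg _)
          (by positivity)
    refine (norm_sub_le _ _).trans ((add_le_add ((norm_sub_le _ _).trans
      (add_le_add b1 b2)) b3).trans (le_of_eq ?_))
    rw [← sq_abs h]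
    ring
  · exact riccati_coefficient_le hκ hc hc8 (hbc _) (hsmall _) (hu t).norm_le (hu (t + h)).norm_le
  · intro x
    refine ((((hu (t + h)).hasDerivAt x).sub ((hu t).hasDerivAt x)).sub
      ((hPd x).const_mul (h : ℂ))).congr_deriv ?_
    simp only [map_sub, map_mul, Complex.conj_ofReal]
    ring

/-- `hasDerivAt_flux` makes the integral of the formal time derivative vanish, and
`riccati_remainder` justifies that derivative. Only boundedness of `u` is needed: the weight `W`
comes from the factor `q`. -/
theorem IsEvolution.momentum_conserved (hμ : SpaceMeasure μ p W)
    (hq : IsEvolution p W q q₁ q₂ qt) {κ c : ℝ} (hκ : 1 ≤ κ) (hc : 0 < c) (hc8 : c ≤ 1 / 8)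
    (hsmall : ∀ t x, decayConv κ (fun y => ‖q t y‖) x ≤ c / √κ) {u : ℝ → ℝ → ℂ}
    (hu : ∀ t, IsRiccati κ (2 * c * √κ) (q t) (u t)) (t : ℝ) :
    ∫ x, q t x * u t x ∂μ = ∫ x, q 0 x * u 0 x ∂μ := by
  have hκ0 : 0 < κ := by linarith
  have hbc := fun t => (hq.tame t).isBddCont hμ
  have hub := fun t => (hu t).isBddCont
  -- The translate of `u` by the period of `q` solves the same Riccati equation, so uniqueness (`η =
  -- 0`) makes `u` periodic.
  have huper : ∀ t, Function.Periodic (u t) p := by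
    intro t x
    have hsh : IsRiccati κ (2 * c * √κ) (q t) (fun x => u t (x + p)) := by
      refine ⟨fun x => (hu t).norm_le _, fun x => ?_⟩
      have := ((hu t).hasDerivAt (x + p)).comp_add_const x p
      rwa [(hq.tame t).per] at this
    have := (hu t).norm_sub_le_of_potential hκ hc hc8 (hbc t) (hbc t) (hsmall t) hsh (η := 0)
      (fun x => by simp) x
    rw [mul_zero] at this
    exact sub_eq_zero.1 (norm_le_zero_iff.1 this)
  set P : ℝ → ℝ → ℂ := fun t x => riccatiFlow (Complex.I * κ)
      (q t x) (q₁ t x) (-(starRingEnd ℂ) (q t x)) (-(starRingEnd ℂ) (q₁ t x)) (u t x) with hP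
  have hPb : ∀ t, IsBddCont (P t) := fun t => by
    have hbc₁ := (hq.tame₁ t).isBddCont hμ
    exact isBddCont_riccatiFlow (hbc t) hbc₁ (hbc t).conj.neg hbc₁.conj.neg (hub t)
  have hPp : ∀ t, Function.Periodic (P t) p := fun t x => by
    simp only [hP, (hq.tame t).per x, (hq.tame₁ t).per x, huper t x]
  have hTt := hq.tame_time hμ
  have hFt : ∀ t, Tame p W (fun x => qt t x * u t x + q t x * P t x) := fun t =>
    ((hTt t).mul hμ (hub t) (huper t)).add ((hq.tame t).mul hμ (hPb t) (hPp t))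
  refine integral_eq_of_quadratic_remainder hμ.weight_int (F := fun t x => q t x * u t x)
    (F' := fun t x => qt t x * u t x + q t x * P t x)
    (fun t => ((hq.tame t).mul hμ (hub t) (huper t)).integrable hμ)
    (fun t => (hFt t).integrable hμ) ?_ ?_ t
  · intro t
    have h0 := hq.tame t
    have h1 := hq.tame₁ t
    refine hμ.integral_deriv (fun x => -Complex.I * (Complex.I * κ)
        * (q t x * -(starRingEnd ℂ) (q t x)) + fluxCoeff (Complex.I * κ) (q t x) (q₁ t x)
        (-(starRingEnd ℂ) (q t x)) * u t x) _ ?_ (hFt t) fun x => ?_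
    · have hB : Tame p W (fun x => fluxCoeff (Complex.I * κ) (q t x) (q₁ t x)
          (-(starRingEnd ℂ) (q t x))) := by
        have := ((h0.const_mul (2 * (Complex.I * (κ : ℂ)))).add (h1.const_mul Complex.I)).add
          ((h0.mul_tame hμ h0).mul_tame hμ h0.conj.neg)
        simpa only [fluxCoeff, pow_two] using this
      exact ((h0.mul_tame hμ h0.conj.neg).const_mul _).add (hB.mul hμ (hub t) (huper t))
    · have d0 := hq.deriv₁ t x
      have d1 := hq.deriv₂ t x
      have := hasDerivAt_flux (z := Complex.I * κ) (r₁ := fun x => -(starRingEnd ℂ) (q₁ t x))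
        d0 d1 d0.complex_conj.neg ((hu t).hasDerivAt x |>.congr_deriv (by
          simp only [Pi.neg_apply]
          linear_combination (-2 * κ * u t x) * Complex.I_sq))
      refine this.congr_deriv ?_
      rw [hq.eqn]
      simp only [Pi.neg_apply, hP]
      ring
  · intro t
    obtain ⟨K, hK0, hK⟩ := hq.riccati_remainder hμ hκ hc hc8 hsmall hu t
    obtain ⟨M, hM0, hq0, hqt, hR⟩ := hq.exists_bounds hμ t
    refine ⟨M * (2 * c * √κ) + M * (4 * M) + M * K, fun h hh x => ?_⟩
    obtain ⟨hr, -, -⟩ := hR h hh x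
    have hW := hμ.weight_nonneg x
    have hδ : ‖u (t + h) x - u t x‖ ≤ 2 * (2 * M * |h|) :=
      (hu t).norm_sub_le_of_potential hκ hc hc8 (hbc t) (hbc _) (hsmall _) (hu (t + h))
        (fun x => (hR h hh x).2.1) x
    have e : q (t + h) x * u (t + h) x - q t x * u t x - h * (qt t x * u t x + q t x * P t x)
        = (q (t + h) x - q t x - h * qt t x) * u (t + h) x
          + h * (qt t x * (u (t + h) x - u t x))
          + q t x * (u (t + h) x - u t x - h * P t x) := by ring
    rw [e]
    have b1 : ‖(q (t + h) x - q t x - h * qt t x) * u (t + h) x‖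
        ≤ (M * h ^ 2 * W x) * (2 * c * √κ) := by
      rw [norm_mul]
      exact mul_le_mul hr ((hu (t + h)).norm_le x) (norm_nonneg _) (by positivity)
    have b2 : ‖(h : ℂ) * (qt t x * (u (t + h) x - u t x))‖
        ≤ |h| * ((M * W x) * (2 * (2 * M * |h|))) := by
      rw [norm_mul, norm_mul, Complex.norm_real, Real.norm_eq_abs]
      exact mul_le_mul_of_nonneg_left (mul_le_mul (hqt x) hδ (norm_nonneg _) (by positivity))
        (abs_nonneg h)
    have b3 : ‖q t x * (u (t + h) x - u t x - h * P t x)‖ ≤ (M * W x) * (K * h ^ 2) := by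
      rw [norm_mul]
      exact mul_le_mul (hq0 x) (hK h hh x) (norm_nonneg _) (by positivity)
    refine (norm_add₃_le).trans ((add_le_add (add_le_add b1 b2) b3).trans (le_of_eq ?_))
    rw [← sq_abs h]
    ring

end Conservation

/-! ### The conserved quantity in frequency variables. -/

section Fourier

/-- `(2π)^(-1/2) ∫ f(x) e^{-ixξ} dμ(x)`. -/
noncomputable def angularHat (μ : Measure ℝ) (f : ℝ → ℂ) (ξ : ℝ) : ℂ :=
  ((Real.sqrt (2 * Real.pi))⁻¹ : ℝ) * ∫ x, f x * Complex.exp (-(Complex.I * ξ * x)) ∂μ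

/-- Absolutely convergent Fourier inversion, with frequency measure `ν`. -/
structure HasFourierInversion (μ ν : Measure ℝ) (f : ℝ → ℂ) : Prop where
  integrable : Integrable (angularHat μ f) ν
  inversion : ∀ x, f x = ((Real.sqrt (2 * Real.pi))⁻¹ : ℝ)
    * ∫ ξ, angularHat μ f ξ * Complex.exp (Complex.I * ξ * x) ∂ν

variable {μ ν : Measure ℝ} {p : ℝ} {W : ℝ → ℝ} {f : ℝ → ℂ}

theorem norm_exp_I_mul_mul (ξ x : ℝ) : ‖Complex.exp (Complex.I * ξ * x)‖ = 1 := by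
  rw [show Complex.I * (ξ : ℂ) * x = ((ξ * x : ℝ) : ℂ) * Complex.I by push_cast; ring]
  exact Complex.norm_exp_ofReal_mul_I _

theorem norm_exp_neg_I_mul_mul (ξ x : ℝ) : ‖Complex.exp (-(Complex.I * ξ * x))‖ = 1 := by
  rw [show -(Complex.I * (ξ : ℂ) * x) = ((-(ξ * x) : ℝ) : ℂ) * Complex.I by push_cast; ring]
  exact Complex.norm_exp_ofReal_mul_I _

theorem inv_sqrt_two_pi_nonneg : 0 ≤ (Real.sqrt (2 * Real.pi))⁻¹ := by positivity

theorem inv_sqrt_two_pi_le_one : (Real.sqrt (2 * Real.pi))⁻¹ ≤ 1 := by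
  refine inv_le_one_of_one_le₀ (Real.one_le_sqrt.2 ?_)
  linarith [Real.pi_gt_three]

theorem norm_angularHat_le (ξ : ℝ) : ‖angularHat μ f ξ‖ ≤ ∫ x, ‖f x‖ ∂μ := by
  unfold angularHat
  rw [norm_mul, Complex.norm_real, Real.norm_of_nonneg inv_sqrt_two_pi_nonneg]
  have h : ‖∫ x, f x * Complex.exp (-(Complex.I * ξ * x)) ∂μ‖ ≤ ∫ x, ‖f x‖ ∂μ := by
    refine (norm_integral_le_integral_norm _).trans (le_of_eq ?_)
    congr 1
    ext x
    rw [norm_mul, norm_exp_neg_I_mul_mul, mul_one]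
  exact (mul_le_mul_of_nonneg_left h inv_sqrt_two_pi_nonneg).trans
    (mul_le_of_le_one_left (integral_nonneg fun _ => norm_nonneg _) inv_sqrt_two_pi_le_one)

/-- Multiplying the Fourier representation of `f` by a bounded multiplier `m`: the pairing with
`f` is `∫ |f̂|² m̄`. -/
theorem HasFourierInversion.integral_mul_conj [SFinite μ] [SFinite ν]
    (hf : HasFourierInversion μ ν f) (hfi : Integrable f μ) {m : ℝ → ℂ} (hm : Continuous m)
    (hm1 : ∀ ξ, ‖m ξ‖ ≤ 1) :
    ∫ x, f x * (starRingEnd ℂ) (((Real.sqrt (2 * Real.pi))⁻¹ : ℝ)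
      * ∫ ξ, angularHat μ f ξ * m ξ * Complex.exp (Complex.I * ξ * x) ∂ν) ∂μ
    = ∫ ξ, (‖angularHat μ f ξ‖ ^ 2 : ℝ) * (starRingEnd ℂ) (m ξ) ∂ν := by
  set g := angularHat μ f with hg
  have hgm : Integrable (fun ξ => (starRingEnd ℂ) (g ξ * m ξ)) ν := by
    have h1 : Integrable (fun ξ => g ξ * m ξ) ν :=
      hf.integrable.mul_bdd (c := 1) hm.aestronglyMeasurable (Filter.Eventually.of_forall hm1)
    exact (Complex.conjCLE : ℂ →L[ℝ] ℂ).integrable_comp h1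
  -- Fubini applies because `f` is integrable in space and `f̂ m` in frequency.
  have hswap := integral_integral_swap (μ := μ) (ν := ν)
    (f := fun x ξ => (f x * (starRingEnd ℂ) (g ξ * m ξ)) * Complex.exp (-(Complex.I * ξ * x))) (by
      refine (hfi.mul_prod hgm).mul_bdd (c := 1) ?_ (Filter.Eventually.of_forall fun z => ?_)
      · exact Continuous.aestronglyMeasurable (by fun_prop)
      · exact (norm_exp_neg_I_mul_mul _ _).le)
  calc _ = ((Real.sqrt (2 * Real.pi))⁻¹ : ℝ) * ∫ x, ∫ ξ, (f x * (starRingEnd ℂ) (g ξ * m ξ))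
          * Complex.exp (-(Complex.I * ξ * x)) ∂ν ∂μ := by
        rw [← integral_const_mul]
        congr 1
        ext x
        rw [map_mul, Complex.conj_ofReal, ← integral_conj, mul_left_comm, ← integral_const_mul]
        congr 2
        ext ξ
        rw [map_mul, ← Complex.exp_conj]
        simp only [map_mul, Complex.conj_I, Complex.conj_ofReal]
        rw [show -Complex.I * (ξ : ℂ) * x = -(Complex.I * ξ * x) by ring]
        ring
    _ = ∫ ξ, (starRingEnd ℂ) (g ξ * m ξ) * g ξ ∂ν := by
        rw [hswap, ← integral_const_mul]
        congr 1
        ext ξ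
        have hgξ : g ξ = ((Real.sqrt (2 * Real.pi))⁻¹ : ℝ)
          * ∫ x, f x * Complex.exp (-(Complex.I * ξ * x)) ∂μ := rfl
        rw [mul_comm _ (g ξ)]
        nth_rw 2 [hgξ]
        rw [mul_assoc, ← integral_mul_const]
        congr 2
        ext x
        ring
    _ = _ := by
        congr 1
        ext ξ
        rw [map_mul, mul_right_comm, ← Complex.normSq_eq_norm_sq, Complex.normSq_eq_conj_mul_self]

theorem two_mul_add_I_mul_ne_zero {κ : ℝ} (hκ : 0 < κ) (ξ : ℝ) :
    (2 * κ + Complex.I * ξ : ℂ) ≠ 0 := fun h => by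
  have := congrArg Complex.re h
  simp at this
  linarith

theorem norm_inv_two_mul_add_I_mul (κ ξ : ℝ) :
    ‖(2 * κ + Complex.I * ξ : ℂ)⁻¹‖ = (√(4 * κ ^ 2 + ξ ^ 2))⁻¹ := by
  rw [norm_inv, Complex.norm_eq_sqrt_sq_add_sq]
  congr 2
  simp
  ring

/-- The Fourier integral with multiplier `1/(2κ + iξ)` is a bounded solution of `v' = f - 2κv`,
hence equals `decayConv` by uniqueness. Differentiation under the integral is dominated by `|f̂|`,
since `|ξ| ≤ |2κ + iξ|`. -/
theorem HasFourierInversion.decayConv_eq (hf : HasFourierInversion μ ν f) (hfb : IsBddCont f)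
    {κ : ℝ} (hκ : 0 < κ) (x : ℝ) :
    decayConv κ f x = ((Real.sqrt (2 * Real.pi))⁻¹ : ℝ) * ∫ ξ, angularHat μ f ξ
      * (2 * κ + Complex.I * ξ : ℂ)⁻¹ * Complex.exp (Complex.I * ξ * x) ∂ν := by
  set g := angularHat μ f with hg
  have hm : Continuous fun ξ : ℝ => (2 * κ + Complex.I * ξ : ℂ)⁻¹ :=
    Continuous.inv₀ (by fun_prop) (two_mul_add_I_mul_ne_zero hκ)
  have hmle : ∀ ξ : ℝ, ‖(2 * κ + Complex.I * ξ : ℂ)⁻¹‖ ≤ (2 * κ)⁻¹ := fun ξ => by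
    rw [norm_inv_two_mul_add_I_mul]
    refine inv_anti₀ (by positivity) (Real.le_sqrt_of_sq_le ?_)
    nlinarith [sq_nonneg ξ]
  have hgm : Integrable (fun ξ => g ξ * (2 * κ + Complex.I * ξ : ℂ)⁻¹) ν :=
    hf.integrable.mul_bdd hm.aestronglyMeasurable (Filter.Eventually.of_forall hmle)
  have hgme : ∀ x : ℝ, Integrable (fun ξ => g ξ * (2 * κ + Complex.I * ξ : ℂ)⁻¹
      * Complex.exp (Complex.I * ξ * x)) ν := fun x =>
    hgm.mul_bdd (c := 1) (Continuous.aestronglyMeasurable (by fun_prop))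
      (Filter.Eventually.of_forall fun ξ => (norm_exp_I_mul_mul ξ x).le)
  symm
  refine eq_decayConv_of_hasDerivAt hκ (v := fun x : ℝ => ((Real.sqrt (2 * Real.pi))⁻¹ : ℝ)
    * ∫ ξ, g ξ * (2 * κ + Complex.I * ξ : ℂ)⁻¹ * Complex.exp (Complex.I * ξ * x) ∂ν) hfb
    ⟨(Real.sqrt (2 * Real.pi))⁻¹
      * ∫ ξ, ‖g ξ * (2 * κ + Complex.I * ξ : ℂ)⁻¹‖ ∂ν, fun x => ?_⟩ (fun x => ?_) x
  · rw [norm_mul, Complex.norm_real, Real.norm_of_nonneg inv_sqrt_two_pi_nonneg]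
    refine mul_le_mul_of_nonneg_left ((norm_integral_le_integral_norm _).trans (le_of_eq ?_))
      inv_sqrt_two_pi_nonneg
    congr 1
    ext ξ
    rw [norm_mul, norm_exp_I_mul_mul, mul_one]
  · have hbound : ∀ ξ x : ℝ, ‖g ξ * (2 * κ + Complex.I * ξ : ℂ)⁻¹
        * (Complex.exp (Complex.I * ξ * x) * (Complex.I * ξ))‖ ≤ ‖g ξ‖ := fun ξ x => by
      rw [norm_mul, norm_mul, norm_mul, norm_exp_I_mul_mul, one_mul, mul_assoc]
      refine mul_le_of_le_one_right (norm_nonneg _) ?_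
      rw [norm_inv_two_mul_add_I_mul, norm_mul, Complex.norm_I, one_mul, Complex.norm_real,
        Real.norm_eq_abs]
      refine inv_mul_le_one_of_le₀ (Real.le_sqrt_of_sq_le ?_) (by positivity)
      rw [sq_abs]
      nlinarith [sq_nonneg κ]
    have hder := (hasDerivAt_integral_of_dominated_loc_of_deriv_le (μ := ν) (x₀ := x)
      (F := fun (x : ℝ) (ξ : ℝ) => g ξ * (2 * κ + Complex.I * ξ : ℂ)⁻¹
        * Complex.exp (Complex.I * ξ * x))
      (F' := fun (x : ℝ) (ξ : ℝ) => g ξ * (2 * κ + Complex.I * ξ : ℂ)⁻¹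
        * (Complex.exp (Complex.I * ξ * x) * (Complex.I * ξ))) (bound := fun ξ => ‖g ξ‖)
      (Metric.ball_mem_nhds x one_pos)
      (Filter.Eventually.of_forall fun y => (hgme y).aestronglyMeasurable) (hgme x)
      (hgm.aestronglyMeasurable.mul (Continuous.aestronglyMeasurable (by fun_prop)))
      (Filter.Eventually.of_forall fun ξ y _ => hbound ξ y) hf.integrable.norm
      (Filter.Eventually.of_forall fun ξ y _ => by
        have h1 : HasDerivAt (fun y : ℝ => Complex.I * (ξ : ℂ) * (y : ℂ)) (Complex.I * ξ) y := by
          simpa using (Complex.ofRealCLM.hasDerivAt (x := y)).const_mul (Complex.I * (ξ : ℂ))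
        exact (h1.cexp).const_mul _))
    refine (hder.2.const_mul (((Real.sqrt (2 * Real.pi))⁻¹ : ℝ) : ℂ)).congr_deriv ?_
    rw [hf.inversion x, ← hg, Complex.real_smul, mul_left_comm, ← mul_sub]
    congr 1
    rw [← integral_const_mul, ← integral_sub]
    · congr 1
      ext ξ
      have := two_mul_add_I_mul_ne_zero hκ ξ
      field_simp
      push_cast
      ring
    · exact hf.integrable.mul_bdd (c := 1) (Continuous.aestronglyMeasurable (by fun_prop))
        (Filter.Eventually.of_forall fun ξ => (norm_exp_I_mul_mul ξ x).le)
    · exact (hgme x).const_mul _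

theorem HasFourierInversion.integrable_sq (hf : HasFourierInversion μ ν f) :
    Integrable (fun ξ => ‖angularHat μ f ξ‖ ^ 2) ν := by
  simp only [pow_two]
  refine hf.integrable.norm.mul_bdd (c := ∫ x, ‖f x‖ ∂μ) hf.integrable.norm.aestronglyMeasurable
    (Filter.Eventually.of_forall fun ξ => ?_)
  rw [norm_norm]
  exact norm_angularHat_le ξ

theorem HasFourierInversion.plancherel [SFinite μ] [SFinite ν] (hf : HasFourierInversion μ ν f)
    (hfi : Integrable f μ) : ∫ x, ‖f x‖ ^ 2 ∂μ = ∫ ξ, ‖angularHat μ f ξ‖ ^ 2 ∂ν := by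
  have h := hf.integral_mul_conj hfi (m := fun _ => 1) continuous_const (fun _ => by simp)
  simp only [mul_one, map_one] at h
  simp_rw [← hf.inversion, Complex.mul_conj, Complex.normSq_eq_norm_sq] at h
  rw [integral_complex_ofReal, integral_complex_ofReal] at h
  exact_mod_cast h

/-- `∫ f · conj (G f)` in frequency. -/
theorem HasFourierInversion.re_integral_mul_conj_decayConv [SFinite μ] [SFinite ν]
    (hf : HasFourierInversion μ ν f) (hfi : Integrable f μ) (hfb : IsBddCont f)
    {κ : ℝ} (hκ : 1 ≤ κ) :
    (∫ x, f x * (starRingEnd ℂ) (decayConv κ f x) ∂μ).re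
      = ∫ ξ, ‖angularHat μ f ξ‖ ^ 2 * (2 * κ / (4 * κ ^ 2 + ξ ^ 2)) ∂ν := by
  have hκ0 : 0 < κ := by linarith
  have hm : Continuous fun ξ : ℝ => (2 * κ + Complex.I * ξ : ℂ)⁻¹ :=
    Continuous.inv₀ (by fun_prop) (two_mul_add_I_mul_ne_zero hκ0)
  have hmle : ∀ ξ : ℝ, ‖(2 * κ + Complex.I * ξ : ℂ)⁻¹‖ ≤ 1 := fun ξ => by
    rw [norm_inv_two_mul_add_I_mul]
    refine inv_le_one_of_one_le₀ (Real.one_le_sqrt.2 ?_)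
    nlinarith [sq_nonneg ξ]
  simp_rw [hf.decayConv_eq hfb hκ0]
  rw [hf.integral_mul_conj hfi hm hmle, ← RCLike.re_to_complex, ← integral_re]
  · congr 1
    ext ξ
    rw [RCLike.re_to_complex, Complex.re_ofReal_mul, Complex.conj_re, Complex.inv_re]
    congr 1
    simp [Complex.normSq_apply]
    ring
  · refine Integrable.mul_bdd (c := 1) hf.integrable_sq.ofReal ?_
      (Filter.Eventually.of_forall fun ξ => ?_)
    · exact (Complex.continuous_conj.comp hm).aestronglyMeasurable
    · rw [RCLike.norm_conj]
      exact hmle ξ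

/-- The high-frequency part `∫ ξ² / (4κ² + ξ²) |f̂|²` of the mass. -/
noncomputable def highEnergy (μ ν : Measure ℝ) (κ : ℝ) (f : ℝ → ℂ) : ℝ :=
  ∫ ξ, ξ ^ 2 / (4 * κ ^ 2 + ξ ^ 2) * ‖angularHat μ f ξ‖ ^ 2 ∂ν

/-- The quadratic part of `∫ f u` is `-iκ ∫ f conj(G f)`, with imaginary part `-κ ∫ 2κ/(4κ² + ξ²)
|f̂|²`. Added twice to the mass it leaves the multiplier `1 - 4κ²/(4κ² + ξ²)`. For a solution the
first two terms on the right are conserved. -/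
theorem highEnergy_eq [SFinite μ] [SFinite ν] (hμ : SpaceMeasure μ p W) (hT : Tame p W f)
    (hf : HasFourierInversion μ ν f) {κ ρ : ℝ} (hκ : 1 ≤ κ) {u : ℝ → ℂ}
    (hu : IsRiccati κ ρ f u) :
    highEnergy μ ν κ f = (∫ x, ‖f x‖ ^ 2 ∂μ) + 2 * (∫ x, f x * u x ∂μ).im
      + 2 * (∫ x, f x * decayConv κ (fun y => f y * u y ^ 2) x ∂μ).im := by
  have hκ0 : 0 < κ := by linarith
  have hfi := hT.integrable hμ
  have hfb := hT.isBddCont hμ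
  have hNb := isBddCont_decayConv hκ0 (hfb.mul (hu.isBddCont.pow 2))
  have hGb := (isBddCont_decayConv hκ0 hfb).conj
  have hmul : ∀ {w : ℝ → ℂ}, IsBddCont w → Integrable (fun x => f x * w x) μ := fun hw =>
    hfi.mul_bdd hw.cont.aestronglyMeasurable (Filter.Eventually.of_forall hw.bdd.choose_spec)
  have hΦ : ∫ x, f x * u x ∂μ = -(Complex.I * κ) * (∫ x, f x * (starRingEnd ℂ) (decayConv κ f x) ∂μ)
      - ∫ x, f x * decayConv κ (fun y => f y * u y ^ 2) x ∂μ := by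
    rw [← integral_const_mul, ← integral_sub ((hmul hGb).const_mul _) (hmul hNb)]
    congr 1
    ext x
    rw [hu.eq_decayConv hκ0 hfb x]
    have h1 : IsBddCont fun x => -(Complex.I * κ * (starRingEnd ℂ) (f x)) :=
      ((isBddCont_const (Complex.I * (κ : ℂ))).mul hfb.conj).neg
    rw [decayConv_sub hκ0 h1 (hfb.mul (hu.isBddCont.pow 2))]
    have : (fun x => -(Complex.I * κ * (starRingEnd ℂ) (f x)))
        = fun x => (-(Complex.I * κ)) * (starRingEnd ℂ) (f x) := by ext; ring
    rw [this, decayConv_const_mul, decayConv_conj]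
    ring
  have hJ := hf.re_integral_mul_conj_decayConv hfi hfb hκ
  have him : (∫ x, f x * u x ∂μ).im
      = -κ * (∫ x, f x * (starRingEnd ℂ) (decayConv κ f x) ∂μ).re
        - (∫ x, f x * decayConv κ (fun y => f y * u y ^ 2) x ∂μ).im := by
    rw [hΦ]
    simp
  have hint2 : Integrable (fun ξ => ‖angularHat μ f ξ‖ ^ 2 * (2 * κ / (4 * κ ^ 2 + ξ ^ 2))) ν := by
    refine hf.integrable_sq.mul_bdd (c := 1) ?_ (Filter.Eventually.of_forall fun ξ => ?_)
    · refine (Continuous.div (by fun_prop) (by fun_prop) fun ξ => ?_).aestronglyMeasurable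
      positivity
    · rw [Real.norm_of_nonneg (by positivity), div_le_one (by positivity)]
      nlinarith [sq_nonneg ξ]
  have hE : highEnergy μ ν κ f = (∫ ξ, ‖angularHat μ f ξ‖ ^ 2 ∂ν)
      - 2 * κ * ∫ ξ, ‖angularHat μ f ξ‖ ^ 2 * (2 * κ / (4 * κ ^ 2 + ξ ^ 2)) ∂ν := by
    rw [← integral_const_mul, ← integral_sub hf.integrable_sq (hint2.const_mul _)]
    unfold highEnergy
    congr 1
    ext ξ
    field_simp
    ring
  rw [hE, him, hJ, hf.plancherel hfi]
  ring

/-- The quartic error. -/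
theorem IsRiccati.norm_integral_quartic_le (hμ : SpaceMeasure μ p W) (hT : Tame p W f) {κ c : ℝ}
    (hκ : 1 ≤ κ) (hc : 0 < c) (hc8 : c ≤ 1 / 8) {u : ℝ → ℂ}
    (hsmall : ∀ x, decayConv κ (fun y => ‖f y‖) x ≤ c / √κ)
    (hu : IsRiccati κ (2 * c * √κ) f u) {B : ℝ} (hB : ∀ x, κ * ‖decayConv κ f x‖ ≤ B)
    (hmass : ∫ x, ‖f x‖ ^ 2 ∂μ ≤ c ^ 2) :
    ‖∫ x, f x * decayConv κ (fun y => f y * u y ^ 2) x ∂μ‖ ≤ 2 * B ^ 2 * c ^ 2 / κ := by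
  have hκ0 : 0 < κ := by linarith
  have hs : 0 < √κ := Real.sqrt_pos.2 hκ0
  have hfb := hT.isBddCont hμ
  have hB0 : 0 ≤ B := le_trans (by positivity) (hB 0)
  -- The bound `ρ` on `u` does not see where the frequencies of `f` lie; `B` does. One factor of
  -- `u²` is bounded by `ρ`, so the quadratic term is at most `2c²S ≤ S/2`.
  have hub : ∀ x, ‖u x‖ ≤ 2 * B := by
    set S := ⨆ x, ‖u x‖ with hS
    have hbd : BddAbove (Set.range fun x => ‖u x‖) :=
      ⟨_, by rintro _ ⟨x, rfl⟩; exact hu.norm_le x⟩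
    have hle : ∀ x, ‖u x‖ ≤ S := fun x => le_ciSup hbd x
    have hS0 : 0 ≤ S := (norm_nonneg _).trans (hle 0)
    have hmain : S ≤ B + 1 / 2 * S := by
      refine ciSup_le fun x => ?_
      rw [hu.eq_decayConv hκ0 hfb x]
      have h1 : IsBddCont fun x => -(Complex.I * κ * (starRingEnd ℂ) (f x)) :=
        ((isBddCont_const (Complex.I * (κ : ℂ))).mul hfb.conj).neg
      rw [decayConv_sub hκ0 h1 (hfb.mul (hu.isBddCont.pow 2))]
      have : (fun x => -(Complex.I * κ * (starRingEnd ℂ) (f x)))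
          = fun x => (-(Complex.I * κ)) * (starRingEnd ℂ) (f x) := by ext; ring
      rw [this, decayConv_const_mul, decayConv_conj]
      refine (norm_sub_le _ _).trans (add_le_add ?_ ?_)
      · rw [norm_mul, norm_neg, norm_mul, Complex.norm_I, one_mul, Complex.norm_real,
          Real.norm_of_nonneg hκ0.le, RCLike.norm_conj]
        exact hB x
      · refine (norm_decayConv_mul_le hκ0 hfb hsmall (m := (2 * c * √κ) * S)
          (fun y => ?_) x).trans ?_
        · rw [pow_two, norm_mul]
          exact mul_le_mul (hu.norm_le y) (hle y) (norm_nonneg _) (by positivity)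
        · have : 2 * c * √κ * S * (c / √κ) = 2 * c ^ 2 * S := by field_simp
          rw [this]
          exact mul_le_mul_of_nonneg_right (by nlinarith) hS0
    intro x
    linarith [hle x]
  have h1 : IsBddCont fun y => (2 * B) ^ 2 * ‖f y‖ := by
    obtain ⟨M, hM⟩ := hfb.bdd
    refine ⟨continuous_const.mul hfb.cont.norm, (2 * B) ^ 2 * M, fun x => ?_⟩
    rw [norm_mul, Real.norm_of_nonneg (by positivity), norm_norm]
    exact mul_le_mul_of_nonneg_left (hM x) (by positivity)
  -- Both factors `u` go into the sup norm; what remains is `∫ |f| G|f| ≤ c²/(2κ)`, and `(2B)² ·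
  -- c²/(2κ) = 2B²c²/κ`.
  have hG : ∀ x, ‖decayConv κ (fun y => f y * u y ^ 2) x‖
      ≤ (2 * B) ^ 2 * decayConv κ (fun y => ‖f y‖) x := fun x => by
    rw [← decayConv_real_const_mul]
    refine norm_decayConv_le_of_le hκ0 h1 (fun y => ?_) x
    rw [norm_mul, norm_pow, mul_comm]
    exact mul_le_mul_of_nonneg_right (pow_le_pow_left₀ (norm_nonneg _) (hub y) 2) (norm_nonneg _)
  have hGb := isBddCont_decayConv hκ0 hfb.norm
  have hint : Integrable (fun x => ‖f x‖ * decayConv κ (fun y => ‖f y‖) x) μ :=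
    (hT.integrable hμ).norm.mul_bdd hGb.cont.aestronglyMeasurable
      (Filter.Eventually.of_forall hGb.bdd.choose_spec)
  refine (norm_integral_le_of_norm_le (hint.const_mul ((2 * B) ^ 2))
    (Filter.Eventually.of_forall fun x => ?_)).trans ?_
  · rw [norm_mul, mul_left_comm]
    exact mul_le_mul_of_nonneg_left (hG x) (norm_nonneg _)
  · rw [integral_const_mul]
    have h2 := (integral_norm_mul_decayConv_le hκ hμ hT).trans
      (div_le_div_of_nonneg_right hmass (by positivity : 0 ≤ 2 * κ))
    refine (mul_le_mul_of_nonneg_left h2 (by positivity)).trans (le_of_eq ?_)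
    field_simp

end Fourier

/-! ### Weighted `ℓ^r` norms and the absorption argument. -/

section Sequences

variable {r : ℝ≥0∞}

theorem eLpNorm_top_count (b : ℕ → ℝ≥0∞) : eLpNorm b ⊤ Measure.count = ⨆ j, b j := by
  simp [eLpNorm_exponent_top, eLpNormEssSup_eq_essSup_enorm]

theorem eLpNorm_count_eq (hr : 1 ≤ r) (hr' : r ≠ ⊤) (b : ℕ → ℝ≥0∞) :
    eLpNorm b r Measure.count = (∑' j, b j ^ r.toReal) ^ (1 / r.toReal) := by
  rw [eLpNorm_eq_lintegral_rpow_enorm_toReal (zero_lt_one.trans_le hr).ne' hr', lintegral_count]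
  simp

theorem toReal_pos_of_one_le (hr : 1 ≤ r) (hr' : r ≠ ⊤) : 0 < r.toReal :=
  ENNReal.toReal_pos (zero_lt_one.trans_le hr).ne' hr'

theorem eLpNorm_count_mono {a b : ℕ → ℝ≥0∞} (h : ∀ j, a j ≤ b j) :
    eLpNorm a r Measure.count ≤ eLpNorm b r Measure.count :=
  eLpNorm_mono_enorm fun j => by simpa using h j

theorem eLpNorm_count_const_mul (hr : 1 ≤ r) (c : ℝ≥0∞) (b : ℕ → ℝ≥0∞) :
    eLpNorm (fun j => c * b j) r Measure.count = c * eLpNorm b r Measure.count := by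
  rcases eq_or_ne r ⊤ with rfl | hr'
  · rw [eLpNorm_top_count, eLpNorm_top_count, ENNReal.mul_iSup]
  · have h0 := toReal_pos_of_one_le hr hr'
    rw [eLpNorm_count_eq hr hr', eLpNorm_count_eq hr hr']
    simp_rw [ENNReal.mul_rpow_of_nonneg _ _ h0.le]
    rw [ENNReal.tsum_mul_left, ENNReal.mul_rpow_of_nonneg _ _ (by positivity), ← ENNReal.rpow_mul,
      mul_one_div_cancel h0.ne', ENNReal.rpow_one]

/-- Minkowski's inequality for a series in `ℓ^r`. -/
theorem eLpNorm_count_tsum_le (hr : 1 ≤ r) (f : ℕ → ℕ → ℝ≥0∞) :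
    eLpNorm (fun j => ∑' m, f m j) r Measure.count ≤ ∑' m, eLpNorm (f m) r Measure.count := by
  have hfin : ∀ n, eLpNorm (fun j => ∑ m ∈ Finset.range n, f m j) r Measure.count
      ≤ ∑' m, eLpNorm (f m) r Measure.count := fun n => by
    have h1 := eLpNorm_sum_le (μ := Measure.count) (f := f) (s := Finset.range n)
      (fun m _ => (measurable_from_nat (f := f m)).aestronglyMeasurable) hr
    have h2 : (∑ m ∈ Finset.range n, f m) = fun j => ∑ m ∈ Finset.range n, f m j := by
      ext j; simp
    rw [h2] at h1
    exact h1.trans (ENNReal.sum_le_tsum _)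
  rcases eq_or_ne r ⊤ with rfl | hr'
  · simp only [eLpNorm_top_count] at hfin ⊢
    refine iSup_le fun j => ?_
    rw [ENNReal.tsum_eq_iSup_nat (f := fun m => f m j)]
    refine iSup_le fun n => ?_
    exact (le_iSup (fun j => ∑ m ∈ Finset.range n, f m j) j).trans (hfin n)
  · have h0 := toReal_pos_of_one_le hr hr'
    have hrew : ∀ b : ℕ → ℝ≥0∞, eLpNorm b r Measure.count
        = (∫⁻ j, b j ^ r.toReal ∂Measure.count) ^ (1 / r.toReal) := fun b => by
      rw [eLpNorm_count_eq hr hr', lintegral_count]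
    set T := ∑' m, eLpNorm (f m) r Measure.count
    rw [hrew]
    rw [one_div, ENNReal.rpow_inv_le_iff h0]
    -- Monotone convergence passes from the finite sums in `hfin` to the series.
    have hpt : ∀ j, (∑' m, f m j) ^ r.toReal
        = ⨆ n, (∑ m ∈ Finset.range n, f m j) ^ r.toReal := fun j => by
      rw [ENNReal.tsum_eq_iSup_nat]
      exact (ENNReal.orderIsoRpow r.toReal h0).map_iSup _
    simp_rw [hpt]
    rw [lintegral_iSup (fun n => measurable_from_nat)]
    · refine iSup_le fun n => ?_
      have := hfin n
      rwa [hrew, one_div, ENNReal.rpow_inv_le_iff h0] at this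
    · intro m n hmn j
      exact ENNReal.rpow_le_rpow (Finset.sum_le_sum_of_subset (by
        simpa using hmn)) h0.le

theorem eLpNorm_count_comp_le (hr : 1 ≤ r) (b : ℕ → ℝ≥0∞) {e : ℕ → ℕ}
    (he : Function.Injective e) :
    eLpNorm (fun j => b (e j)) r Measure.count ≤ eLpNorm b r Measure.count := by
  rcases eq_or_ne r ⊤ with rfl | hr'
  · rw [eLpNorm_top_count, eLpNorm_top_count]
    exact iSup_comp_le b e
  · have h0 := toReal_pos_of_one_le hr hr'
    rw [eLpNorm_count_eq hr hr', eLpNorm_count_eq hr hr']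
    exact ENNReal.rpow_le_rpow (ENNReal.tsum_comp_le_tsum_of_injective he
      (fun j => b j ^ r.toReal)) (by positivity)

theorem eLpNorm_count_shift_le (hr : 1 ≤ r) (b : ℕ → ℝ≥0∞) (m : ℕ) :
    eLpNorm (fun j => if m ≤ j then b (j - m) else 0) r Measure.count
      ≤ eLpNorm b r Measure.count := by
  rcases eq_or_ne r ⊤ with rfl | hr'
  · rw [eLpNorm_top_count, eLpNorm_top_count]
    refine iSup_le fun j => ?_
    split_ifs
    · exact le_iSup b _
    · exact zero_le
  · have h0 := toReal_pos_of_one_le hr hr'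
    rw [eLpNorm_count_eq hr hr', eLpNorm_count_eq hr hr']
    refine le_of_eq ?_
    congr 1
    have hinj : Function.Injective fun j : ℕ => j + m := fun a b h => by simpa using h
    rw [← hinj.tsum_eq (f := fun j => (if m ≤ j then b (j - m) else 0) ^ r.toReal)]
    · simp
    · intro j hj
      by_cases hmj : m ≤ j
      · exact ⟨j - m, by simp [hmj]⟩
      · simp [hmj, h0] at hj

/-- The average `∑_k 2^{-(j-k)₊/2} a_k`, which dominates the contribution of all frequencies to
quantities localized at frequency `2^j`. -/
noncomputable def dyadicAverage (a : ℕ → ℝ≥0∞) (j : ℕ) : ℝ≥0∞ :=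
  ∑' k, ENNReal.ofReal (√2)⁻¹ ^ (j - k) * a k

theorem ofReal_two_rpow_natCast_mul (s : ℝ) (j : ℕ) :
    ENNReal.ofReal ((2 : ℝ) ^ ((j : ℝ) * s)) = ENNReal.ofReal ((2 : ℝ) ^ s) ^ j := by
  rw [← ENNReal.ofReal_pow (by positivity), ← Real.rpow_mul_natCast (by norm_num), mul_comm]

/-- In terms of `2^{ks} a_k` the averaging is a sum of shifts: those from `k = j - m` carry `2^{(s -
1/2)m}`, summable as `s < 1/2`, those from `k = j + m + 1` carry `2^{-s(m+1)}`, summable as `s > 0`.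
Shifts do not increase the `ℓ^r` norm, so Minkowski's inequality gives an `S` independent of `r`. -/
theorem exists_dyadicNorm_dyadicAverage_le {s : ℝ} (hs0 : 0 < s) (hs1 : s < 1 / 2) :
    ∃ S : ℝ≥0, ∀ r : ℝ≥0∞, 1 ≤ r → ∀ a : ℕ → ℝ≥0∞,
      dyadicNorm s r (dyadicAverage a) ≤ S * dyadicNorm s r a := by
  set σ := ENNReal.ofReal ((2 : ℝ) ^ s) with hσ
  set τ := ENNReal.ofReal (√2)⁻¹ with hτ
  have hσ1 : 1 < σ := by
    rw [hσ, ENNReal.one_lt_ofReal]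
    exact Real.one_lt_rpow (by norm_num) hs0
  have hσt : σ ≠ ⊤ := ENNReal.ofReal_ne_top
  have hσ0 : σ ≠ 0 := (zero_lt_one.trans hσ1).ne'
  have hx : σ * τ < 1 := by
    rw [hσ, hτ, ← ENNReal.ofReal_mul (by positivity), ENNReal.ofReal_lt_one, ← div_eq_mul_inv,
      div_lt_one (by positivity), Real.sqrt_eq_rpow]
    exact Real.rpow_lt_rpow_of_exponent_lt (by norm_num) hs1
  have hy : σ⁻¹ < 1 := ENNReal.inv_lt_one.2 hσ1
  set S : ℝ≥0∞ := ∑' m : ℕ, (σ * τ) ^ m + ∑' m : ℕ, σ⁻¹ ^ (m + 1) with hS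
  have hSt : S ≠ ⊤ := by
    refine ENNReal.add_ne_top.2 ⟨?_, ?_⟩
    · rw [ENNReal.tsum_geometric]
      exact ENNReal.inv_ne_top.2 (tsub_pos_of_lt hx).ne'
    · refine ne_top_of_le_ne_top (b := ∑' m : ℕ, σ⁻¹ ^ m) ?_
        (ENNReal.tsum_comp_le_tsum_of_injective (add_left_injective 1) _)
      rw [ENNReal.tsum_geometric]
      exact ENNReal.inv_ne_top.2 (tsub_pos_of_lt hy).ne'
  refine ⟨S.toNNReal, fun r hr a => ?_⟩
  rw [ENNReal.coe_toNNReal hSt]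
  unfold dyadicNorm
  simp_rw [ofReal_two_rpow_natCast_mul]
  rw [← hσ]
  set b : ℕ → ℝ≥0∞ := fun k => σ ^ k * a k with hb
  have hsplit : ∀ j, σ ^ j * dyadicAverage a j
      = ∑' m, (σ * τ) ^ m * (if m ≤ j then b (j - m) else 0)
        + ∑' m, σ⁻¹ ^ (m + 1) * b (m + (j + 1)) := by
    intro j
    unfold dyadicAverage
    rw [← ENNReal.tsum_mul_left, ← Summable.sum_add_tsum_nat_add' (k := j + 1) ENNReal.summable]
    congr 1
    · rw [← Finset.sum_range_reflect, tsum_eq_sum (s := Finset.range (j + 1))]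
      · refine Finset.sum_congr rfl fun m hm => ?_
        have hmj : m ≤ j := by simpa [Nat.lt_succ_iff] using hm
        have e1 : j + 1 - 1 - m = j - m := by omega
        have e2 : j - (j - m) = m := by omega
        rw [if_pos hmj, e1, e2, hb]
        nth_rw 1 [show j = m + (j - m) by omega]
        rw [pow_add, mul_pow]
        ring
      · intro m hm
        have : ¬ m ≤ j := by simpa [Nat.lt_succ_iff] using hm
        simp [this]
    · congr 1
      ext m
      have e1 : j - (m + (j + 1)) = 0 := by omega
      rw [e1, pow_zero, one_mul, hb]
      simp only
      rw [show m + (j + 1) = (m + 1) + j by ring, pow_add σ (m + 1), ← mul_assoc,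
          ← mul_assoc, ← mul_pow,
        ENNReal.inv_mul_cancel hσ0 hσt, one_pow, one_mul]
  simp_rw [hsplit]
  have h1 : eLpNorm (fun j => ∑' m, (σ * τ) ^ m * (if m ≤ j then b (j - m) else 0)) r
      Measure.count ≤ (∑' m : ℕ, (σ * τ) ^ m) * eLpNorm b r Measure.count := by
    refine (eLpNorm_count_tsum_le hr
      (fun m j => (σ * τ) ^ m * (if m ≤ j then b (j - m) else 0))).trans ?_
    rw [← ENNReal.tsum_mul_right]
    refine ENNReal.tsum_le_tsum fun m => ?_
    rw [eLpNorm_count_const_mul hr]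
    gcongr
    exact eLpNorm_count_shift_le hr b m
  have h2 : eLpNorm (fun j => ∑' m, σ⁻¹ ^ (m + 1) * b (m + (j + 1))) r Measure.count
      ≤ (∑' m : ℕ, σ⁻¹ ^ (m + 1)) * eLpNorm b r Measure.count := by
    refine (eLpNorm_count_tsum_le hr (fun m j => σ⁻¹ ^ (m + 1) * b (m + (j + 1)))).trans ?_
    rw [← ENNReal.tsum_mul_right]
    refine ENNReal.tsum_le_tsum fun m => ?_
    rw [eLpNorm_count_const_mul hr]
    gcongr
    exact eLpNorm_count_comp_le hr b fun x y h => by simpa using h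
  rw [hS, add_mul]
  exact (eLpNorm_add_le (measurable_from_nat.aestronglyMeasurable)
    (measurable_from_nat.aestronglyMeasurable) hr).trans (add_le_add h1 h2)

/-- Geometric decay `a_j = O(2^{-j/2})` gives a finite norm for `s < 1/2`. -/
theorem dyadicNorm_ne_top {s : ℝ} (hs1 : s < 1 / 2) (hr : 1 ≤ r) {a : ℕ → ℝ≥0∞} {K : ℝ≥0∞}
    (hK : K ≠ ⊤) (ha : ∀ j, a j ≤ K * ENNReal.ofReal (√2)⁻¹ ^ j) : dyadicNorm s r a ≠ ⊤ := by
  set σ := ENNReal.ofReal ((2 : ℝ) ^ s) with hσ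
  set τ := ENNReal.ofReal (√2)⁻¹ with hτ
  have hx : σ * τ < 1 := by
    rw [hσ, hτ, ← ENNReal.ofReal_mul (by positivity), ENNReal.ofReal_lt_one, ← div_eq_mul_inv,
      div_lt_one (by positivity), Real.sqrt_eq_rpow]
    exact Real.rpow_lt_rpow_of_exponent_lt (by norm_num) hs1
  have hle : dyadicNorm s r a ≤ K * eLpNorm (fun j : ℕ => (σ * τ) ^ j) r Measure.count := by
    rw [← eLpNorm_count_const_mul hr]
    refine eLpNorm_count_mono fun j => ?_
    rw [ofReal_two_rpow_natCast_mul, ← hσ, mul_pow]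
    calc σ ^ j * a j ≤ σ ^ j * (K * τ ^ j) := by gcongr; exact ha j
      _ = K * (σ ^ j * τ ^ j) := by ring
  refine ne_top_of_le_ne_top (ENNReal.mul_ne_top hK ?_) hle
  rcases eq_or_ne r ⊤ with rfl | hr'
  · rw [eLpNorm_top_count]
    exact ne_top_of_le_ne_top ENNReal.one_ne_top (iSup_le fun j => pow_le_one' hx.le j)
  · have h0 := toReal_pos_of_one_le hr hr'
    rw [eLpNorm_count_eq hr hr']
    refine ENNReal.rpow_ne_top_of_nonneg (by positivity) ?_
    have : ∀ j : ℕ, ((σ * τ) ^ j) ^ r.toReal = ((σ * τ) ^ r.toReal) ^ j := fun j => by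
      rw [← ENNReal.rpow_natCast, ← ENNReal.rpow_natCast, ← ENNReal.rpow_mul, ← ENNReal.rpow_mul,
        mul_comm (j : ℝ)]
    simp_rw [this]
    rw [ENNReal.tsum_geometric]
    exact ENNReal.inv_ne_top.2 (tsub_pos_of_lt (ENNReal.rpow_lt_one hx h0)).ne'

/-- The `ε` term returns at most half of the norm of `a`, which can be subtracted because that norm
is finite. -/
theorem dyadicNorm_le_of_le_dyadicAverage {s : ℝ} (hr : 1 ≤ r) {S : ℝ≥0}
    (hS : ∀ a : ℕ → ℝ≥0∞, dyadicNorm s r (dyadicAverage a) ≤ S * dyadicNorm s r a)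
    {a b : ℕ → ℝ≥0∞} {A ε : ℝ≥0} (hab : ∀ j, a j ≤ A * dyadicAverage b j + ε * dyadicAverage a j)
    (hε : ε * S ≤ 1 / 2) (ha : dyadicNorm s r a ≠ ⊤) :
    dyadicNorm s r a ≤ (2 * A * S : ℝ≥0) * dyadicNorm s r b := by
  have h1 : dyadicNorm s r a ≤ A * dyadicNorm s r (dyadicAverage b)
      + ε * dyadicNorm s r (dyadicAverage a) := by
    unfold dyadicNorm
    rw [← eLpNorm_count_const_mul hr, ← eLpNorm_count_const_mul hr]
    refine le_trans (eLpNorm_count_mono fun j => ?_)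
      (eLpNorm_add_le (measurable_from_nat.aestronglyMeasurable)
        (measurable_from_nat.aestronglyMeasurable) hr)
    simp only [Pi.add_apply]
    calc _ ≤ ENNReal.ofReal ((2 : ℝ) ^ ((j : ℝ) * s))
          * (A * dyadicAverage b j + ε * dyadicAverage a j) := by gcongr; exact hab j
      _ = _ := by ring
  set x := dyadicNorm s r a
  set y := dyadicNorm s r b
  have h2 : x ≤ A * (S * y) + (1 / 2 : ℝ≥0) * x := by
    refine h1.trans (add_le_add (by gcongr; exact hS b) ?_)
    calc (ε : ℝ≥0∞) * dyadicNorm s r (dyadicAverage a) ≤ ε * (S * x) := by gcongr; exact hS a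
      _ = ((ε * S : ℝ≥0) : ℝ≥0∞) * x := by push_cast; ring
      _ ≤ _ := by gcongr
  rcases eq_or_ne y ⊤ with hy | hy
  · rcases eq_or_ne (2 * A * S) 0 with h0 | h0
    · have h3 : A * (S * y) = 0 := by
        rcases mul_eq_zero.1 h0 with h | h
        · have : A = 0 := by simpa using h
          simp [this]
        · simp [h]
      rw [h3, zero_add] at h2
      have hx0 : x = 0 := by
        by_contra hne
        have : (1 / 2 : ℝ≥0) * x < x := by
          lift x to ℝ≥0 using ha with x'
          have hx' : 0 < x' := by
            rw [pos_iff_ne_zero]; rintro rfl; simp at hne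
          rw [← ENNReal.coe_mul, ENNReal.coe_lt_coe, ← NNReal.coe_lt_coe]
          push_cast
          have : (0 : ℝ) < x' := hx'
          linarith
        exact absurd h2 (not_le.2 this)
      rw [hx0]
      exact zero_le
    · rw [hy, ENNReal.mul_top (by exact_mod_cast h0)]
      exact le_top
  · lift x to ℝ≥0 using ha with x'
    lift y to ℝ≥0 using hy with y'
    have h3 : x' ≤ A * (S * y') + 1 / 2 * x' := by exact_mod_cast h2
    have h4 : x' ≤ 2 * A * S * y' := by
      rw [← NNReal.coe_le_coe] at h3 ⊢
      push_cast at h3 ⊢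
      linarith
    exact_mod_cast h4

end Sequences

/-! ### Multiplier estimates on dyadic shells. -/

section Shells

variable {ν : Measure ℝ} {F : ℝ → ℂ}

theorem measurableSet_dyadicShell (k : ℕ) : MeasurableSet (dyadicShell k) := by
  cases k with
  | zero => exact measurableSet_le continuous_abs.measurable measurable_const
  | succ k =>
    exact (measurableSet_lt measurable_const continuous_abs.measurable).inter
      (measurableSet_le continuous_abs.measurable measurable_const)

theorem abs_le_of_mem_dyadicShell {k : ℕ} {ξ : ℝ} (h : ξ ∈ dyadicShell k) : |ξ| ≤ 2 ^ k := by
  cases k with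
  | zero => simpa [dyadicShell] using h
  | succ k => exact h.2

theorem lt_abs_of_mem_dyadicShell {j k : ℕ} {ξ : ℝ} (h : ξ ∈ dyadicShell k) (hjk : j < k) :
    2 ^ j < |ξ| := by
  cases k with
  | zero => omega
  | succ k => exact (pow_le_pow_right₀ (by norm_num) (by omega)).trans_lt h.1

theorem pairwise_disjoint_dyadicShell :
    Pairwise (Function.onFun Disjoint dyadicShell) := by
  have key : ∀ j k, j < k → Disjoint (dyadicShell j) (dyadicShell k) := fun j k hjk =>
    Set.disjoint_left.2 fun ξ h1 h2 =>
      absurd (abs_le_of_mem_dyadicShell h1) (not_le.2 (lt_abs_of_mem_dyadicShell h2 hjk))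
  intro j k hjk
  rcases lt_or_gt_of_ne hjk with h | h
  · exact key j k h
  · exact (key k j h).symm

theorem iUnion_dyadicShell : ⋃ k, dyadicShell k = Set.univ := by
  refine Set.eq_univ_of_forall fun ξ => ?_
  have hex : ∃ k : ℕ, |ξ| ≤ 2 ^ k := by
    obtain ⟨k, hk⟩ := pow_unbounded_of_one_lt |ξ| (by norm_num : (1 : ℝ) < 2)
    exact ⟨k, hk.le⟩
  classical
  refine Set.mem_iUnion.2 ⟨Nat.find hex, ?_⟩
  have h1 := Nat.find_spec hex
  cases hk : Nat.find hex with
  | zero => rw [hk] at h1; simpa [dyadicShell] using h1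
  | succ k =>
    rw [hk] at h1
    exact ⟨not_le.1 (Nat.find_min hex (by omega)), h1⟩

theorem lintegral_eq_tsum_dyadicShell (G : ℝ → ℝ≥0∞) :
    ∫⁻ ξ, G ξ ∂ν = ∑' k, ∫⁻ ξ in dyadicShell k, G ξ ∂ν := by
  rw [← lintegral_iUnion measurableSet_dyadicShell pairwise_disjoint_dyadicShell,
    iUnion_dyadicShell, Measure.restrict_univ]

/-- The dyadic pieces of the `L²` norm. -/
noncomputable def shellNorm (ν : Measure ℝ) (F : ℝ → ℂ) (k : ℕ) : ℝ≥0∞ :=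
  eLpNorm F 2 (ν.restrict (dyadicShell k))

theorem shellNorm_sq (k : ℕ) :
    shellNorm ν F k ^ 2 = ∫⁻ ξ in dyadicShell k, ‖F ξ‖ₑ ^ 2 ∂ν := by
  have := eLpNorm_nnreal_pow_eq_lintegral (f := F) (μ := ν.restrict (dyadicShell k))
    (p := 2) (by norm_num)
  unfold shellNorm
  simpa using this

theorem ENNReal.tsum_sq_le (a : ℕ → ℝ≥0∞) : ∑' k, a k ^ 2 ≤ (∑' k, a k) ^ 2 := by
  rw [pow_two (∑' k, a k), ← ENNReal.tsum_mul_right]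
  refine ENNReal.tsum_le_tsum fun k => ?_
  rw [pow_two]
  gcongr
  exact ENNReal.le_tsum k

theorem lintegral_sq_le_dyadicAverage_zero :
    ∫⁻ ξ, ‖F ξ‖ₑ ^ 2 ∂ν ≤ dyadicAverage (shellNorm ν F) 0 ^ 2 := by
  rw [lintegral_eq_tsum_dyadicShell]
  simp_rw [← shellNorm_sq]
  refine (ENNReal.tsum_sq_le _).trans (le_of_eq ?_)
  simp [dyadicAverage]

theorem shellNorm_sq_le (k : ℕ) : shellNorm ν F k ^ 2 ≤ ∫⁻ ξ, ‖F ξ‖ₑ ^ 2 ∂ν := by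
  rw [shellNorm_sq]
  exact setLIntegral_le_lintegral _ _

theorem inv_sqrt_two_pow_sq (n : ℕ) : ((√2)⁻¹ ^ n) ^ 2 = ((2 : ℝ) ^ n)⁻¹ := by
  rw [← pow_mul, mul_comm, pow_mul, inv_pow, Real.sq_sqrt (by norm_num), inv_pow]

/-- On lower shells the multiplier is at most `ξ²/(4κ²)`, of order `4^{-(j-k)}`; the weaker
`2^{-(j-k)}`, the square of the weight in `dyadicAverage`, is enough. For `k > j` the truncated
difference is `0` and the bound is `1`. -/
theorem highMultiplier_le {j k : ℕ} {ξ : ℝ} (h : ξ ∈ dyadicShell k) :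
    ξ ^ 2 / (4 * (2 ^ j) ^ 2 + ξ ^ 2) ≤ ((√2)⁻¹ ^ (j - k)) ^ 2 := by
  rw [inv_sqrt_two_pow_sq, ← one_div]
  rw [div_le_div_iff₀ (by positivity) (by positivity), one_mul]
  rcases le_or_gt k j with hkj | hkj
  · obtain ⟨m, rfl⟩ := Nat.exists_eq_add_of_le hkj
    have e : k + m - k = m := by omega
    rw [e]
    have h1 : ξ ^ 2 ≤ (2 ^ k) ^ 2 := by
      rw [← sq_abs]
      exact pow_le_pow_left₀ (abs_nonneg _) (abs_le_of_mem_dyadicShell h) 2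
    have h2 : (1 : ℝ) ≤ 2 ^ m := one_le_pow₀ (by norm_num)
    rw [pow_add]
    have h3 : ξ ^ 2 * 2 ^ m ≤ (2 ^ k) ^ 2 * 2 ^ m := mul_le_mul_of_nonneg_right h1 (by positivity)
    have h4 : ((2 : ℝ) ^ k) ^ 2 * 2 ^ m ≤ (2 ^ k) ^ 2 * (2 ^ m * 2 ^ m) :=
      mul_le_mul_of_nonneg_left (by nlinarith) (by positivity)
    nlinarith [sq_nonneg ξ, sq_nonneg ((2 : ℝ) ^ k * 2 ^ m)]
  · have e : j - k = 0 := by omega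
    rw [e]
    have : (0 : ℝ) ≤ (2 ^ j) ^ 2 := by positivity
    linarith

/-- On this shell `|ξ| > κ/2` with `κ = 2^{j+1}`, and `(1/4)/(4 + 1/4) = 1/17`. -/
theorem le_highMultiplier {j : ℕ} {ξ : ℝ} (h : ξ ∈ dyadicShell (j + 1)) :
    1 / 17 ≤ ξ ^ 2 / (4 * (2 ^ (j + 1)) ^ 2 + ξ ^ 2) := by
  have h1 : ((2 : ℝ) ^ j) ^ 2 ≤ ξ ^ 2 := by
    rw [← sq_abs ξ]
    exact pow_le_pow_left₀ (by positivity) h.1.le 2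
  have h2 : 0 < ((2 : ℝ) ^ j) ^ 2 := by positivity
  rw [div_le_div_iff₀ (by norm_num) (by positivity), pow_succ (2 : ℝ) j]
  nlinarith

/-- `κ/|2κ + iξ|` is at most `min(1, κ/|ξ|)`, and `√2^k` is the Cauchy-Schwarz cost of shell `k`.
For `k ≤ j` this is `2^{k/2} = 2^{j/2} 2^{-(j-k)/2}`; for `k > j` the decay `2^{j-k}` beats
`2^{k/2}`. -/
theorem resolventMultiplier_le {j k : ℕ} {ξ : ℝ} (h : ξ ∈ dyadicShell k) :
    2 ^ j * (√(4 * (2 ^ j) ^ 2 + ξ ^ 2))⁻¹ * (√2 ^ k) ≤ 2 * √2 ^ j * (√2)⁻¹ ^ (j - k) := by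
  have hs : 0 < √2 := by positivity
  have hs2 : √2 * √2 = 2 := Real.mul_self_sqrt (by norm_num)
  have hs1 : 1 ≤ √2 := Real.one_le_sqrt.2 (by norm_num)
  rcases le_or_gt k j with hkj | hkj
  · obtain ⟨m, rfl⟩ := Nat.exists_eq_add_of_le hkj
    have e : k + m - k = m := by omega
    rw [e, pow_add √2, inv_pow]
    have h1 : 2 ^ (k + m) * (√(4 * (2 ^ (k + m)) ^ 2 + ξ ^ 2))⁻¹ ≤ 1 := by
      rw [← div_eq_mul_inv]
      refine div_le_one_of_le₀ (Real.le_sqrt_of_sq_le ?_) (Real.sqrt_nonneg _)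
      nlinarith [sq_nonneg ξ, sq_nonneg ((2 : ℝ) ^ (k + m))]
    have h2 := mul_le_mul_of_nonneg_right h1 (by positivity : 0 ≤ √2 ^ k)
    have h3 : 2 * (√2 ^ k * √2 ^ m) * (√2 ^ m)⁻¹ = 2 * √2 ^ k := by field_simp
    rw [h3]
    have : 0 ≤ √2 ^ k := by positivity
    linarith
  · obtain ⟨m, rfl⟩ := Nat.exists_eq_add_of_lt hkj
    have e : j - (j + m + 1) = 0 := by omega
    rw [e, pow_zero, mul_one]
    have h0 : (2 : ℝ) ^ (j + m) < |ξ| := h.1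
    have h1 : (√(4 * (2 ^ j) ^ 2 + ξ ^ 2))⁻¹ ≤ ((2 : ℝ) ^ (j + m))⁻¹ := by
      refine inv_anti₀ (by positivity) (Real.le_sqrt_of_sq_le ?_)
      have : ((2 : ℝ) ^ (j + m)) ^ 2 ≤ ξ ^ 2 := by
        rw [← sq_abs ξ]
        exact pow_le_pow_left₀ (by positivity) h0.le 2
      have h5 : (0 : ℝ) ≤ (2 ^ j) ^ 2 := by positivity
      linarith
    have h2 : 2 ^ j * (√(4 * (2 ^ j) ^ 2 + ξ ^ 2))⁻¹ ≤ ((2 : ℝ) ^ m)⁻¹ := by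
      refine (mul_le_mul_of_nonneg_left h1 (by positivity)).trans (le_of_eq ?_)
      rw [pow_add]
      field_simp
    refine (mul_le_mul_of_nonneg_right h2 (by positivity)).trans ?_
    have h3 : (2 : ℝ) ^ m = √2 ^ m * √2 ^ m := by rw [← mul_pow, hs2]
    have h4 : 1 ≤ √2 ^ m := one_le_pow₀ hs1
    rw [h3, show j + m + 1 = j + (m + 1) by ring, pow_add, pow_succ]
    have h6 : (√2 ^ m * √2 ^ m)⁻¹ * (√2 ^ j * (√2 ^ m * √2)) = √2 ^ j * √2 / √2 ^ m := by
      field_simp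
    rw [h6, div_le_iff₀ (by positivity)]
    have h7 : √2 ≤ 2 := by nlinarith
    have h8 : 0 ≤ √2 ^ j := by positivity
    nlinarith [mul_le_mul h7 h4 zero_le_one (by norm_num)]

/-- Cauchy-Schwarz, with `3 · 2^k ≤ (2√2^k)²`. The factor `3` leaves room for the `2 · 2^k + 1`
integers of modulus at most `2^k`. -/
theorem lintegral_shell_le (hF : AEStronglyMeasurable F ν)
    (hν : ∀ k, ν (dyadicShell k) ≤ 3 * 2 ^ k) (k : ℕ) :
    ∫⁻ ξ in dyadicShell k, ‖F ξ‖ₑ ∂ν ≤ ENNReal.ofReal (2 * √2 ^ k) * shellNorm ν F k := by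
  have h := eLpNorm_le_eLpNorm_mul_rpow_measure_univ (p := 1) (q := 2)
    (μ := ν.restrict (dyadicShell k)) (by norm_num) hF.restrict
  rw [eLpNorm_one_eq_lintegral_enorm] at h
  refine h.trans ?_
  rw [mul_comm]
  unfold shellNorm
  gcongr
  rw [Measure.restrict_apply_univ]
  have h2 : ν (dyadicShell k) ≤ ENNReal.ofReal ((2 * √2 ^ k) ^ 2) := by
    refine (hν k).trans ?_
    rw [mul_pow, ← pow_mul, mul_comm k, pow_mul, Real.sq_sqrt (by norm_num),
      ENNReal.ofReal_mul (by norm_num), ENNReal.ofReal_pow (by norm_num)]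
    norm_num
    gcongr
    norm_num
  have h3 : (1 / (1 : ℝ≥0∞).toReal - 1 / (2 : ℝ≥0∞).toReal) = (2 : ℝ)⁻¹ := by norm_num
  rw [h3, ENNReal.rpow_inv_le_iff (by norm_num)]
  refine h2.trans (le_of_eq ?_)
  rw [ENNReal.ofReal_pow (by positivity)]
  exact (ENNReal.rpow_two _).symm

theorem lintegral_resolventMultiplier_le (hF : AEStronglyMeasurable F ν)
    (hν : ∀ k, ν (dyadicShell k) ≤ 3 * 2 ^ k) (j : ℕ) :
    ∫⁻ ξ, ENNReal.ofReal (2 ^ j * (√(4 * (2 ^ j) ^ 2 + ξ ^ 2))⁻¹) * ‖F ξ‖ₑ ∂ν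
      ≤ ENNReal.ofReal (4 * √2 ^ j) * dyadicAverage (shellNorm ν F) j := by
  unfold dyadicAverage
  rw [lintegral_eq_tsum_dyadicShell, ← ENNReal.tsum_mul_left]
  refine ENNReal.tsum_le_tsum fun k => ?_
  have hpt : ∀ ξ ∈ dyadicShell k,
      ENNReal.ofReal (2 ^ j * (√(4 * (2 ^ j) ^ 2 + ξ ^ 2))⁻¹) * ‖F ξ‖ₑ
      ≤ ENNReal.ofReal (2 * √2 ^ j * (√2)⁻¹ ^ (j - k) / √2 ^ k) * ‖F ξ‖ₑ := fun ξ hξ => by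
    gcongr
    rw [le_div_iff₀ (by positivity)]
    exact resolventMultiplier_le hξ
  refine (setLIntegral_mono' (measurableSet_dyadicShell k) hpt).trans ?_
  rw [lintegral_const_mul' _ _ ENNReal.ofReal_ne_top]
  refine (mul_le_mul_right (lintegral_shell_le hF hν k) _).trans (le_of_eq ?_)
  rw [← mul_assoc, ← mul_assoc, ← ENNReal.ofReal_mul (by positivity),
    ← ENNReal.ofReal_pow (by positivity), ← ENNReal.ofReal_mul (by positivity)]
  congr 2
  field_simp
  norm_num

theorem lintegral_highMultiplier_le (j : ℕ) :
    ∫⁻ ξ, ENNReal.ofReal (ξ ^ 2 / (4 * (2 ^ j) ^ 2 + ξ ^ 2)) * ‖F ξ‖ₑ ^ 2 ∂ν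
      ≤ dyadicAverage (shellNorm ν F) j ^ 2 := by
  unfold dyadicAverage
  rw [lintegral_eq_tsum_dyadicShell]
  refine le_trans (ENNReal.tsum_le_tsum fun k => ?_) (ENNReal.tsum_sq_le _)
  have hpt : ∀ ξ ∈ dyadicShell k,
      ENNReal.ofReal (ξ ^ 2 / (4 * (2 ^ j) ^ 2 + ξ ^ 2)) * ‖F ξ‖ₑ ^ 2
      ≤ ENNReal.ofReal (((√2)⁻¹ ^ (j - k)) ^ 2) * ‖F ξ‖ₑ ^ 2 := fun ξ hξ => by
    gcongr
    exact highMultiplier_le hξ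
  refine (setLIntegral_mono' (measurableSet_dyadicShell k) hpt).trans (le_of_eq ?_)
  rw [lintegral_const_mul' _ _ ENNReal.ofReal_ne_top, ← shellNorm_sq, mul_pow,
    ENNReal.ofReal_pow (by positivity), ENNReal.ofReal_pow (by positivity)]

theorem shellNorm_sq_le_highMultiplier (j : ℕ) :
    shellNorm ν F (j + 1) ^ 2
      ≤ 17 * ∫⁻ ξ, ENNReal.ofReal (ξ ^ 2 / (4 * (2 ^ (j + 1)) ^ 2 + ξ ^ 2)) * ‖F ξ‖ₑ ^ 2 ∂ν := by
  rw [shellNorm_sq, ← lintegral_const_mul' _ _ (by norm_num)]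
  refine le_trans (setLIntegral_mono' (measurableSet_dyadicShell (j + 1)) fun ξ hξ => ?_)
    (setLIntegral_le_lintegral (dyadicShell (j + 1)) _)
  rw [← mul_assoc]
  refine le_mul_of_one_le_left zero_le ?_
  have h17 : (17 : ℝ≥0∞) = ENNReal.ofReal 17 := by norm_num
  rw [h17, ← ENNReal.ofReal_mul (by norm_num), ← ENNReal.ofReal_one]
  refine ENNReal.ofReal_le_ofReal ?_
  have := le_highMultiplier hξ
  linarith

/-- Functions bounded by `C / |ξ|` have `shellNorm` decaying like `2^{-k/2}`. -/
theorem exists_shellNorm_le (hν : ∀ k, ν (dyadicShell k) ≤ 3 * 2 ^ k) {C : ℝ}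
    (hC : ∀ᵐ ξ ∂ν, ‖F ξ‖ ≤ C ∧ |ξ| * ‖F ξ‖ ≤ C) :
    ∃ K : ℝ≥0∞, K ≠ ⊤ ∧ ∀ k, shellNorm ν F k ≤ K * ENNReal.ofReal (√2)⁻¹ ^ k := by
  have key : ∀ k, shellNorm ν F k ^ 2
      ≤ (ENNReal.ofReal (4 * |C|) * ENNReal.ofReal (√2)⁻¹ ^ k) ^ 2 := by
    intro k
    rw [shellNorm_sq]
    have hpt : ∀ᵐ ξ ∂ν.restrict (dyadicShell k),
        ‖F ξ‖ₑ ^ 2 ≤ ENNReal.ofReal ((2 * |C| / 2 ^ k) ^ 2) := by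
      filter_upwards [ae_restrict_of_ae hC, ae_restrict_mem (measurableSet_dyadicShell k)]
        with ξ hξ hmem
      rw [ENNReal.ofReal_pow (by positivity), ← ofReal_norm]
      gcongr
      rw [le_div_iff₀ (by positivity)]
      cases k with
      | zero =>
        rw [pow_zero, mul_one]
        linarith [hξ.1, le_abs_self C, abs_nonneg C]
      | succ k =>
        have h1 := mul_le_mul_of_nonneg_right hmem.1.le (norm_nonneg (F ξ))
        rw [pow_succ]
        linarith [hξ.2, le_abs_self C]
    refine (lintegral_mono_ae hpt).trans ?_
    rw [lintegral_const, Measure.restrict_apply_univ]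
    refine (mul_le_mul_right (hν k) _).trans ?_
    have h3 : (3 : ℝ≥0∞) * 2 ^ k = ENNReal.ofReal (3 * 2 ^ k) := by
      rw [ENNReal.ofReal_mul (by norm_num), ENNReal.ofReal_pow (by norm_num)]
      norm_num
    rw [h3, ← ENNReal.ofReal_mul (by positivity), ← ENNReal.ofReal_pow (by positivity),
      ← ENNReal.ofReal_mul (by positivity), ← ENNReal.ofReal_pow (by positivity)]
    refine ENNReal.ofReal_le_ofReal ?_
    rw [mul_pow, inv_sqrt_two_pow_sq]
    have : (2 * |C| / 2 ^ k) ^ 2 * (3 * 2 ^ k) = 12 * |C| ^ 2 * (2 ^ k)⁻¹ := by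
      field_simp
      ring
    rw [this]
    refine mul_le_mul_of_nonneg_right ?_ (by positivity)
    nlinarith [sq_nonneg |C|]
  refine ⟨ENNReal.ofReal (4 * |C|), ENNReal.ofReal_ne_top, fun k => ?_⟩
  have := key k
  rwa [ENNReal.pow_le_pow_left_iff two_ne_zero] at this

end Shells

/-! ### The a priori bound on each shell and its summation. -/

section APriori

variable {μ ν : Measure ℝ} {p : ℝ} {W : ℝ → ℝ}

theorem HasFourierInversion.ofReal_highEnergy {f : ℝ → ℂ} (hf : HasFourierInversion μ ν f)
    {κ : ℝ} (hκ : 1 ≤ κ) : ENNReal.ofReal (highEnergy μ ν κ f)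
      = ∫⁻ ξ, ENNReal.ofReal (ξ ^ 2 / (4 * κ ^ 2 + ξ ^ 2)) * ‖angularHat μ f ξ‖ₑ ^ 2 ∂ν := by
  unfold highEnergy
  rw [ofReal_integral_eq_lintegral_ofReal]
  · congr 1
    ext ξ
    rw [ENNReal.ofReal_mul (by positivity), ENNReal.ofReal_pow (norm_nonneg _), ofReal_norm]
  · refine hf.integrable_sq.bdd_mul (c := 1) ?_ (Filter.Eventually.of_forall fun ξ => ?_)
    · refine (Continuous.div (by fun_prop) (by fun_prop) fun ξ => ?_).aestronglyMeasurable
      positivity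
    · rw [Real.norm_of_nonneg (by positivity), div_le_one (by positivity)]
      nlinarith [sq_nonneg κ]
  · exact Filter.Eventually.of_forall fun ξ => by positivity

theorem HasFourierInversion.ofReal_integral_sq {f : ℝ → ℂ} (hf : HasFourierInversion μ ν f) :
    ENNReal.ofReal (∫ ξ, ‖angularHat μ f ξ‖ ^ 2 ∂ν) = ∫⁻ ξ, ‖angularHat μ f ξ‖ₑ ^ 2 ∂ν := by
  rw [ofReal_integral_eq_lintegral_ofReal hf.integrable_sq
    (Filter.Eventually.of_forall fun ξ => by positivity)]
  congr 1
  ext ξ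
  rw [ENNReal.ofReal_pow (norm_nonneg _), ofReal_norm]

theorem HasFourierInversion.ofReal_decayConv_le {f : ℝ → ℂ} (hf : HasFourierInversion μ ν f)
    (hfb : IsBddCont f) (hν : ∀ k, ν (dyadicShell k) ≤ 3 * 2 ^ k) (j : ℕ) (x : ℝ) :
    ENNReal.ofReal (2 ^ j * ‖decayConv (2 ^ j) f x‖)
      ≤ ENNReal.ofReal (4 * √2 ^ j) * dyadicAverage (shellNorm ν (angularHat μ f)) j := by
  have hκ : (0 : ℝ) < 2 ^ j := by positivity
  refine le_trans ?_
    (lintegral_resolventMultiplier_le hf.integrable.aestronglyMeasurable hν j)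
  have h1 : ‖decayConv (2 ^ j) f x‖ₑ
      ≤ ∫⁻ ξ, ENNReal.ofReal (√(4 * (2 ^ j) ^ 2 + ξ ^ 2))⁻¹ * ‖angularHat μ f ξ‖ₑ ∂ν := by
    rw [hf.decayConv_eq hfb hκ, enorm_mul]
    have h2 : ‖(((Real.sqrt (2 * Real.pi))⁻¹ : ℝ) : ℂ)‖ₑ ≤ 1 := by
      rw [← ofReal_norm, Complex.norm_real, Real.norm_of_nonneg inv_sqrt_two_pi_nonneg,
        ENNReal.ofReal_le_one]
      exact inv_sqrt_two_pi_le_one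
    refine (mul_le_of_le_one_left zero_le h2).trans
      ((enorm_integral_le_lintegral_enorm _).trans (le_of_eq ?_))
    congr 1
    ext ξ
    rw [enorm_mul, enorm_mul, ← ofReal_norm (Complex.exp _), norm_exp_I_mul_mul,
      ENNReal.ofReal_one, mul_one, mul_comm, ← ofReal_norm (_⁻¹), norm_inv_two_mul_add_I_mul]
  rw [ENNReal.ofReal_mul hκ.le, ofReal_norm]
  refine (mul_le_mul_right h1 _).trans (le_of_eq ?_)
  rw [← lintegral_const_mul' _ _ ENNReal.ofReal_ne_top]
  congr 1
  ext ξ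
  rw [ENNReal.ofReal_mul hκ.le, mul_assoc]

/-- The a priori bound, before summation over frequencies. -/
theorem IsEvolution.shellNorm_le [SFinite μ] [SFinite ν] (hμ : SpaceMeasure μ p W)
    (hν : ∀ k, ν (dyadicShell k) ≤ 3 * 2 ^ k) {q q₁ q₂ qt : ℝ → ℝ → ℂ}
    (hq : IsEvolution p W q q₁ q₂ qt) (hinv : ∀ t, HasFourierInversion μ ν (q t)) {c : ℝ}
    (hc : 0 < c) (hc8 : c ≤ 1 / 8) (hmass : ∫ x, ‖q 0 x‖ ^ 2 ∂μ ≤ c ^ 2) (t : ℝ) (j : ℕ) :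
    shellNorm ν (angularHat μ (q t)) j
      ≤ 6 * dyadicAverage (shellNorm ν (angularHat μ (q 0))) j
        + ENNReal.ofReal (33 * c) * dyadicAverage (shellNorm ν (angularHat μ (q t))) j := by
  have hmt := hq.mass_conserved hμ
  have hm : ∀ t, ∫ x, ‖q t x‖ ^ 2 ∂μ ≤ c ^ 2 := fun t => (hmt t).le.trans hmass
  have hbc := fun t => (hq.tame t).isBddCont hμ
  cases j with
  | zero =>
    -- The lowest shell needs only mass conservation: at `j = 0` all weights in `dyadicAverage` are
    -- `1`, so it dominates the whole `L²` norm.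
    refine le_add_right ?_
    have h1 : shellNorm ν (angularHat μ (q t)) 0 ^ 2
        ≤ dyadicAverage (shellNorm ν (angularHat μ (q 0))) 0 ^ 2 := by
      refine (shellNorm_sq_le 0).trans (le_trans (le_of_eq ?_) lintegral_sq_le_dyadicAverage_zero)
      rw [← (hinv t).ofReal_integral_sq, ← (hinv 0).ofReal_integral_sq,
        ← (hinv t).plancherel ((hq.tame t).integrable hμ),
        ← (hinv 0).plancherel ((hq.tame 0).integrable hμ), hmt]
    rw [ENNReal.pow_le_pow_left_iff two_ne_zero] at h1
    exact h1.trans (le_mul_of_one_le_left zero_le (by norm_num))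
  | succ i =>
    set j := i + 1
    set κ : ℝ := 2 ^ j with hκdef
    have hκ : 1 ≤ κ := one_le_pow₀ (by norm_num)
    have hκ0 : 0 < κ := by linarith
    have hsmall : ∀ t x, decayConv κ (fun y => ‖q t y‖) x ≤ c / √κ := fun t =>
      decayConv_norm_le_of_local_sq hκ hc (hbc t) fun x =>
        (hμ.local_sq_le _ (hq.tame t) x).trans (hm t)
    choose u hu using fun t => exists_isRiccati hκ hc hc8 (hbc t) (hsmall t)
    have hmom := hq.momentum_conserved hμ hκ hc hc8 hsmall hu t
    set N : ℝ → ℂ := fun t => ∫ x, q t x * decayConv κ (fun y => q t y * u t y ^ 2) x ∂μ with hN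
    have hE := fun t => highEnergy_eq hμ (hq.tame t) (hinv t) hκ (hu t)
    have hEle : highEnergy μ ν κ (q t) ≤ highEnergy μ ν κ (q 0) + 2 * ‖N 0‖ + 2 * ‖N t‖ := by
      rw [hE t, hE 0, hmom, hmt]
      have h1 := (Complex.abs_im_le_norm (N t))
      have h2 := (Complex.abs_im_le_norm (N 0))
      have h3 := le_abs_self (N t).im
      have h4 := neg_abs_le (N 0).im
      change _ + _ + 2 * (N t).im ≤ _ + _ + 2 * (N 0).im + _ + _
      linarith
    set X : ℝ → ℝ≥0∞ := fun t => dyadicAverage (shellNorm ν (angularHat μ (q t))) j with hX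
    have hNle : ∀ t, ENNReal.ofReal (2 * ‖N t‖) ≤ ENNReal.ofReal (64 * c ^ 2) * X t ^ 2 := by
      intro t
      rcases eq_or_ne (X t) ⊤ with htop | hfin
      · rw [htop]
        have : ENNReal.ofReal (64 * c ^ 2) ≠ 0 := by
          rw [Ne, ENNReal.ofReal_eq_zero, not_le]
          positivity
        rw [ENNReal.top_pow two_ne_zero, ENNReal.mul_top this]
        exact le_top
      -- With this `B` one has `B² = 16 κ X²`, so the factor `1/κ` in the quartic bound cancels and
      -- `32 c² X²` remains.
      · have hB : ∀ x, κ * ‖decayConv κ (q t) x‖ ≤ 4 * √2 ^ j * (X t).toReal := fun x => by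
          have h1 := (hinv t).ofReal_decayConv_le (hbc t) hν j x
          rw [← ENNReal.ofReal_le_ofReal_iff (by positivity),
            ENNReal.ofReal_mul (p := 4 * √2 ^ j) (by positivity), ENNReal.ofReal_toReal hfin]
          exact h1
        have h2 := (hu t).norm_integral_quartic_le hμ (hq.tame t) hκ hc hc8 (hsmall t) hB (hm t)
        have h3 : 2 * (4 * √2 ^ j * (X t).toReal) ^ 2 * c ^ 2 / κ
            = 32 * c ^ 2 * (X t).toReal ^ 2 := by
          have : (√2 ^ j) ^ 2 = κ := by
            rw [← pow_mul, mul_comm, pow_mul, Real.sq_sqrt (by norm_num)]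
          rw [mul_pow, mul_pow, this]
          field_simp
          ring
        rw [h3] at h2
        rw [show X t = ENNReal.ofReal (X t).toReal from (ENNReal.ofReal_toReal hfin).symm,
          ← ENNReal.ofReal_pow (by positivity), ← ENNReal.ofReal_mul (by positivity)]
        refine ENNReal.ofReal_le_ofReal ?_
        change ‖N t‖ ≤ _ at h2
        linarith
    have hsq : shellNorm ν (angularHat μ (q t)) j ^ 2
        ≤ 17 * (X 0 ^ 2 + ENNReal.ofReal (64 * c ^ 2) * X 0 ^ 2
          + ENNReal.ofReal (64 * c ^ 2) * X t ^ 2) := by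
      refine (shellNorm_sq_le_highMultiplier i).trans ?_
      rw [← (hinv t).ofReal_highEnergy hκ]
      gcongr
      refine (ENNReal.ofReal_le_ofReal hEle).trans ?_
      have h0 : 0 ≤ highEnergy μ ν κ (q 0) := integral_nonneg fun ξ => by positivity
      rw [ENNReal.ofReal_add (by positivity) (by positivity),
        ENNReal.ofReal_add h0 (by positivity)]
      refine add_le_add (add_le_add ?_ (hNle 0)) (hNle t)
      rw [(hinv 0).ofReal_highEnergy hκ]
      exact lintegral_highMultiplier_le j
    -- The constants come from `64c² ≤ 1`, `17 + 17 ≤ 6²` and `17 · 64 = 1088 ≤ 33²`.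
    have hfinal : 17 * (X 0 ^ 2 + ENNReal.ofReal (64 * c ^ 2) * X 0 ^ 2
          + ENNReal.ofReal (64 * c ^ 2) * X t ^ 2)
        ≤ (6 * X 0 + ENNReal.ofReal (33 * c) * X t) ^ 2 := by
      have h1 : ENNReal.ofReal (64 * c ^ 2) ≤ 1 := by
        rw [ENNReal.ofReal_le_one]
        nlinarith
      have h2 : 17 * ENNReal.ofReal (64 * c ^ 2) ≤ ENNReal.ofReal (33 * c) ^ 2 := by
        have : (17 : ℝ≥0∞) = ENNReal.ofReal 17 := by norm_num
        rw [this, ← ENNReal.ofReal_mul (by norm_num), ← ENNReal.ofReal_pow (by positivity)]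
        refine ENNReal.ofReal_le_ofReal ?_
        nlinarith [sq_nonneg c]
      calc 17 * (X 0 ^ 2 + ENNReal.ofReal (64 * c ^ 2) * X 0 ^ 2
          + ENNReal.ofReal (64 * c ^ 2) * X t ^ 2)
          = 17 * X 0 ^ 2 + 17 * ENNReal.ofReal (64 * c ^ 2) * X 0 ^ 2
            + (17 * ENNReal.ofReal (64 * c ^ 2)) * X t ^ 2 := by ring
        _ ≤ 17 * X 0 ^ 2 + 17 * 1 * X 0 ^ 2 + ENNReal.ofReal (33 * c) ^ 2 * X t ^ 2 := by
            gcongr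
        _ = 34 * X 0 ^ 2 + (ENNReal.ofReal (33 * c) * X t) ^ 2 := by ring
        _ ≤ 36 * X 0 ^ 2 + (ENNReal.ofReal (33 * c) * X t) ^ 2
            + 12 * X 0 * (ENNReal.ofReal (33 * c) * X t) := by
            refine le_add_right ?_
            gcongr
            norm_num
        _ = _ := by ring
    have := hsq.trans hfinal
    rwa [ENNReal.pow_le_pow_left_iff two_ne_zero] at this

theorem IsEvolution.dyadicNorm_le [SFinite μ] [SFinite ν] (hμ : SpaceMeasure μ p W)
    (hν : ∀ k, ν (dyadicShell k) ≤ 3 * 2 ^ k) {q q₁ q₂ qt : ℝ → ℝ → ℂ}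
    (hq : IsEvolution p W q q₁ q₂ qt) (hinv : ∀ t, HasFourierInversion μ ν (q t))
    (hdec : ∀ t, ∃ C : ℝ, ∀ᵐ ξ ∂ν, |ξ| * ‖angularHat μ (q t) ξ‖ ≤ C)
    {s : ℝ} (hs1 : s < 1 / 2) {r : ℝ≥0∞} (hr : 1 ≤ r) {S : ℝ≥0}
    (hS : ∀ a : ℕ → ℝ≥0∞, dyadicNorm s r (dyadicAverage a) ≤ S * dyadicNorm s r a) {c : ℝ}
    (hc : 0 < c) (hc8 : c ≤ 1 / 8) (hcS : 66 * c * S ≤ 1)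
    (hmass : ∫ x, ‖q 0 x‖ ^ 2 ∂μ ≤ c ^ 2) (t : ℝ) :
    dyadicNorm s r (shellNorm ν (angularHat μ (q t)))
      ≤ (12 * S : ℝ≥0) * dyadicNorm s r (shellNorm ν (angularHat μ (q 0))) := by
  obtain ⟨C, hC⟩ := hdec t
  obtain ⟨K, hK, hdecay⟩ := exists_shellNorm_le (F := angularHat μ (q t)) hν
    (C := max C (∫ x, ‖q t x‖ ∂μ)) (hC.mono fun ξ hξ =>
      ⟨(norm_angularHat_le ξ).trans (le_max_right _ _), hξ.trans (le_max_left _ _)⟩)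
  -- The condition `66cS ≤ 1` is the required `33c · S ≤ 1/2`, and `2 · 6 · S` is the final
  -- constant.
  have h := dyadicNorm_le_of_le_dyadicAverage (A := 6) (ε := Real.toNNReal (33 * c)) hr hS
    (fun j => hq.shellNorm_le hμ hν hinv hc hc8 hmass t j) ?_ (dyadicNorm_ne_top hs1 hr hK hdecay)
  · refine h.trans (le_of_eq ?_)
    norm_num
  · rw [← NNReal.coe_le_coe]
    push_cast
    rw [Real.coe_toNNReal _ (by positivity)]
    linarith

end APriori

/-! ### From the stated equation and norms to the abstract setting. -/

section Common

variable {μ : Measure ℝ} {p : ℝ} {W : ℝ → ℝ}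

theorem SolvesDNLS.time_deriv_eq {q : ℝ → ℝ → ℂ} (h : SolvesDNLS q) {t x : ℝ} {qt q₂ : ℂ}
    {q₁ : ℝ → ℂ} (ht : HasDerivAt (fun τ => q τ x) qt t) (h1 : ∀ x, HasDerivAt (q t) (q₁ x) x)
    (h2 : HasDerivAt q₁ q₂ x) :
    qt = Complex.I * q₂ - (2 * q t x * q₁ x * (starRingEnd ℂ) (q t x)
      + q t x ^ 2 * (starRingEnd ℂ) (q₁ x)) := by
  have hd : deriv (q t) = q₁ := funext fun x => (h1 x).deriv
  have e2 : iteratedDeriv 2 (q t) x = q₂ := by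
    rw [iteratedDeriv_succ, iteratedDeriv_one, hd, h2.deriv]
  have e3 : deriv (fun y => ((‖q t y‖ : ℂ) ^ 2) * q t y) x
      = 2 * q t x * q₁ x * (starRingEnd ℂ) (q t x) + q t x ^ 2 * (starRingEnd ℂ) (q₁ x) := by
    have : (fun y => ((‖q t y‖ : ℂ) ^ 2) * q t y)
        = fun y => (q t y * q t y) * (starRingEnd ℂ) (q t y) := by
      ext y
      rw [← Complex.conj_mul']
      ring
    rw [this]
    refine ((((h1 x).mul (h1 x)).mul (h1 x).complex_conj).congr_deriv ?_).deriv
    simp only [Pi.mul_apply]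
    ring
  have h0 := h t x
  rw [ht.deriv, e2, e3] at h0
  have hI : Complex.I * Complex.I = -1 := Complex.I_mul_I
  linear_combination (-Complex.I) * h0 + (qt + (2 * q t x * q₁ x * (starRingEnd ℂ) (q t x)
    + q t x ^ 2 * (starRingEnd ℂ) (q₁ x))) * hI

theorem Tame.integral_sq_le_of_eLpNorm_le (hμ : SpaceMeasure μ p W) {f : ℝ → ℂ}
    (hf : Tame p W f) {c : ℝ} (hc : 0 ≤ c) (h : eLpNorm f 2 μ ≤ ENNReal.ofReal c) :
    ∫ x, ‖f x‖ ^ 2 ∂μ ≤ c ^ 2 := by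
  have h1 : ENNReal.ofReal (∫ x, ‖f x‖ ^ 2 ∂μ) = eLpNorm f 2 μ ^ 2 := by
    have h2 := eLpNorm_nnreal_pow_eq_lintegral (f := f) (μ := μ) (p := 2) (by norm_num)
    have h3 : Integrable (fun x => ‖f x‖ ^ 2) μ := by
      have := ((hf.ofReal_norm.mul_tame hμ hf.ofReal_norm).integrable hμ).re
      simpa [pow_two] using! this
    rw [ofReal_integral_eq_lintegral_ofReal h3
      (Filter.Eventually.of_forall fun x => by positivity)]
    have h4 : ∀ x, ENNReal.ofReal (‖f x‖ ^ 2) = ‖f x‖ₑ ^ 2 := fun x => by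
      rw [ENNReal.ofReal_pow (norm_nonneg _), _root_.ofReal_norm]
    simp_rw [h4]
    simpa using h2.symm
  have h5 : ENNReal.ofReal (∫ x, ‖f x‖ ^ 2 ∂μ) ≤ ENNReal.ofReal (c ^ 2) := by
    rw [h1, ENNReal.ofReal_pow hc]
    gcongr
  exact (ENNReal.ofReal_le_ofReal_iff (by positivity)).1 h5

/-- The mean value inequality, applied first to `f'` and then to `f - τ f'(t)`. -/
theorem norm_taylor_remainder_le {f f' f'' : ℝ → ℂ} {t h B : ℝ}
    (h1 : ∀ τ, HasDerivAt f (f' τ) τ) (h2 : ∀ τ, HasDerivAt f' (f'' τ) τ)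
    (hB : ∀ τ, |τ - t| ≤ |h| → ‖f'' τ‖ ≤ B) :
    ‖f (t + h) - f t - h * f' t‖ ≤ B * h ^ 2 := by
  have hs : ∀ τ ∈ Set.uIcc t (t + h), |τ - t| ≤ |h| := fun τ hτ => by
    have := Set.abs_sub_left_of_mem_uIcc hτ
    simpa using this
  have hB0 : 0 ≤ B := (norm_nonneg _).trans (hB t (by simp))
  have hd : ∀ τ ∈ Set.uIcc t (t + h), ‖f' τ - f' t‖ ≤ B * |h| := fun τ hτ => by
    have := Convex.norm_image_sub_le_of_norm_hasDerivWithin_le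
      (fun σ _ => (h2 σ).hasDerivWithinAt) (fun σ hσ => hB σ (hs σ hσ))
      (convex_uIcc t (t + h)) Set.left_mem_uIcc hτ
    exact this.trans (mul_le_mul_of_nonneg_left (hs τ hτ) hB0)
  have := Convex.norm_image_sub_le_of_norm_hasDerivWithin_le
    (f := fun τ : ℝ => f τ - τ * f' t) (f' := fun τ => f' τ - f' t)
    (fun σ _ => by
      have e : HasDerivAt (fun τ : ℝ => (τ : ℂ) * f' t) (f' t) σ := by
        simpa using (Complex.ofRealCLM.hasDerivAt (x := σ)).mul_const (f' t)
      exact ((h1 σ).sub e).hasDerivWithinAt) hd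
      (convex_uIcc t (t + h)) Set.left_mem_uIcc Set.right_mem_uIcc
  have e : f (t + h) - ((t + h : ℝ) : ℂ) * f' t - (f t - t * f' t)
      = f (t + h) - f t - h * f' t := by push_cast; ring
  rw [e] at this
  refine this.trans (le_of_eq ?_)
  rw [add_sub_cancel_left, Real.norm_eq_abs, ← sq_abs]
  ring

end Common

/-! ### The line. -/

section Line

/-- The weight on the line. -/
noncomputable def lineWeight (x : ℝ) : ℝ := (1 + x ^ 2)⁻¹

theorem spaceMeasure_line : SpaceMeasure volume 0 lineWeight := by
  have hint : Integrable lineWeight volume := integrable_inv_one_add_sq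
  have hw : ∀ x, 0 ≤ lineWeight x := fun x => by unfold lineWeight; positivity
  have hw1 : ∀ x, lineWeight x ≤ 1 := fun x => inv_le_one_of_one_le₀ (by nlinarith)
  have hti : ∀ f, Tame 0 lineWeight f → Integrable f volume := fun f hf => by
    obtain ⟨M, hM⟩ := hf.bound
    exact (hint.const_mul M).mono' hf.cont.aestronglyMeasurable (Filter.Eventually.of_forall hM)
  refine ⟨hw, hw1, hint, fun x y => ?_, fun f hf x => ?_, fun f f' hf hf' hd => ?_⟩
  · unfold lineWeight
    rw [← div_eq_mul_inv, inv_eq_one_div, div_le_div_iff₀ (by positivity) (by positivity)]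
    -- After clearing denominators: `1 + x² ≤ 2(1 + y²)(1 + (x - y)²)`, from `x = y + (x - y)`.
    nlinarith [sq_nonneg (x - 2 * y), sq_nonneg (y * (x - y))]
  · have h2 : Integrable (fun y => ‖f y‖ ^ 2) volume := by
      obtain ⟨M, hM⟩ := hf.bound
      have h := hf.cont
      refine ((hti f hf).norm.mul_bdd (c := |M|) h.norm.aestronglyMeasurable
        (Filter.Eventually.of_forall fun y => ?_)).congr
        (Filter.Eventually.of_forall fun y => (pow_two _).symm)
      rw [norm_norm]
      refine (hM y).trans ((mul_le_mul_of_nonneg_right (le_abs_self M) (hw y)).trans ?_)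
      exact mul_le_of_le_one_right (abs_nonneg _) (hw1 y)
    rw [intervalIntegral.integral_of_le (by linarith)]
    exact setIntegral_le_integral h2 (Filter.Eventually.of_forall fun y => by positivity)
  · exact integral_eq_zero_of_hasDerivAt_of_integrable hd (hti _ hf') (hti _ hf)

theorem volume_dyadicShell_le (k : ℕ) : volume (dyadicShell k) ≤ 3 * 2 ^ k := by
  have hsub : dyadicShell k ⊆ Set.Icc (-2 ^ k) (2 ^ k) := fun ξ hξ =>
    abs_le.1 (abs_le_of_mem_dyadicShell hξ)
  refine (measure_mono hsub).trans ?_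
  rw [Real.volume_Icc, show (2 : ℝ) ^ k - -2 ^ k = 2 * 2 ^ k by ring,
    ENNReal.ofReal_mul (by norm_num), ENNReal.ofReal_pow (by norm_num)]
  norm_num
  gcongr
  norm_num

theorem angularHat_volume_eq_lineHat (f : ℝ → ℂ) : angularHat volume f = lineHat f := by
  ext ξ
  unfold angularHat lineHat
  rw [Real.fourier_real_eq_integral_exp_smul]
  congr 2
  ext x
  rw [smul_eq_mul, mul_comm]
  congr 2
  push_cast
  have : (Real.pi : ℂ) ≠ 0 := by exact_mod_cast Real.pi_ne_zero
  field_simp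

theorem SchwartzMap.hasFourierInversion (f : 𝓢(ℝ, ℂ)) :
    HasFourierInversion volume volume f := by
  have hpi : (0 : ℝ) < 2 * Real.pi := by positivity
  have hF : Integrable (𝓕 (f : ℝ → ℂ)) volume := by
    rw [← SchwartzMap.fourier_coe]
    exact (𝓕 f).integrable
  refine ⟨?_, fun x => ?_⟩
  · rw [angularHat_volume_eq_lineHat]
    exact (hF.comp_div hpi.ne').const_mul _
  · rw [angularHat_volume_eq_lineHat]
    have hinv := f.integrable.fourierInv_fourier_eq hF (v := x) f.continuous.continuousAt
    rw [Real.fourierInv_eq'] at hinv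
    -- The rescaling `ξ = 2πη` contributes a factor `2π`, which the two normalising factors
    -- `(2π)^{-1/2}` cancel.
    have hsub := Measure.integral_comp_div (fun v : ℝ =>
      Complex.exp (↑(2 * Real.pi * inner ℝ v x) * Complex.I) • 𝓕 (f : ℝ → ℂ) v) (2 * Real.pi)
    rw [hinv] at hsub
    have e : ∀ ξ : ℝ, lineHat f ξ * Complex.exp (Complex.I * ξ * x)
        = ((Real.sqrt (2 * Real.pi))⁻¹ : ℝ) *
          (Complex.exp (↑(2 * Real.pi * inner ℝ (ξ / (2 * Real.pi)) x) * Complex.I)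
            • 𝓕 (f : ℝ → ℂ) (ξ / (2 * Real.pi))) := fun ξ => by
      have : (2 * Real.pi * inner ℝ (ξ / (2 * Real.pi)) x : ℝ) = ξ * x := by
        simp only [RCLike.inner_apply, conj_trivial]
        field_simp
      rw [this]
      unfold lineHat
      rw [smul_eq_mul, show Complex.I * (ξ : ℂ) * x = ((ξ * x : ℝ) : ℂ) * Complex.I by
        push_cast; ring]
      ring
    simp_rw [e]
    rw [integral_const_mul, hsub, abs_of_pos hpi, Complex.real_smul, ← mul_assoc, ← mul_assoc,
      ← Complex.ofReal_mul, ← Complex.ofReal_mul, ← mul_inv, Real.mul_self_sqrt hpi.le,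
      inv_mul_cancel₀ hpi.ne', Complex.ofReal_one, one_mul]

theorem SchwartzMap.exists_abs_mul_angularHat_le (f : 𝓢(ℝ, ℂ)) :
    ∃ C : ℝ, ∀ ξ, |ξ| * ‖angularHat volume f ξ‖ ≤ C := by
  obtain ⟨C, -, hC⟩ := (𝓕 f).decay 1 0
  refine ⟨2 * Real.pi * C, fun ξ => ?_⟩
  have hpi : (0 : ℝ) < 2 * Real.pi := by positivity
  have h := hC (ξ / (2 * Real.pi))
  rw [pow_one, norm_iteratedFDeriv_zero, Real.norm_eq_abs, abs_div, abs_of_pos hpi,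
    SchwartzMap.fourier_coe, div_mul_eq_mul_div, div_le_iff₀ hpi] at h
  rw [angularHat_volume_eq_lineHat]
  unfold lineHat
  rw [norm_mul, Complex.norm_real, Real.norm_of_nonneg inv_sqrt_two_pi_nonneg]
  refine le_trans ?_ (h.trans (le_of_eq (mul_comm _ _)))
  exact mul_le_mul_of_nonneg_left (mul_le_of_le_one_left (norm_nonneg _) inv_sqrt_two_pi_le_one)
    (abs_nonneg _)

theorem SchwartzMap.norm_le_lineWeight (f : 𝓢(ℝ, ℂ)) (x : ℝ) :
    ‖f x‖ ≤ (SchwartzMap.seminorm ℝ 0 0 f + SchwartzMap.seminorm ℝ 2 0 f) * lineWeight x := by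
  have h0 := SchwartzMap.le_seminorm ℝ 0 0 f x
  have h2 := SchwartzMap.le_seminorm ℝ 2 0 f x
  rw [norm_iteratedFDeriv_zero] at h0 h2
  rw [Real.norm_eq_abs, sq_abs] at h2
  unfold lineWeight
  rw [← div_eq_mul_inv, le_div_iff₀ (by positivity)]
  linarith

theorem SchwartzMap.tame (f : 𝓢(ℝ, ℂ)) : Tame 0 lineWeight f :=
  ⟨f.continuous, fun x => by rw [add_zero], _, f.norm_le_lineWeight⟩

/-- The Schwartz space is not normed, so the derivative of the curve is one in a topological vector
space. Continuous linear maps into a normed space, such as evaluation at a point, carry it to an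
ordinary derivative. -/
theorem hasDerivAt_clm_comp {F E : Type*} [AddCommGroup F] [Module ℝ F] [TopologicalSpace F]
    [ContinuousSMul ℝ F] [NormedAddCommGroup E] [NormedSpace ℝ E] {Q : ℝ → F} {v : F} {t : ℝ}
    (h : HasDerivAt Q v t) (L : F →L[ℝ] E) : HasDerivAt (fun τ => L (Q τ)) (L v) t := by
  refine ⟨?_⟩
  refine ((L.isBigOTVS_comp).trans_isLittleOTVS h.isLittleOTVS).congr_left fun x => ?_
  simp

theorem SchwartzMap.hasDerivAt_apply {Q : ℝ → 𝓢(ℝ, ℂ)} {v : 𝓢(ℝ, ℂ)} {t : ℝ}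
    (h : HasDerivAt Q v t) (x : ℝ) : HasDerivAt (fun τ => Q τ x) (v x) t :=
  hasDerivAt_clm_comp h ((BoundedContinuousFunction.evalCLM ℝ x).comp
    (SchwartzMap.toBoundedContinuousFunctionCLM ℝ ℝ ℂ))

theorem IsSmoothSchwartzCurve.exists_isEvolution {q : ℝ → 𝓢(ℝ, ℂ)} (h : IsSmoothSchwartzCurve q)
    (hs : SolvesDNLS (fun t x => q t x)) :
    ∃ q₁ q₂ qt, IsEvolution 0 lineWeight (fun t x => q t x) q₁ q₂ qt := by
  obtain ⟨Q, rfl, hQ⟩ := h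
  have d1 : ∀ (f : 𝓢(ℝ, ℂ)) x, HasDerivAt f (SchwartzMap.derivCLM ℝ ℂ f x) x := fun f x =>
    f.hasDerivAt x
  have hx : ∀ n t x, HasDerivAt (fun τ => Q n τ x) (Q (n + 1) t x) t := fun n t x =>
    SchwartzMap.hasDerivAt_apply (hQ n t) x
  refine ⟨fun t => SchwartzMap.derivCLM ℝ ℂ (Q 0 t),
    fun t => SchwartzMap.derivCLM ℝ ℂ (SchwartzMap.derivCLM ℝ ℂ (Q 0 t)), fun t => Q 1 t,
    fun t => (Q 0 t).tame, fun t => SchwartzMap.tame _, fun t => SchwartzMap.tame _,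
    fun t x => d1 _ x, fun t x => d1 _ x,
    fun t x => hs.time_deriv_eq (hx 0 t x) (d1 _) (d1 _ x), fun t => ?_⟩
  -- Continuity of the second time derivative in the Schwartz topology bounds its seminorms on `[t -
  -- 1, t + 1]`, which gives a Taylor remainder carrying the weight `lineWeight`.
  have hcont : Continuous (Q 2) := continuous_iff_continuousAt.2 fun τ =>
    HasFDerivAt.continuousAt (hQ 2 τ)
  have hsc : Continuous fun τ => SchwartzMap.seminorm ℝ 0 0 (Q 2 τ)
      + SchwartzMap.seminorm ℝ 2 0 (Q 2 τ) :=
    (((schwartz_withSeminorms ℝ ℝ ℂ).continuous_seminorm (0, 0)).comp hcont).add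
      (((schwartz_withSeminorms ℝ ℝ ℂ).continuous_seminorm (2, 0)).comp hcont)
  obtain ⟨M, hM⟩ := (isCompact_Icc (a := t - 1) (b := t + 1)).exists_bound_of_continuousOn
    hsc.continuousOn
  refine ⟨M, fun h hh x => ?_⟩
  refine (norm_taylor_remainder_le (f := fun τ => Q 0 τ x) (B := M * lineWeight x)
    (fun τ => hx 0 τ x) (fun τ => hx 1 τ x) fun τ hτ => ?_).trans (le_of_eq (by ring))
  refine ((Q 2 τ).norm_le_lineWeight x).trans (mul_le_mul_of_nonneg_right ?_
    (spaceMeasure_line.weight_nonneg x))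
  have h3 := abs_le.1 (hτ.trans hh)
  exact (le_abs_self _).trans (hM τ ⟨by linarith [h3.1], by linarith [h3.2]⟩)

end Line

/-! ### The circle. -/

section Circle

/-- Integration over the circle. -/
noncomputable def circleMeasure : Measure ℝ := volume.restrict (Set.Ioc 0 (2 * Real.pi))

/-- Counting measure on the integer frequencies. -/
noncomputable def intMeasure : Measure ℝ := Measure.map (Int.cast : ℤ → ℝ) Measure.count

instance : SFinite circleMeasure := by unfold circleMeasure; infer_instance

instance : SFinite intMeasure := by unfold intMeasure; infer_instance

theorem measurableEmbedding_intCast : MeasurableEmbedding (Int.cast : ℤ → ℝ) :=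
  Int.isClosedEmbedding_coe_real.measurableEmbedding

theorem integral_circleMeasure {E : Type*} [NormedAddCommGroup E] [NormedSpace ℝ E] (f : ℝ → E) :
    ∫ x, f x ∂circleMeasure = ∫ x in (0 : ℝ)..(2 * Real.pi), f x := by
  rw [intervalIntegral.integral_of_le Real.two_pi_pos.le, circleMeasure]

theorem spaceMeasure_circle : SpaceMeasure circleMeasure (2 * Real.pi) fun _ => 1 := by
  refine ⟨fun _ => zero_le_one, fun _ => le_rfl, ?_, fun x y => ?_,
    fun f hf x => ?_, fun f f' hf hf' hd => ?_⟩
  · unfold circleMeasure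
    exact integrable_const (1 : ℝ)
  · nlinarith [sq_nonneg y]
  · have hc : Continuous fun y => ‖f y‖ ^ 2 := hf.cont.norm.pow 2
    have hp : Function.Periodic (fun y => ‖f y‖ ^ 2) (2 * Real.pi) := fun y => by
      simp only [hf.per y]
    rw [integral_circleMeasure]
    have h := hp.intervalIntegral_add_eq 0 (x - 2 * Real.pi)
    rw [zero_add, sub_add_cancel] at h
    rw [h]
    -- The interval `[x - 1, x]` lies in the full period `[x - 2π, x]`.
    exact intervalIntegral.integral_mono_interval (by linarith [Real.pi_gt_three]) (by linarith)
      le_rfl (Filter.Eventually.of_forall fun y => by positivity) (hc.intervalIntegrable _ _)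
  · rw [integral_circleMeasure, intervalIntegral.integral_eq_sub_of_hasDerivAt
      (fun x _ => hd x) (hf'.cont.intervalIntegrable _ _)]
    have := hf.per 0
    rw [zero_add] at this
    rw [this, sub_self]

theorem intMeasure_dyadicShell_le (k : ℕ) : intMeasure (dyadicShell k) ≤ 3 * 2 ^ k := by
  unfold intMeasure
  rw [measurableEmbedding_intCast.map_apply]
  have hsub : (Int.cast : ℤ → ℝ) ⁻¹' dyadicShell k
      ⊆ (Finset.Icc (-2 ^ k : ℤ) (2 ^ k) : Finset ℤ) := fun n hn => by
    have h := abs_le.1 (abs_le_of_mem_dyadicShell hn)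
    rw [Finset.coe_Icc]
    exact ⟨by exact_mod_cast h.1, by exact_mod_cast h.2⟩
  refine (measure_mono hsub).trans ?_
  rw [Measure.count_apply_finset, Int.card_Icc]
  have h1 : (2 ^ k + 1 - -2 ^ k : ℤ).toNat = 2 * 2 ^ k + 1 := by
    rw [show (2 ^ k + 1 - -2 ^ k : ℤ) = ((2 * 2 ^ k + 1 : ℕ) : ℤ) by push_cast; ring,
      Int.toNat_natCast]
  have h2 : 2 * 2 ^ k + 1 ≤ 3 * 2 ^ k := by
    have := Nat.one_le_two_pow (n := k)
    omega
  rw [h1]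
  exact_mod_cast h2

theorem angularHat_circleMeasure (f : ℝ → ℂ) (k : ℤ) :
    angularHat circleMeasure f k = circleHat f k := by
  unfold angularHat circleHat
  rw [integral_circleMeasure]
  simp

theorem circleBesovNorm_eq (s : ℝ) (r : ℝ≥0∞) (f : ℝ → ℂ) :
    circleBesovNorm s r f = dyadicNorm s r (shellNorm intMeasure (angularHat circleMeasure f)) := by
  unfold circleBesovNorm
  congr 1
  ext j
  unfold shellNorm intMeasure
  rw [measurableEmbedding_intCast.restrict_map, measurableEmbedding_intCast.eLpNorm_map_measure]
  congr 1
  ext k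
  exact (angularHat_circleMeasure f k).symm

theorem circleHat_deriv {f f' : ℝ → ℂ} (hf : Tame (2 * Real.pi) (fun _ => 1) f)
    (hf' : Tame (2 * Real.pi) (fun _ => 1) f') (hd : ∀ x, HasDerivAt f (f' x) x) (k : ℤ) :
    circleHat f' k = Complex.I * k * circleHat f k := by
  set e : ℝ → ℂ := fun x => Complex.exp (-(Complex.I * k * x)) with he
  have hed : ∀ x, HasDerivAt e (e x * -(Complex.I * k)) x := fun x => by
    have := ((Complex.ofRealCLM.hasDerivAt (x := x)).const_mul (Complex.I * k)).neg.cexp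
    simpa [he] using! this
  have hec : Continuous e := by fun_prop
  have hint : ∀ {g : ℝ → ℂ}, Tame (2 * Real.pi) (fun _ => 1) g →
      IntervalIntegrable (fun x => g x * e x) volume 0 (2 * Real.pi) := fun hg =>
    (hg.cont.mul hec).intervalIntegrable _ _
  have hz := intervalIntegral.integral_eq_sub_of_hasDerivAt (a := 0) (b := 2 * Real.pi)
    (f := fun x => f x * e x) (f' := fun x => f' x * e x - Complex.I * k * (f x * e x))
    (fun x _ => ((hd x).mul (hed x)).congr_deriv (by ring))
    ((hint hf').sub ((hint hf).const_mul _))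
  have hp : f (2 * Real.pi) * e (2 * Real.pi) = f 0 * e 0 := by
    have h1 := hf.per 0
    rw [zero_add] at h1
    have h2 : e (2 * Real.pi) = e 0 := by
      rw [he]
      simp only [Complex.ofReal_zero, mul_zero, neg_zero]
      rw [Complex.exp_eq_exp_iff_exists_int]
      exact ⟨-k, by push_cast; ring⟩
    rw [h1, h2]
  rw [intervalIntegral.integral_sub (hint hf') ((hint hf).const_mul _),
    intervalIntegral.integral_const_mul, hp, sub_self, sub_eq_zero] at hz
  unfold circleHat
  rw [hz]
  ring

theorem norm_circleHat_le (f : ℝ → ℂ) (k : ℤ) :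
    ‖circleHat f k‖ ≤ ∫ x, ‖f x‖ ∂circleMeasure := by
  rw [← angularHat_circleMeasure]
  exact norm_angularHat_le _

/-- Two derivatives give coefficients `O(k⁻²)`; the frequency `k = 0` is discarded as a finite set.
-/
theorem summable_norm_circleHat {f f₁ f₂ : ℝ → ℂ} (hf : Tame (2 * Real.pi) (fun _ => 1) f)
    (hf₁ : Tame (2 * Real.pi) (fun _ => 1) f₁) (hf₂ : Tame (2 * Real.pi) (fun _ => 1) f₂)
    (h₁ : ∀ x, HasDerivAt f (f₁ x) x) (h₂ : ∀ x, HasDerivAt f₁ (f₂ x) x) :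
    Summable fun k => ‖circleHat f k‖ := by
  have hs : Summable fun k : ℤ => (∫ x, ‖f₂ x‖ ∂circleMeasure) * (1 / (k : ℝ) ^ 2) :=
    (Real.summable_one_div_int_pow.2 one_lt_two).mul_left _
  refine hs.of_norm_bounded_eventually ?_
  have h0 : ∀ᶠ k : ℤ in Filter.cofinite, k ≠ 0 := by
    simpa using (Set.finite_singleton (0 : ℤ)).compl_mem_cofinite
  filter_upwards [h0] with k hk
  have hk2 : (0 : ℝ) < (k : ℝ) ^ 2 := by positivity
  have h := norm_circleHat_le f₂ k
  rw [circleHat_deriv hf₁ hf₂ h₂, circleHat_deriv hf hf₁ h₁, ← mul_assoc, norm_mul, norm_mul,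
    norm_mul, Complex.norm_I, one_mul, Complex.norm_intCast, ← pow_two, sq_abs] at h
  rw [norm_norm, mul_one_div, le_div_iff₀ hk2]
  linarith

theorem circle_hasFourierInversion {f f₁ f₂ : ℝ → ℂ} (hf : Tame (2 * Real.pi) (fun _ => 1) f)
    (hf₁ : Tame (2 * Real.pi) (fun _ => 1) f₁) (hf₂ : Tame (2 * Real.pi) (fun _ => 1) f₂)
    (h₁ : ∀ x, HasDerivAt f (f₁ x) x) (h₂ : ∀ x, HasDerivAt f₁ (f₂ x) x) :
    HasFourierInversion circleMeasure intMeasure f := by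
  have hs := summable_norm_circleHat hf hf₁ hf₂ h₁ h₂
  have hi : Integrable (angularHat circleMeasure f) intMeasure := by
    unfold intMeasure
    rw [measurableEmbedding_intCast.integrable_map_iff, integrable_count_iff]
    simpa only [Function.comp_def, angularHat_circleMeasure] using hs
  refine ⟨hi, fun x => ?_⟩
  have : Fact (0 < 2 * Real.pi) := ⟨Real.two_pi_pos⟩
  let F : C(AddCircle (2 * Real.pi), ℂ) := ⟨hf.per.lift, hf.cont.quotient_lift _⟩
  have hpi0 : (Real.pi : ℂ) ≠ 0 := by exact_mod_cast Real.pi_ne_zero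
  have hsq : ((Real.sqrt (2 * Real.pi))⁻¹ : ℝ) * ((Real.sqrt (2 * Real.pi))⁻¹ : ℝ)
      = 1 / (2 * Real.pi) := by
    rw [← mul_inv, Real.mul_self_sqrt Real.two_pi_pos.le, one_div]
  -- `fourierCoeff` is normalised by `1/(2π)` and `circleHat` by `(2π)^{-1/2}`.
  have hF : ∀ k : ℤ, fourierCoeff F k = ((Real.sqrt (2 * Real.pi))⁻¹ : ℝ) * circleHat f k :=
      fun k => by
    rw [fourierCoeff_eq_intervalIntegral _ k 0, zero_add]
    unfold circleHat
    rw [← mul_assoc, ← Complex.ofReal_mul, hsq, Complex.real_smul]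
    congr 1
    refine intervalIntegral.integral_congr fun y _ => ?_
    simp only [smul_eq_mul]
    rw [fourier_coe_apply, mul_comm]
    change f y * _ = _
    congr 2
    push_cast
    field_simp
  have hsum : Summable (fourierCoeff F) := by
    rw [show fourierCoeff F = _ from funext hF]
    exact hs.of_norm.mul_left _
  have hx := has_pointwise_sum_fourier_series_of_summable hsum (x : AddCircle (2 * Real.pi))
  have hi2 : Integrable (fun k : ℤ => circleHat f k * Complex.exp (Complex.I * (k : ℝ) * x))
      Measure.count := by
    rw [integrable_count_iff]
    simpa only [norm_mul, norm_exp_I_mul_mul, mul_one] using hs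
  unfold intMeasure
  rw [measurableEmbedding_intCast.integral_map]
  simp only [angularHat_circleMeasure]
  rw [integral_countable hi2, ← tsum_mul_left]
  refine hx.tsum_eq.symm.trans (tsum_congr fun k => ?_)
  rw [hF, fourier_coe_apply, smul_eq_mul, measureReal_def, Measure.count_singleton,
    ENNReal.toReal_one, one_smul, mul_assoc]
  congr 3
  push_cast
  field_simp

theorem ae_abs_mul_angularHat_circle_le {f f' : ℝ → ℂ}
    (hf : Tame (2 * Real.pi) (fun _ => 1) f) (hf' : Tame (2 * Real.pi) (fun _ => 1) f')
    (hd : ∀ x, HasDerivAt f (f' x) x) :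
    ∀ᵐ ξ ∂intMeasure, |ξ| * ‖angularHat circleMeasure f ξ‖ ≤ ∫ x, ‖f' x‖ ∂circleMeasure := by
  unfold intMeasure
  rw [measurableEmbedding_intCast.ae_map_iff]
  refine Filter.Eventually.of_forall fun k => ?_
  have h := norm_circleHat_le f' k
  rwa [circleHat_deriv hf hf' hd, norm_mul, norm_mul, Complex.norm_I, one_mul,
    Complex.norm_intCast, ← angularHat_circleMeasure] at h

theorem IsSmoothPeriodic.exists_bound {q : ℝ → ℝ → ℂ} (h : IsSmoothPeriodic q) (t : ℝ) :
    ∃ M : ℝ, ∀ τ, |τ - t| ≤ 1 → ∀ x, ‖q τ x‖ ≤ M := by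
  obtain ⟨M, hM⟩ := ((isCompact_Icc (a := t - 1) (b := t + 1)).prod
    (isCompact_Icc (a := 0) (b := 2 * Real.pi))).exists_bound_of_continuousOn
    h.1.continuous.continuousOn
  refine ⟨M, fun τ hτ x => ?_⟩
  -- Periodicity reduces the bound on the whole strip to the compact rectangle.
  obtain ⟨y, hy, hxy⟩ := (h.2 τ).exists_mem_Ico₀ Real.two_pi_pos x
  have h3 := abs_le.1 hτ
  rw [hxy]
  exact hM (τ, y) ⟨⟨by linarith [h3.1], by linarith [h3.2]⟩, hy.1, hy.2.le⟩

theorem IsSmoothPeriodic.tame {q : ℝ → ℝ → ℂ} (h : IsSmoothPeriodic q) (t : ℝ) :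
    Tame (2 * Real.pi) (fun _ => 1) (q t) := by
  obtain ⟨M, hM⟩ := h.exists_bound t
  refine ⟨h.1.continuous.comp (Continuous.prodMk_right t), h.2 t, M, fun x => ?_⟩
  rw [mul_one]
  exact hM t (by simp) x

theorem IsSmoothPeriodic.fderiv {q : ℝ → ℝ → ℂ} (h : IsSmoothPeriodic q) (v : ℝ × ℝ) :
    IsSmoothPeriodic fun t x => fderiv ℝ (Function.uncurry q) (t, x) v := by
  refine ⟨?_, fun t x => ?_⟩
  · change ContDiff ℝ ∞ fun z : ℝ × ℝ => _root_.fderiv ℝ (Function.uncurry q) z v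
    exact (h.1.fderiv_right (m := ∞) (by simp)).clm_apply contDiff_const
  · have e : (fun z : ℝ × ℝ => Function.uncurry q (z + (0, 2 * Real.pi))) = Function.uncurry q := by
      ext z
      simp only [Function.uncurry, Prod.fst_add, Prod.snd_add, add_zero]
      exact h.2 _ _
    have := fderiv_comp_add_right (𝕜 := ℝ) (f := Function.uncurry q) (x := (t, x))
      (0, 2 * Real.pi)
    rw [e] at this
    simp only [this, Prod.mk_add_mk, add_zero]

theorem IsSmoothPeriodic.hasDerivAt_space {q : ℝ → ℝ → ℂ} (h : IsSmoothPeriodic q) (t x : ℝ) :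
    HasDerivAt (q t) (_root_.fderiv ℝ (Function.uncurry q) (t, x) (0, 1)) x :=
  ((h.1.differentiable (by simp)) (t, x)).hasFDerivAt.comp_hasDerivAt x
    ((hasDerivAt_const x t).prodMk (hasDerivAt_id x))

theorem IsSmoothPeriodic.hasDerivAt_time {q : ℝ → ℝ → ℂ} (h : IsSmoothPeriodic q) (t x : ℝ) :
    HasDerivAt (fun τ => q τ x) (_root_.fderiv ℝ (Function.uncurry q) (t, x) (1, 0)) t :=
  HasFDerivAt.comp_hasDerivAt (f := fun τ => (τ, x)) t
    ((h.1.differentiable (by simp)) (t, x)).hasFDerivAt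
    ((hasDerivAt_id t).prodMk (hasDerivAt_const t x))

theorem IsSmoothPeriodic.exists_space_deriv {q : ℝ → ℝ → ℂ} (h : IsSmoothPeriodic q) :
    ∃ q₁, IsSmoothPeriodic q₁ ∧ ∀ t x, HasDerivAt (q t) (q₁ t x) x :=
  ⟨_, h.fderiv (0, 1), h.hasDerivAt_space⟩

theorem IsSmoothPeriodic.exists_time_deriv {q : ℝ → ℝ → ℂ} (h : IsSmoothPeriodic q) :
    ∃ qt, IsSmoothPeriodic qt ∧ ∀ t x, HasDerivAt (fun τ => q τ x) (qt t x) t :=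
  ⟨_, h.fderiv (1, 0), h.hasDerivAt_time⟩

theorem IsSmoothPeriodic.exists_isEvolution {q : ℝ → ℝ → ℂ} (h : IsSmoothPeriodic q)
    (hs : SolvesDNLS q) :
    ∃ q₁ q₂ qt, IsEvolution (2 * Real.pi) (fun _ => 1) q q₁ q₂ qt := by
  obtain ⟨q₁, h₁, d₁⟩ := h.exists_space_deriv
  obtain ⟨q₂, h₂, d₂⟩ := h₁.exists_space_deriv
  obtain ⟨qt, ht, dt⟩ := h.exists_time_deriv
  obtain ⟨qtt, htt, dtt⟩ := ht.exists_time_deriv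
  refine ⟨q₁, q₂, qt, h.tame, h₁.tame, h₂.tame, d₁, d₂,
    fun t x => hs.time_deriv_eq (dt t x) (d₁ t) (d₂ t x), fun t => ?_⟩
  obtain ⟨M, hM⟩ := htt.exists_bound t
  refine ⟨M, fun δ hδ x => ?_⟩
  rw [mul_one]
  exact norm_taylor_remainder_le (fun τ => dt τ x) (fun τ => dtt τ x)
    fun τ hτ => hM τ (hτ.trans hδ) x

end Circle

/-! ### The theorem, with the constants for line and circle chosen at once. -/

theorem theorem1 (s : ℝ) (hs0 : 0 < s) (hs1 : s < 1 / 2) (r : ℝ≥0∞) (hr : 1 ≤ r) :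
    ∃ c : ℝ, 0 < c ∧ c < 1 ∧ ∃ C : ℝ≥0,
      (∀ q : ℝ → 𝓢(ℝ, ℂ), IsSmoothSchwartzCurve q → SolvesDNLS (fun t x => q t x) →
        eLpNorm (fun x => q 0 x) 2 volume ≤ ENNReal.ofReal c →
        (⨆ t : ℝ, lineBesovNorm s r (fun x => q t x)) ≤ C * lineBesovNorm s r (fun x => q 0 x)) ∧
      (∀ q : ℝ → ℝ → ℂ, IsSmoothPeriodic q → SolvesDNLS q →
        eLpNorm (q 0) 2 (volume.restrict (Set.Ioc 0 (2 * Real.pi))) ≤ ENNReal.ofReal c →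
        (⨆ t : ℝ, circleBesovNorm s r (q t)) ≤ C * circleBesovNorm s r (q 0)) := by
  obtain ⟨S, hS⟩ := exists_dyadicNorm_dyadicAverage_le hs0 hs1
  have hS0 : (0 : ℝ) ≤ S := S.coe_nonneg
  -- This gives `66cS ≤ 1`, the absorption condition; `S + 1` in place of `S` also keeps `c ≤ 1/66`
  -- if `S` is small or zero.
  set c : ℝ := 1 / (66 * (S + 1)) with hc
  have hc0 : 0 < c := by positivity
  have hc8 : c ≤ 1 / 8 := by
    rw [hc]
    exact one_div_le_one_div_of_le (by norm_num) (by linarith)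
  have hcS : 66 * c * S ≤ 1 := by
    rw [hc, show 66 * (1 / (66 * ((S : ℝ) + 1))) * S = S / (S + 1) by field_simp]
    exact div_le_one_of_le₀ (by linarith) (by linarith)
  refine ⟨c, hc0, by linarith, 12 * S, fun q hq hs hm => iSup_le fun t => ?_,
    fun q hq hs hm => iSup_le fun t => ?_⟩
  · obtain ⟨q₁, q₂, qt, he⟩ := hq.exists_isEvolution hs
    have := he.dyadicNorm_le spaceMeasure_line volume_dyadicShell_le
      (fun t => (q t).hasFourierInversion)
      (fun t => (q t).exists_abs_mul_angularHat_le.imp fun C hC => Filter.Eventually.of_forall hC)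
      hs1 hr (hS r hr) hc0 hc8 hcS
      ((he.tame 0).integral_sq_le_of_eLpNorm_le spaceMeasure_line hc0.le hm) t
    rwa [angularHat_volume_eq_lineHat, angularHat_volume_eq_lineHat] at this
  · obtain ⟨q₁, q₂, qt, he⟩ := hq.exists_isEvolution hs
    rw [circleBesovNorm_eq, circleBesovNorm_eq]
    exact he.dyadicNorm_le spaceMeasure_circle intMeasure_dyadicShell_le
      (fun t => circle_hasFourierInversion (he.tame t) (he.tame₁ t) (he.tame₂ t) (he.deriv₁ t)
        (he.deriv₂ t))
      (fun t => ⟨_, ae_abs_mul_angularHat_circle_le (he.tame t) (he.tame₁ t) (he.deriv₁ t)⟩)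
      hs1 hr (hS r hr) hc0 hc8 hcS
      ((he.tame 0).integral_sq_le_of_eLpNorm_le spaceMeasure_circle hc0.le hm) t
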